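/- A complex Hadamard matrix (CHM) of order $n$ is an $n\times n$ complex matrix $H$ with all entries of modulus $1$ and $HH^{*}=nI$. Mutually unbiased bases (MUBs) of $\mathbb{C}^d$ are orthonormal bases such that any two vectors from different bases have inner product of modulus $1/\sqrt d$; an orthonormal basis is identified with the unitary matrix whose columns are its vectors. A CHM trio consists of three $6\times 6$ CHMs $H_1,H_2,H_3$ such that $I,\ H_1/\sqrt6,\ H_2/\sqrt6,\ H_3/\sqrt6$ are four MUBs of $\mathbb{C}^6$. A $6\times6$ matrix $M$ is said to belong to a set of four MUBs of $\mathbb{C}^6$ if $M=\sqrt6\,U^{*}V$ for two different bases $U,V$ of the set. Two matrices $A,B$ are (complex) equivalent if $A=PBQ$, where each of $P,Q$ is a diagonal matrix with entries of modulus $1$ times a permutation matrix. Let $\omega=e^{2\pi i/3}$ or $\omega=e^{4\pi i/3}$, and let $$M_1=\begin{bmatrix} i&1&1&1&1&1\\1&i&1&1&-1&-1\\1&1&i&-1&1&-1\\1&1&-1&i&-1&1\\1&-1&1&-1&i&1\\1&-1&-1&1&1&i\end{bmatrix},\quad M_2=\begin{bmatrix}\omega&\omega&1&1&1&1\\ \omega&-\omega&-1&1&-1&1\\1&1&\omega&\omega&1&1\\1&-1&-\omega&\omega&-1&1\\1&1&1&1&\omega&\omega\\-1&1&1&-1&\omega&-\omega\end{bmatrix},$$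 $$D_0=\begin{bmatrix}1&1&1&1&1&1\\1&-1&i&-i&-i&i\\1&i&-1&i&-i&-i\\1&-i&i&-1&i&-i\\1&-i&-i&i&-1&i\\1&i&-i&-i&i&-1\end{bmatrix}.$$ Theorem. 1. $M_1$ and $M_2$ are CHMs, and neither of them belongs to any CHM trio. 2. $M_1$ is equivalent to $D_0$. 3. $M_2$ contains the $3\times3$ submatrix $\begin{bmatrix}\omega&1&1\\1&\omega&1\\1&1&\omega\end{bmatrix}$, which is a CHM of order $3$. 4. More generally, no $6\times6$ matrix that is equivalent to $M_1$ or to $M_2$ belongs to any CHM trio. 5. Consequently, a $6\times 6$ CHM that has more than $22$ real entries and is equivalent to $M_1$ or to $M_2$ does not belong to any set of four MUBs of $\mathbb{C}^6$. -/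

import Mathlib

open scoped Matrix

noncomputable section

/-- A complex Hadamard matrix of order `n`: all entries have modulus one and `H Hᴴ = n I`. -/
structure IsCHM {n : ℕ} (H : Matrix (Fin n) (Fin n) ℂ) : Prop where
  norm_entry : ∀ i j, ‖H i j‖ = 1
  mul_conjTranspose : H * Hᴴ = (n : ℂ) • (1 : Matrix (Fin n) (Fin n) ℂ)

/-- `k` mutually unbiased bases of `ℂ^d`. Each basis is given by the matrix whose columns are the
basis vectors: every matrix is unitary (the columns form an orthonormal basis), and two vectors
from different bases have an inner product of modulus `1 / √d`. -/
structure IsMUBFamily {d k : ℕ} (B : Fin k → Matrix (Fin d) (Fin d) ℂ) : Prop where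
  unitary : ∀ i, B i ∈ Matrix.unitaryGroup (Fin d) ℂ
  unbiased : ∀ i j, i ≠ j → ∀ a b, ‖((B i)ᴴ * B j) a b‖ = 1 / √(d : ℝ)

/-- The orthonormal basis `H / √6` belonging to a complex Hadamard matrix `H` of order six. -/
def normalizedCHM (H : Matrix (Fin 6) (Fin 6) ℂ) : Matrix (Fin 6) (Fin 6) ℂ :=
  ((1 / √6 : ℝ) : ℂ) • H

/-- A CHM trio: three complex Hadamard matrices of order six which, suitably normalized, form
together with the identity matrix (the standard basis) four mutually unbiased bases of `ℂ^6`. -/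
structure IsCHMTrio (H : Fin 3 → Matrix (Fin 6) (Fin 6) ℂ) : Prop where
  isCHM : ∀ i, IsCHM (H i)
  isMUB : IsMUBFamily ![(1 : Matrix (Fin 6) (Fin 6) ℂ),
    normalizedCHM (H 0), normalizedCHM (H 1), normalizedCHM (H 2)]

/-- `M` is a member of some CHM trio. -/
def BelongsToCHMTrio (M : Matrix (Fin 6) (Fin 6) ℂ) : Prop :=
  ∃ H : Fin 3 → Matrix (Fin 6) (Fin 6) ℂ, IsCHMTrio H ∧ ∃ i, H i = M

/-- `M` is a Hadamard matrix of some set of four mutually unbiased bases of `ℂ^6`, that is,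
`M = √6 Uᴴ V` for two different bases `U`, `V` of the set (if `U` is the standard basis, this says
that `M / √6` is itself one of the bases). -/
def BelongsToMUBQuadruple (M : Matrix (Fin 6) (Fin 6) ℂ) : Prop :=
  ∃ B : Fin 4 → Matrix (Fin 6) (Fin 6) ℂ, IsMUBFamily B ∧
    ∃ i j, i ≠ j ∧ M = ((√6 : ℝ) : ℂ) • ((B i)ᴴ * B j)

/-- A complex permutation matrix: a diagonal matrix with entries of modulus one times a
permutation matrix. -/
def IsComplexPermutation {n : ℕ} (P : Matrix (Fin n) (Fin n) ℂ) : Prop :=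
  ∃ (u : Fin n → ℂ) (σ : Equiv.Perm (Fin n)),
    (∀ i, ‖u i‖ = 1) ∧ P = Matrix.diagonal u * σ.permMatrix ℂ

/-- (Complex) equivalence of matrices: `A = P B Q` with complex permutation matrices `P`, `Q`. -/
def ComplexEquivalent {n : ℕ} (A B : Matrix (Fin n) (Fin n) ℂ) : Prop :=
  ∃ P Q : Matrix (Fin n) (Fin n) ℂ,
    IsComplexPermutation P ∧ IsComplexPermutation Q ∧ A = P * B * Q

/-- The number of real entries of a matrix. -/
def realEntryCount {n : ℕ} (A : Matrix (Fin n) (Fin n) ℂ) : ℕ :=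
  Set.ncard {p : Fin n × Fin n | (A p.1 p.2).im = 0}

/-- The first matrix. -/
def matM1 : Matrix (Fin 6) (Fin 6) ℂ :=
  !![Complex.I, 1, 1, 1, 1, 1;
     1, Complex.I, 1, 1, -1, -1;
     1, 1, Complex.I, -1, 1, -1;
     1, 1, -1, Complex.I, -1, 1;
     1, -1, 1, -1, Complex.I, 1;
     1, -1, -1, 1, 1, Complex.I]

/-- The second matrix; it is used for the two primitive cube roots of unity `ω`. -/
def matM2 (ω : ℂ) : Matrix (Fin 6) (Fin 6) ℂ :=
  !![ω, ω, 1, 1, 1, 1;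
     ω, -ω, -1, 1, -1, 1;
     1, 1, ω, ω, 1, 1;
     1, -1, -ω, ω, -1, 1;
     1, 1, 1, 1, ω, ω;
     -1, 1, 1, -1, ω, -ω]

/-- The matrix `D_0`. -/
def matD0 : Matrix (Fin 6) (Fin 6) ℂ :=
  !![1, 1, 1, 1, 1, 1;
     1, -1, Complex.I, -Complex.I, -Complex.I, Complex.I;
     1, Complex.I, -1, Complex.I, -Complex.I, -Complex.I;
     1, -Complex.I, Complex.I, -1, Complex.I, -Complex.I;
     1, -Complex.I, -Complex.I, Complex.I, -1, Complex.I;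
     1, Complex.I, -Complex.I, -Complex.I, Complex.I, -1]

/-- The `3 × 3` submatrix of the second matrix. -/
def matC3 (ω : ℂ) : Matrix (Fin 3) (Fin 3) ℂ :=
  !![ω, 1, 1;
     1, ω, 1;
     1, 1, ω]

end

/-! Everything is reduced to one obstruction, `HasUnbiasedPair`. If `H = P M Q` equals `√6 Uᴴ V` for
two of four mutually unbiased bases, then applying `√6 Pᴴ Uᴴ` to the other two bases yields two
mutually unbiased bases, all of whose vectors are unbiased to the standard basis and to the columns
of `M` (`ComplexEquivalent.hasUnbiasedPair`). So the vectors unbiased to both have to be determined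
for `M₁` and `M₂`.

The matrix `M₂`. Up to phases and order it is the Fourier matrix of `ℤ/2 × ℤ/3`. A vector splits
into halves `a, b ∈ ℂ³`, and unbiasedness says that `a + b` and `a - b` have flat Fourier
transforms, that is, vanishing autocorrelation. Writing `a = g ξ` and `b = g ξ̄` entrywise turns `a
± b` into `g` times real numbers, and two types remain: product type, `b = ± i a`, and mixed type,
where `ξ` is one explicit triple up to phase and order
(`IsFourierUnbiased.isProductType_or_isMixedType`, `IsMixedType.exists_mixedTriple`). Two mixed
vectors are never unbiased (`IsMixedType.not_unbiased`), so one of the two bases consists of product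
vectors. These are eigenvectors of the traceless Hermitian operator `pairingMatrix`, whose
expectation at a vector unbiased to the whole basis is therefore zero. But this expectation is a
nonzero multiple of `Im ∑ a b̄`, which never vanishes (`IsFourierUnbiased.inner_im_ne_zero`).

The matrix `M₁`. It is `i + C` with `C` a symmetric conference matrix. After two sign changes and
grouping the coordinates into three blocks `w_j ∈ ℂ²`, `C` becomes `1 ⊗ (Z + 2X) - J ⊗ (Z + X)`,
where `X, Y, Z` are the Pauli matrices and `J` is the all-ones matrix, so permuting the blocks is a
symmetry. If `W = ∑ w_j` is nonzero, all `w_j` have the same real inner product with a spinor `d`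
that depends linearly on `W`. Hence `w_j = (1 - i q_j·σ) d / 2` with `q_j ∈ ℝ³`, and the conditions
become a real polynomial system in the `q_j` and the Bloch vector of `d`. In the orthogonal frame
`(1,-1,1)`, `(-1,1,2)`, `(-1,-1,0)`, of squared lengths 3, 6, 2, the coordinates of `q_j` are `(x_j,
t_j, y_j)` and those of the Bloch vector are `(b, s, g)`; this is `IsBlochSystem`. Each of its
solutions is, up to order, one of 24 (`IsBlochSystem.exists_isBlochDecimal`), and `W = 0` adds two
vectors (`IsConferenceUnbiased.of_sum_eq_zero`).

For all 26 vectors, and every relative order of the blocks, the squared modulus of the inner product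
stays away from 6 (`vectorTable_norm`). The gap is wide enough for decimal approximations with crude
error bounds, so no two vectors unbiased to the standard basis and `M₁` are unbiased to each other.
-/

/-- The vector `v` has unimodular entries and its inner products with the columns of `M` all have
modulus `√6`. -/
structure IsUnbiasedTo (M : Matrix (Fin 6) (Fin 6) ℂ) (v : Fin 6 → ℂ) : Prop where
  norm_entry : ∀ k, ‖v k‖ = 1
  norm_inner : ∀ j, ‖(Mᴴ *ᵥ v) j‖ = √6

/-- Two mutually unbiased bases (up to normalization) that are unbiased to the standard basis and
to the basis of the columns of `M`. -/
def HasUnbiasedPair (M : Matrix (Fin 6) (Fin 6) ℂ) : Prop :=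
  ∃ A B : Matrix (Fin 6) (Fin 6) ℂ, (∀ j, IsUnbiasedTo M (A.col j)) ∧
    (∀ j, IsUnbiasedTo M (B.col j)) ∧ Aᴴ * A = (6 : ℂ) • 1 ∧ Bᴴ * B = (6 : ℂ) • 1 ∧
    ∀ i j, ‖(Aᴴ * B) i j‖ = √6

/-! ### Reduction from four mutually unbiased bases to an unbiased pair -/

lemma BelongsToCHMTrio.belongsToMUBQuadruple {M : Matrix (Fin 6) (Fin 6) ℂ}
    (h : BelongsToCHMTrio M) : BelongsToMUBQuadruple M := by
  obtain ⟨H, hH, i, rfl⟩ := h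
  refine ⟨_, hH.isMUB, 0, i.succ, (Fin.succ_ne_zero i).symm, ?_⟩
  fin_cases i <;>
  · ext a b
    simp [normalizedCHM]

lemma Equiv.Perm.permMatrix_mul_apply' {n : ℕ} (σ : Equiv.Perm (Fin n))
    (A : Matrix (Fin n) (Fin n) ℂ) (i j : Fin n) : (σ.permMatrix ℂ * A) i j = A (σ i) j := by
  simp [Equiv.Perm.permMatrix, PEquiv.toMatrix_toPEquiv_mul]

lemma Equiv.Perm.conjTranspose_permMatrix_mul {n : ℕ} (σ : Equiv.Perm (Fin n)) :
    (σ.permMatrix ℂ)ᴴ * σ.permMatrix ℂ = 1 := by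
  rw [Matrix.conjTranspose_permMatrix, ← Matrix.permMatrix_mul]
  simp

lemma conj_mul_self_of_norm {z : ℂ} (h : ‖z‖ = 1) : star z * z = 1 := by
  have := Complex.conj_mul' z
  rw [h] at this
  simpa using this

lemma IsComplexPermutation.conjTranspose_mul_self {n : ℕ} {P : Matrix (Fin n) (Fin n) ℂ}
    (h : IsComplexPermutation P) : Pᴴ * P = 1 := by
  obtain ⟨u, σ, hu, rfl⟩ := h
  have hd : (Matrix.diagonal u)ᴴ * Matrix.diagonal u = 1 := by
    rw [Matrix.diagonal_conjTranspose, Matrix.diagonal_mul_diagonal, ← Matrix.diagonal_one]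
    congr 1
    ext i
    exact conj_mul_self_of_norm (hu i)
  rw [Matrix.conjTranspose_mul, Matrix.mul_assoc, ← Matrix.mul_assoc _ (Matrix.diagonal u), hd,
    Matrix.one_mul, σ.conjTranspose_permMatrix_mul]

lemma IsComplexPermutation.norm_mul_apply {n : ℕ} {P : Matrix (Fin n) (Fin n) ℂ}
    (h : IsComplexPermutation P) {r : ℝ} {A : Matrix (Fin n) (Fin n) ℂ}
    (hA : ∀ i j, ‖A i j‖ = r) (i j : Fin n) : ‖(P * A) i j‖ = r := by
  obtain ⟨u, σ, hu, rfl⟩ := h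
  rw [Matrix.mul_assoc, Matrix.diagonal_mul, norm_mul, hu, one_mul, σ.permMatrix_mul_apply', hA]

lemma IsComplexPermutation.conjTranspose {n : ℕ} {P : Matrix (Fin n) (Fin n) ℂ}
    (h : IsComplexPermutation P) : IsComplexPermutation Pᴴ := by
  obtain ⟨u, σ, hu, rfl⟩ := h
  refine ⟨fun i => star (u (σ⁻¹ i)), σ⁻¹, fun i => by simp [hu], ?_⟩
  rw [Matrix.conjTranspose_mul, Matrix.diagonal_conjTranspose, Matrix.conjTranspose_permMatrix]
  ext i j
  rw [Equiv.Perm.permMatrix_mul_apply', Matrix.diagonal_mul, Matrix.diagonal_apply]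
  by_cases hij : σ⁻¹ i = j
  · subst hij; simp
  · have : (σ⁻¹.permMatrix ℂ) i j = 0 := by
      rw [← Matrix.mul_one (σ⁻¹.permMatrix ℂ), Equiv.Perm.permMatrix_mul_apply',
        Matrix.one_apply_ne hij]
    rw [if_neg hij, this, mul_zero]

lemma IsMUBFamily.norm_smul_apply {B : Fin 4 → Matrix (Fin 6) (Fin 6) ℂ} (hB : IsMUBFamily B)
    {i j : Fin 4} (hij : i ≠ j) (a b : Fin 6) :
    ‖(((√6 : ℝ) : ℂ) • ((B i)ᴴ * B j)) a b‖ = 1 := by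
  rw [Matrix.smul_apply, norm_smul, hB.unbiased i j hij, Complex.norm_real, Real.norm_eq_abs,
    abs_of_nonneg (Real.sqrt_nonneg _)]
  have : √(6 : ℝ) ≠ 0 := by positivity
  push_cast
  field_simp

lemma sqrt_six_mul_self : ((√6 : ℝ) : ℂ) * ((√6 : ℝ) : ℂ) = 6 := by
  rw [← Complex.ofReal_mul, Real.mul_self_sqrt (by norm_num)]
  norm_num

lemma IsMUBFamily.smul_conjTranspose_mul {B : Fin 4 → Matrix (Fin 6) (Fin 6) ℂ}
    (hB : IsMUBFamily B) (i j k : Fin 4) :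
    (((√6 : ℝ) : ℂ) • ((B i)ᴴ * B j))ᴴ * (((√6 : ℝ) : ℂ) • ((B i)ᴴ * B k)) =
      (6 : ℂ) • ((B j)ᴴ * B k) := by
  have h1 : B i * (B i)ᴴ = 1 := Matrix.mem_unitaryGroup_iff.1 (hB.unitary i)
  rw [Matrix.conjTranspose_smul, Matrix.conjTranspose_mul, Matrix.conjTranspose_conjTranspose,
    Matrix.smul_mul, Matrix.mul_smul, smul_smul, Matrix.mul_assoc, ← Matrix.mul_assoc (B i), h1,
    Matrix.one_mul]
  congr 1
  simpa using sqrt_six_mul_self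

lemma IsMUBFamily.norm_six_smul {B : Fin 4 → Matrix (Fin 6) (Fin 6) ℂ} (hB : IsMUBFamily B)
    {i j : Fin 4} (hij : i ≠ j) (a b : Fin 6) : ‖((6 : ℂ) • ((B i)ᴴ * B j)) a b‖ = √6 := by
  rw [Matrix.smul_apply, norm_smul, hB.unbiased i j hij]
  have : √(6 : ℝ) ≠ 0 := by positivity
  norm_num
  rw [← div_eq_mul_inv, div_eq_iff this, Real.mul_self_sqrt (by norm_num)]

/-- Multiplication by `(B i)ᴴ` makes `B i` the standard basis and turns `B j` into `H / √6`; the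
further factor `Pᴴ` replaces the columns of `H` by those of `M Q`. Complex permutations preserve
constant moduli of entries, so the images of the two remaining bases form the pair. -/
lemma ComplexEquivalent.hasUnbiasedPair {H M : Matrix (Fin 6) (Fin 6) ℂ}
    (hHM : ComplexEquivalent H M) (hH : BelongsToMUBQuadruple H) : HasUnbiasedPair M := by
  obtain ⟨P, Q, hP, hQ, rfl⟩ := hHM
  obtain ⟨B, hB, i, j, hij, hH⟩ := hH
  obtain ⟨k, l, hki, hkj, hli, hlj, hkl⟩ :
      ∃ k l : Fin 4, k ≠ i ∧ k ≠ j ∧ l ≠ i ∧ l ≠ j ∧ k ≠ l := by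
    clear hH hB
    revert i j
    decide
  set X : Fin 4 → Matrix (Fin 6) (Fin 6) ℂ := fun m => ((√6 : ℝ) : ℂ) • ((B i)ᴴ * B m) with hX
  have hself : ∀ m, (X m)ᴴ * X m = (6 : ℂ) • 1 := by
    intro m
    rw [hX, hB.smul_conjTranspose_mul]
    congr 1
    exact Matrix.mem_unitaryGroup_iff'.1 (hB.unitary m)
  have hPP : P * Pᴴ = 1 := by
    have := hP.conjTranspose.conjTranspose_mul_self
    rwa [Matrix.conjTranspose_conjTranspose] at this
  have hQQ : Q * Qᴴ = 1 := by
    have := hQ.conjTranspose.conjTranspose_mul_self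
    rwa [Matrix.conjTranspose_conjTranspose] at this
  have hcol : ∀ m, m ≠ i → m ≠ j → ∀ a, IsUnbiasedTo M ((Pᴴ * X m).col a) := by
    intro m hmi hmj a
    constructor
    · intro b
      exact hP.conjTranspose.norm_mul_apply (fun c d => hB.norm_smul_apply hmi.symm c d) b a
    · intro b
      -- From `H = P M Q` with `Q` unitary, `Mᴴ Pᴴ = Q Hᴴ`.
      have h1 : Mᴴ * (Pᴴ * X m) = Q * ((6 : ℂ) • ((B j)ᴴ * B m)) := by
        rw [← hB.smul_conjTranspose_mul i j m, ← hH, Matrix.conjTranspose_mul,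
          Matrix.conjTranspose_mul, Matrix.mul_assoc, ← Matrix.mul_assoc Q, hQQ, Matrix.one_mul,
          Matrix.mul_assoc]
      have h2 : (Mᴴ *ᵥ (Pᴴ * X m).col a) b = (Mᴴ * (Pᴴ * X m)) b a := rfl
      rw [h2, h1]
      exact hQ.norm_mul_apply (fun c d => hB.norm_six_smul hmj.symm c d) b a
  have hmul : ∀ m m', (Pᴴ * X m)ᴴ * (Pᴴ * X m') = (X m)ᴴ * X m' := by
    intro m m'
    rw [Matrix.conjTranspose_mul, Matrix.conjTranspose_conjTranspose, Matrix.mul_assoc,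
      ← Matrix.mul_assoc P, hPP, Matrix.one_mul]
  refine ⟨Pᴴ * X k, Pᴴ * X l, hcol k hki hkj, hcol l hli hlj, ?_, ?_, ?_⟩
  · rw [hmul, hself]
  · rw [hmul, hself]
  · intro a b
    rw [hmul, hX, hB.smul_conjTranspose_mul]
    exact hB.norm_six_smul hkl a b

lemma ComplexEquivalent.refl {n : ℕ} (M : Matrix (Fin n) (Fin n) ℂ) : ComplexEquivalent M M := by
  have h : IsComplexPermutation (1 : Matrix (Fin n) (Fin n) ℂ) :=
    ⟨fun _ => 1, 1, fun _ => by simp, by simp⟩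
  exact ⟨1, 1, h, h, by simp⟩

/-! ### The explicit matrices: Hadamard property, submatrix, equivalence with `D₀` -/

lemma isCHM_matM1 : IsCHM matM1 := by
  constructor
  · intro i j
    fin_cases i <;> fin_cases j <;> simp [matM1]
  · ext i j
    fin_cases i <;> fin_cases j <;>
      simp [matM1, Matrix.mul_apply, Fin.sum_univ_succ] <;> norm_num

lemma cube_root_properties {ω : ℂ}
    (hω : ω = Complex.exp (2 * Real.pi * Complex.I / 3) ∨
      ω = Complex.exp (4 * Real.pi * Complex.I / 3)) :
    ‖ω‖ = 1 ∧ ω ^ 2 + ω + 1 = 0 := by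
  have key : ∀ k : ℕ, k = 1 ∨ k = 2 →
      Complex.exp (2 * Real.pi * Complex.I * (k / 3)) ^ 2 +
        Complex.exp (2 * Real.pi * Complex.I * (k / 3)) + 1 = 0 := by
    intro k hk
    have h := Complex.isPrimitiveRoot_exp_of_coprime k 3 (by norm_num)
      (by rcases hk with rfl | rfl <;> norm_num)
    have := h.geom_sum_eq_zero (by norm_num)
    rw [Finset.sum_range_succ, Finset.sum_range_succ, Finset.sum_range_one] at this
    push_cast at this
    linear_combination this
  have h : ω ^ 2 + ω + 1 = 0 := by
    rcases hω with rfl | rfl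
    · convert key 1 (Or.inl rfl) using 5 <;> push_cast <;> ring
    · convert key 2 (Or.inr rfl) using 5 <;> push_cast <;> ring
  refine ⟨?_, h⟩
  have h3 : ω ^ 3 = 1 := by linear_combination (ω - 1) * h
  exact Complex.norm_eq_one_of_pow_eq_one h3 (by norm_num)

lemma star_cube_root {ω : ℂ} (h1 : ‖ω‖ = 1) (h : ω ^ 2 + ω + 1 = 0) :
    (starRingEnd ℂ) ω = -1 - ω := by
  have h0 : ω ≠ 0 := by
    rintro rfl
    simp at h
  have := Complex.mul_conj' ω
  rw [h1] at this
  apply mul_left_cancel₀ h0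
  rw [this]
  push_cast
  linear_combination h

lemma isCHM_matM2 {ω : ℂ} (h1 : ‖ω‖ = 1) (h : ω ^ 2 + ω + 1 = 0) : IsCHM (matM2 ω) := by
  constructor
  · intro i j
    fin_cases i <;> fin_cases j <;> simp [matM2, h1]
  · have hc := star_cube_root h1 h
    ext i j
    fin_cases i <;> fin_cases j <;>
      simp [matM2, Matrix.mul_apply, Fin.sum_univ_succ, hc] <;>
      first
      | ring1
      | linear_combination (-2 : ℂ) * h

lemma isCHM_matC3 {ω : ℂ} (h1 : ‖ω‖ = 1) (h : ω ^ 2 + ω + 1 = 0) : IsCHM (matC3 ω) := by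
  constructor
  · intro i j
    fin_cases i <;> fin_cases j <;> simp [matC3, h1]
  · have hc := star_cube_root h1 h
    ext i j
    fin_cases i <;> fin_cases j <;>
      simp [matC3, Matrix.mul_apply, Fin.sum_univ_succ, hc] <;>
      first
      | ring1
      | linear_combination (-1 : ℂ) * h

lemma matM2_submatrix (ω : ℂ) : (matM2 ω).submatrix ![0, 2, 4] ![0, 2, 4] = matC3 ω := by
  ext i j
  fin_cases i <;> fin_cases j <;> simp [matM2, matC3]

lemma complexEquivalent_matM1_matD0 : ComplexEquivalent matM1 matD0 := by
  -- Multiplying all rows of `D₀` but the first by `-i` makes the entries `±i` real and the diagonal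
  -- entries `-1` equal to `i`; multiplying the first column by `i` repairs the border. The
  -- relabelling `s` of the last three indices, used for rows and columns alike, matches the sign
  -- patterns.
  let s : Equiv.Perm (Fin 6) := ⟨![0, 1, 2, 5, 3, 4], ![0, 1, 2, 4, 5, 3], by decide, by decide⟩
  let u : Fin 6 → ℂ := ![1, -Complex.I, -Complex.I, -Complex.I, -Complex.I, -Complex.I]
  let w : Fin 6 → ℂ := ![Complex.I, 1, 1, 1, 1, 1]
  refine ⟨_, _, ⟨u, s, ?_, rfl⟩, ⟨w, s⁻¹, ?_, rfl⟩, ?_⟩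
  · intro i
    fin_cases i <;> simp [u]
  · intro i
    fin_cases i <;> simp [w]
  · ext i j
    have : (Matrix.diagonal u * s.permMatrix ℂ * matD0 * (Matrix.diagonal w * s⁻¹.permMatrix ℂ)) i j
        = u i * matD0 (s i) (s j) * w (s j) := by
      rw [Matrix.mul_assoc (Matrix.diagonal u), ← Matrix.mul_assoc, Equiv.Perm.permMatrix,
        Equiv.Perm.permMatrix, PEquiv.mul_toMatrix_toPEquiv, Matrix.submatrix_apply,
        Matrix.mul_diagonal, Matrix.diagonal_mul, PEquiv.toMatrix_toPEquiv_mul]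
      rfl
    rw [this]
    fin_cases i <;> fin_cases j <;> simp [matM1, matD0, s, u, w]

/-! ### Vectors unbiased to the Fourier basis: product type and mixed type -/

open ComplexConjugate

lemma Complex.mul_conj_of_norm_eq_one {z : ℂ} (h : ‖z‖ = 1) : z * conj z = 1 := by
  rw [Complex.mul_conj', h]; norm_num

lemma Complex.re_sq_add_im_sq_of_norm_eq_one {z : ℂ} (h : ‖z‖ = 1) : z.re ^ 2 + z.im ^ 2 = 1 := by
  have := Complex.sq_norm z
  rw [h, Complex.normSq_apply] at this
  linarith

lemma Complex.norm_eq_one_of_mul_conj {z : ℂ} (h : z * conj z = 1) : ‖z‖ = 1 := by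
  rw [Complex.mul_conj'] at h
  have h2 : ‖z‖ ^ 2 = 1 := by exact_mod_cast h
  exact (pow_eq_one_iff_of_nonneg (norm_nonneg z) two_ne_zero).1 h2

/-- Two unimodular numbers have a common unimodular factor up to which they are conjugate. -/
lemma exists_polar_pair {a b : ℂ} (ha : ‖a‖ = 1) (hb : ‖b‖ = 1) :
    ∃ g ξ : ℂ, ‖g‖ = 1 ∧ ‖ξ‖ = 1 ∧ a = g * ξ ∧ b = g * conj ξ := by
  obtain ⟨g, hg⟩ := IsAlgClosed.exists_pow_nat_eq (a * b) (n := 2) (by norm_num)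
  have hgn : ‖g‖ = 1 := by
    have : ‖g‖ ^ 2 = 1 := by rw [← norm_pow, hg, norm_mul, ha, hb, one_mul]
    exact (pow_eq_one_iff_of_nonneg (norm_nonneg g) two_ne_zero).1 this
  have h1 := Complex.mul_conj_of_norm_eq_one ha
  have h2 := Complex.mul_conj_of_norm_eq_one hgn
  refine ⟨g, conj g * a, hgn, by simp [hgn, ha], by linear_combination (-a) * h2, ?_⟩
  simp only [map_mul, Complex.conj_conj]
  linear_combination (-conj a) * hg - b * h1

/-- The conditions for `(a, b)` to be unbiased to the standard basis and to the Fourier basis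
of `ℤ/2 × ℤ/3`. -/
structure IsFourierUnbiased (a b : Fin 3 → ℂ) : Prop where
  norm_left : ∀ x, ‖a x‖ = 1
  norm_right : ∀ x, ‖b x‖ = 1
  auto : a 0 * conj (a 1) + a 1 * conj (a 2) + a 2 * conj (a 0) +
    (b 0 * conj (b 1) + b 1 * conj (b 2) + b 2 * conj (b 0)) = 0
  cross : a 0 * conj (b 1) + a 1 * conj (b 2) + a 2 * conj (b 0) +
    (b 0 * conj (a 1) + b 1 * conj (a 2) + b 2 * conj (a 0)) = 0
  re_inner : (a 0 * conj (b 0) + a 1 * conj (b 1) + a 2 * conj (b 2)).re = 0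

/-- The product type: the second half is `±i` times the first half. -/
def IsProductType (a b : Fin 3 → ℂ) : Prop :=
  ∃ μ : ℂ, (μ = Complex.I ∨ μ = -Complex.I) ∧ ∀ x, b x = μ * a x

/-- The other type of unbiased vectors. -/
structure IsMixedType (a b g ξ : Fin 3 → ℂ) (η : ℂ) : Prop where
  norm_g : ∀ x, ‖g x‖ = 1
  norm_ξ : ∀ x, ‖ξ x‖ = 1
  left : ∀ x, a x = g x * ξ x
  right : ∀ x, b x = g x * conj (ξ x)
  ratio01 : g 0 * conj (g 1) = η
  ratio12 : g 1 * conj (g 2) = η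
  ratio20 : g 2 * conj (g 0) = η
  re_sum : (ξ 0).re * (ξ 1).re + (ξ 1).re * (ξ 2).re + (ξ 2).re * (ξ 0).re = 0
  im_sum : (ξ 0).im * (ξ 1).im + (ξ 1).im * (ξ 2).im + (ξ 2).im * (ξ 0).im = 0
  re_sq : (ξ 0).re ^ 2 + (ξ 1).re ^ 2 + (ξ 2).re ^ 2 = 3 / 2
  im_sq : (ξ 0).im ^ 2 + (ξ 1).im ^ 2 + (ξ 2).im ^ 2 = 3 / 2

/-- If `c₀` vanished, the relation would reduce to `E c₁ c₂ = 0`, so a second real number would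
vanish, and the square of the last one would be `3 / 2 > 1`. -/
lemma ne_zero_of_unimodular_sum {E : ℂ} {c₀ c₁ c₂ : ℝ} {E' E'' : ℂ} (hE : E ≠ 0)
    (h1 : c₁ ^ 2 ≤ 1) (h2 : c₂ ^ 2 ≤ 1) (hs : c₀ ^ 2 + c₁ ^ 2 + c₂ ^ 2 = 3 / 2)
    (h : E' * (c₀ * c₁) + E * (c₁ * c₂) + E'' * (c₂ * c₀) = 0) : c₀ ≠ 0 := by
  rintro rfl
  have : E * ((c₁ : ℂ) * c₂) = 0 := by simpa using h
  have : (c₁ : ℂ) * c₂ = 0 := (mul_eq_zero.1 this).resolve_left hE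
  have : c₁ * c₂ = 0 := by exact_mod_cast this
  rcases mul_eq_zero.1 this with rfl | rfl <;> norm_num at hs <;> linarith

/-- Two real relations between three unimodular numbers make them collinear. -/
lemma collinear_of_relations {E₀ E₁ E₂ : ℂ} (hE₀ : ‖E₀‖ = 1)
    {c₀ c₁ c₂ s₀ s₁ s₂ : ℝ} (hc : c₂ ≠ 0) (hs : s₂ ≠ 0) (hne : c₁ * s₀ ≠ c₀ * s₁)
    (h : E₀ * (c₀ * c₁) + E₁ * (c₁ * c₂) + E₂ * (c₂ * c₀) = 0)
    (h' : E₀ * (s₀ * s₁) + E₁ * (s₁ * s₂) + E₂ * (s₂ * s₀) = 0) :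
    (E₁ * conj E₀).im = 0 ∧ (E₂ * conj E₀).im = 0 := by
  have key : ∀ {c₀ c₁ c₂ : ℝ}, E₀ * (c₀ * c₁) + E₁ * (c₁ * c₂) + E₂ * (c₂ * c₀) = 0 →
      (E₁ * conj E₀).im * (c₁ * c₂) + (E₂ * conj E₀).im * (c₂ * c₀) = 0 := by
    intro c₀ c₁ c₂ h
    have h1 := Complex.mul_conj_of_norm_eq_one hE₀
    have h2 : ((c₀ * c₁ : ℝ) : ℂ) + (E₁ * conj E₀) * ((c₁ * c₂ : ℝ) : ℂ) +
        (E₂ * conj E₀) * ((c₂ * c₀ : ℝ) : ℂ) = 0 := by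
      push_cast
      linear_combination conj E₀ * h - ((c₀ : ℂ) * c₁) * h1
    have := congrArg Complex.im h2
    simpa [Complex.add_im, Complex.im_mul_ofReal] using this
  have k1 := key h
  have k2 := key h'
  -- `k1` and `k2` form a homogeneous real linear system for the two imaginary parts, and this is
  -- its determinant.
  have hd : c₂ * s₂ * (c₁ * s₀ - c₀ * s₁) ≠ 0 :=
    mul_ne_zero (mul_ne_zero hc hs) (sub_ne_zero.2 hne)
  constructor
  · apply (mul_eq_zero (a := c₂ * s₂ * (c₁ * s₀ - c₀ * s₁)) |>.1 ?_).resolve_left hd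
    linear_combination s₂ * s₀ * k1 - c₂ * c₀ * k2
  · apply (mul_eq_zero (a := c₂ * s₂ * (c₁ * s₀ - c₀ * s₁)) |>.1 ?_).resolve_left hd
    linear_combination -s₁ * s₂ * k1 + c₁ * c₂ * k2

lemma eq_or_eq_neg_of_im_eq_zero {z w : ℂ} (hz : ‖z‖ = 1) (hw : ‖w‖ = 1)
    (h : (z * conj w).im = 0) : z = w ∨ z = -w := by
  have h1 := Complex.mul_conj_of_norm_eq_one hw
  have hr : ((z * conj w).re : ℂ) = z * conj w := by
    apply Complex.ext <;> simp only [Complex.ofReal_re, Complex.ofReal_im, h]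
  have h2 : ‖z * conj w‖ = 1 := by simp [hz, hw]
  rw [← hr, Complex.norm_real, Real.norm_eq_abs, abs_eq (by norm_num)] at h2
  have hz' : z = (z * conj w) * w := by linear_combination (-z) * h1
  rcases h2 with h2 | h2
  · left; rw [hz', ← hr, h2]; simp
  · right; rw [hz', ← hr, h2]; simp

lemma im_zero_of_collinear {E₀ E₁ E₂ : ℂ} (h₀ : ‖E₀‖ = 1) (h₁ : ‖E₁‖ = 1) (h₂ : ‖E₂‖ = 1)
    (h : (E₁ * conj E₀).im = 0 ∧ (E₂ * conj E₀).im = 0) :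
    (E₁ = E₀ ∨ E₁ = -E₀) ∧ (E₂ = E₀ ∨ E₂ = -E₀) :=
  ⟨eq_or_eq_neg_of_im_eq_zero h₁ h₀ h.1, eq_or_eq_neg_of_im_eq_zero h₂ h₀ h.2⟩

/-- Change of the signs in a decomposition `a = g ξ`, `b = g ξ̄` so that the ratios agree. -/
lemma exists_signs {E₀ E₁ E₂ : ℂ} (h₁ : E₁ = E₀ ∨ E₁ = -E₀) (h₂ : E₂ = E₀ ∨ E₂ = -E₀) :
    ∃ ε : Fin 3 → ℝ, (∀ x, ε x * ε x = 1) ∧ ∃ η : ℂ, E₀ * (ε 0 * ε 1) = η ∧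
      E₁ * (ε 1 * ε 2) = η ∧ E₂ * (ε 2 * ε 0) = η := by
  rcases h₁ with rfl | rfl <;> rcases h₂ with rfl | rfl
  · exact ⟨![1, 1, 1], by intro x; fin_cases x <;> simp, _, rfl, by simp, by simp⟩
  · exact ⟨![1, -1, 1], by intro x; fin_cases x <;> simp, _, rfl, by simp, by simp⟩
  · exact ⟨![-1, 1, 1], by intro x; fin_cases x <;> simp, _, rfl, by simp, by simp⟩
  · exact ⟨![1, 1, -1], by intro x; fin_cases x <;> simp, _, rfl, by simp, by simp⟩

/-- Replacing `g x` and `ξ x` by `ε x g x` and `ε x ξ x` with a common sign changes neither `a` nor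
`b`. The signs of `exists_signs` make the three cyclic ratios of `g` equal to a single `η ≠ 0`,
which can be divided out of `hC` and `hS` to leave real relations. -/
lemma isMixedType_of_collinear {a b g ξ : Fin 3 → ℂ} (hg : ∀ x, ‖g x‖ = 1)
    (hξ : ∀ x, ‖ξ x‖ = 1) (ha : ∀ x, a x = g x * ξ x) (hb : ∀ x, b x = g x * conj (ξ x))
    (hC : g 0 * conj (g 1) * ((ξ 0).re * (ξ 1).re) + g 1 * conj (g 2) * ((ξ 1).re * (ξ 2).re) +
      g 2 * conj (g 0) * ((ξ 2).re * (ξ 0).re) = 0)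
    (hS : g 0 * conj (g 1) * ((ξ 0).im * (ξ 1).im) + g 1 * conj (g 2) * ((ξ 1).im * (ξ 2).im) +
      g 2 * conj (g 0) * ((ξ 2).im * (ξ 0).im) = 0)
    (hC2 : (ξ 0).re ^ 2 + (ξ 1).re ^ 2 + (ξ 2).re ^ 2 = 3 / 2)
    (hS2 : (ξ 0).im ^ 2 + (ξ 1).im ^ 2 + (ξ 2).im ^ 2 = 3 / 2)
    (h₁ : g 1 * conj (g 2) = g 0 * conj (g 1) ∨ g 1 * conj (g 2) = -(g 0 * conj (g 1)))
    (h₂ : g 2 * conj (g 0) = g 0 * conj (g 1) ∨ g 2 * conj (g 0) = -(g 0 * conj (g 1))) :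
    ∃ g' ξ' η, IsMixedType a b g' ξ' η := by
  obtain ⟨ε, hε, η, e0, e1, e2⟩ := exists_signs h₁ h₂
  have hε' : ∀ x, (ε x : ℂ) * ε x = 1 := fun x => by exact_mod_cast hε x
  have hεn : ∀ x, ‖(ε x : ℂ)‖ = 1 := fun x =>
    Complex.norm_eq_one_of_mul_conj (by rw [Complex.conj_ofReal, hε'])
  have hη : η ≠ 0 := by
    rw [← e0]
    have : ‖g 0 * conj (g 1) * (ε 0 * ε 1)‖ = 1 := by simp only [norm_mul, hεn, hg,
      RCLike.norm_conj, mul_one]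
    intro h
    rw [h] at this
    simp at this
  have hre : ∀ x, (ε x * ξ x : ℂ).re = ε x * (ξ x).re := fun x => by simp
  have him : ∀ x, (ε x * ξ x : ℂ).im = ε x * (ξ x).im := fun x => by simp
  have hsq : ∀ x, ε x ^ 2 = 1 := fun x => by rw [sq, hε]
  refine ⟨fun x => ε x * g x, fun x => ε x * ξ x, η, ⟨fun x => ?_, fun x => ?_, fun x => ?_,
    fun x => ?_, ?_, ?_, ?_, ?_, ?_, ?_, ?_⟩⟩
  · rw [norm_mul, hεn, hg, one_mul]
  · rw [norm_mul, hεn, hξ, one_mul]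
  · rw [ha]; linear_combination (-g x * ξ x) * hε' x
  · rw [hb, map_mul, Complex.conj_ofReal]; linear_combination (-g x * conj (ξ x)) * hε' x
  · rw [map_mul, Complex.conj_ofReal, ← e0]; ring
  · rw [map_mul, Complex.conj_ofReal, ← e1]; ring
  · rw [map_mul, Complex.conj_ofReal, ← e2]; ring
  · have : η * ((ε 0 * (ξ 0).re * (ε 1 * (ξ 1).re) + ε 1 * (ξ 1).re * (ε 2 * (ξ 2).re) +
        ε 2 * (ξ 2).re * (ε 0 * (ξ 0).re) : ℝ) : ℂ) = 0 := by
      push_cast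
      rw [← hC, mul_add, mul_add]
      nth_rw 1 [← e0]
      nth_rw 1 [← e1]
      nth_rw 1 [← e2]
      linear_combination g 0 * conj (g 1) * ((ξ 0).re * (ξ 1).re) * (hε' 0 * ε 1 * ε 1 + hε' 1)
        + g 1 * conj (g 2) * ((ξ 1).re * (ξ 2).re) * (hε' 1 * ε 2 * ε 2 + hε' 2)
        + g 2 * conj (g 0) * ((ξ 2).re * (ξ 0).re) * (hε' 2 * ε 0 * ε 0 + hε' 0)
    simp only [hre]
    exact_mod_cast (mul_eq_zero.1 this).resolve_left hη
  · have : η * ((ε 0 * (ξ 0).im * (ε 1 * (ξ 1).im) + ε 1 * (ξ 1).im * (ε 2 * (ξ 2).im) +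
        ε 2 * (ξ 2).im * (ε 0 * (ξ 0).im) : ℝ) : ℂ) = 0 := by
      push_cast
      rw [← hS, mul_add, mul_add]
      nth_rw 1 [← e0]
      nth_rw 1 [← e1]
      nth_rw 1 [← e2]
      linear_combination g 0 * conj (g 1) * ((ξ 0).im * (ξ 1).im) * (hε' 0 * ε 1 * ε 1 + hε' 1)
        + g 1 * conj (g 2) * ((ξ 1).im * (ξ 2).im) * (hε' 1 * ε 2 * ε 2 + hε' 2)
        + g 2 * conj (g 0) * ((ξ 2).im * (ξ 0).im) * (hε' 2 * ε 0 * ε 0 + hε' 0)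
    simp only [him]
    exact_mod_cast (mul_eq_zero.1 this).resolve_left hη
  · simp only [hre, mul_pow, hsq, one_mul, hC2]
  · simp only [him, mul_pow, hsq, one_mul, hS2]

/-- Classification of the vectors that are unbiased to the Fourier basis. -/
lemma IsFourierUnbiased.isProductType_or_isMixedType {a b : Fin 3 → ℂ}
    (h : IsFourierUnbiased a b) : IsProductType a b ∨ ∃ g ξ η, IsMixedType a b g ξ η := by
  choose g ξ hg hξ ha hb using fun x => exists_polar_pair (h.norm_left x) (h.norm_right x)
  have hre : ∀ x, ξ x + conj (ξ x) = 2 * (ξ x).re := fun x => by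
    rw [Complex.add_conj]; push_cast; ring
  have him : ∀ x, ξ x - conj (ξ x) = 2 * Complex.I * (ξ x).im := fun x => by
    rw [Complex.sub_conj]; push_cast; ring
  have hs : ∀ x, a x + b x = 2 * g x * (ξ x).re := fun x => by
    rw [ha, hb]; linear_combination g x * hre x
  have hd : ∀ x, a x - b x = 2 * Complex.I * g x * (ξ x).im := fun x => by
    rw [ha, hb]; linear_combination g x * him x
  have hs' : ∀ x, conj (a x) + conj (b x) = 2 * conj (g x) * (ξ x).re := fun x => by
    rw [← map_add, hs]; simp [Complex.conj_ofNat]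
  have hd' : ∀ x, conj (a x) - conj (b x) = -(2 * Complex.I * conj (g x) * (ξ x).im) := fun x => by
    rw [← map_sub, hd]; simp [Complex.conj_ofNat]
  -- The sum and the difference of `auto` and `cross` are the autocorrelations of `a + b` and `a -
  -- b`; in polar form they carry the real weights `Re ξ` and `Im ξ`.
  have hC : g 0 * conj (g 1) * ((ξ 0).re * (ξ 1).re) + g 1 * conj (g 2) * ((ξ 1).re * (ξ 2).re) +
      g 2 * conj (g 0) * ((ξ 2).re * (ξ 0).re) = 0 := by
    have : (a 0 + b 0) * (conj (a 1) + conj (b 1)) + (a 1 + b 1) * (conj (a 2) + conj (b 2)) +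
        (a 2 + b 2) * (conj (a 0) + conj (b 0)) = 0 := by
      linear_combination h.auto + h.cross
    simp only [hs, hs'] at this
    linear_combination this / 4
  have hS : g 0 * conj (g 1) * ((ξ 0).im * (ξ 1).im) + g 1 * conj (g 2) * ((ξ 1).im * (ξ 2).im) +
      g 2 * conj (g 0) * ((ξ 2).im * (ξ 0).im) = 0 := by
    have : (a 0 - b 0) * (conj (a 1) - conj (b 1)) + (a 1 - b 1) * (conj (a 2) - conj (b 2)) +
        (a 2 - b 2) * (conj (a 0) - conj (b 0)) = 0 := by
      linear_combination h.auto - h.cross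
    simp only [hd, hd'] at this
    linear_combination this / 4 + (g 0 * conj (g 1) * ((ξ 0).im * (ξ 1).im) +
      g 1 * conj (g 2) * ((ξ 1).im * (ξ 2).im) +
      g 2 * conj (g 0) * ((ξ 2).im * (ξ 0).im)) * Complex.I_sq
  have hn := fun x => Complex.re_sq_add_im_sq_of_norm_eq_one (hξ x)
  have hab : ∀ x, a x * conj (b x) = ξ x * ξ x := fun x => by
    rw [ha, hb, map_mul, Complex.conj_conj]
    linear_combination ξ x * ξ x * Complex.mul_conj_of_norm_eq_one (hg x)
  -- Since `a x * conj (b x) = ξ x ^ 2`, the condition `re_inner` balances the squares of the real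
  -- and imaginary parts; their total is 3, so each sum is `3 / 2`.
  have hre2 : (ξ 0).re ^ 2 - (ξ 0).im ^ 2 + ((ξ 1).re ^ 2 - (ξ 1).im ^ 2) +
      ((ξ 2).re ^ 2 - (ξ 2).im ^ 2) = 0 := by
    have := h.re_inner
    simp only [hab, Complex.add_re, Complex.mul_re] at this
    linarith
  have hC2 : (ξ 0).re ^ 2 + (ξ 1).re ^ 2 + (ξ 2).re ^ 2 = 3 / 2 := by
    linarith [hn 0, hn 1, hn 2]
  have hS2 : (ξ 0).im ^ 2 + (ξ 1).im ^ 2 + (ξ 2).im ^ 2 = 3 / 2 := by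
    linarith [hn 0, hn 1, hn 2]
  have hEn : ∀ x y, ‖g x * conj (g y)‖ = 1 := fun x y => by simp [hg]
  have hE0 : ∀ x y, g x * conj (g y) ≠ 0 := fun x y h0 => by
    have := hEn x y
    rw [h0] at this
    simp at this
  have hre1 : ∀ x, (ξ x).re ^ 2 ≤ 1 := fun x => by nlinarith [hn x, sq_nonneg (ξ x).im]
  have him1 : ∀ x, (ξ x).im ^ 2 ≤ 1 := fun x => by nlinarith [hn x, sq_nonneg (ξ x).re]
  have c0 : (ξ 0).re ≠ 0 := ne_zero_of_unimodular_sum (hE0 1 2) (hre1 1) (hre1 2) hC2 hC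
  have s0 : (ξ 0).im ≠ 0 := ne_zero_of_unimodular_sum (hE0 1 2) (him1 1) (him1 2) hS2 hS
  have c1 : (ξ 1).re ≠ 0 := ne_zero_of_unimodular_sum (E' := g 1 * conj (g 2)) (E'' := g 0 * conj (g 1))
    (hE0 2 0) (hre1 2) (hre1 0) (by linarith) (by linear_combination hC)
  have s1 : (ξ 1).im ≠ 0 := ne_zero_of_unimodular_sum (E' := g 1 * conj (g 2)) (E'' := g 0 * conj (g 1))
    (hE0 2 0) (him1 2) (him1 0) (by linarith) (by linear_combination hS)
  have c2 : (ξ 2).re ≠ 0 := ne_zero_of_unimodular_sum (E' := g 2 * conj (g 0)) (E'' := g 1 * conj (g 2))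
    (hE0 0 1) (hre1 0) (hre1 1) (by linarith) (by linear_combination hC)
  have s2 : (ξ 2).im ≠ 0 := ne_zero_of_unimodular_sum (E' := g 2 * conj (g 0)) (E'' := g 1 * conj (g 2))
    (hE0 0 1) (him1 0) (him1 1) (by linarith) (by linear_combination hS)
  -- Equality means that `ξ 0` and `ξ 1` agree up to sign. If this fails for one of the neighbouring
  -- pairs, the ratios of `g` are collinear and the vector is mixed. If it holds for both, `ξ ^ 2`
  -- is constant with real part zero, so it is `±i` and `b = ∓i a`.
  by_cases p01 : (ξ 1).re * (ξ 0).im = (ξ 0).re * (ξ 1).im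
  swap
  · right
    obtain ⟨k1, k2⟩ := im_zero_of_collinear (hEn 0 1) (hEn 1 2) (hEn 2 0)
      (collinear_of_relations (hEn 0 1) c2 s2 p01 hC hS)
    exact isMixedType_of_collinear hg hξ ha hb hC hS hC2 hS2 k1 k2
  by_cases p12 : (ξ 2).re * (ξ 1).im = (ξ 1).re * (ξ 2).im
  swap
  · right
    obtain ⟨k1, k2⟩ := im_zero_of_collinear (hEn 1 2) (hEn 2 0) (hEn 0 1)
      (collinear_of_relations (c₀ := (ξ 1).re) (c₁ := (ξ 2).re) (s₀ := (ξ 1).im) (s₁ := (ξ 2).im)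
        (hEn 1 2) c0 s0 p12 (by linear_combination hC) (by linear_combination hS))
    refine isMixedType_of_collinear hg hξ ha hb hC hS hC2 hS2 ?_ ?_
    · rcases k2 with k2 | k2 <;> rw [k2] <;> simp
    · rcases k2 with k2 | k2 <;> rcases k1 with k1 | k1 <;> rw [k2, k1] <;> simp
  left
  have q1 : (ξ 1).re ^ 2 = (ξ 0).re ^ 2 := by
    linear_combination (-(ξ 1).re ^ 2) * hn 0 + (ξ 0).re ^ 2 * hn 1 +
      ((ξ 1).re * (ξ 0).im + (ξ 0).re * (ξ 1).im) * p01
  have q2 : (ξ 2).re ^ 2 = (ξ 1).re ^ 2 := by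
    linear_combination (-(ξ 2).re ^ 2) * hn 1 + (ξ 1).re ^ 2 * hn 2 +
      ((ξ 2).re * (ξ 1).im + (ξ 1).re * (ξ 2).im) * p12
  have v0 : (ξ 0).re ^ 2 = 1 / 2 := by linarith
  have w0 : (ξ 0).im ^ 2 = 1 / 2 := by linarith [hn 0]
  have hprod : ((ξ 0).re * (ξ 0).im) ^ 2 = (1 / 2) ^ 2 := by rw [mul_pow, v0, w0]; norm_num
  have e1 : (ξ 1).re * (ξ 1).im = (ξ 0).re * (ξ 0).im := by
    apply mul_left_cancel₀ c0
    linear_combination (-(ξ 1).re) * p01 + (ξ 0).im * q1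
  have e2 : (ξ 2).re * (ξ 2).im = (ξ 1).re * (ξ 1).im := by
    apply mul_left_cancel₀ c1
    linear_combination (-(ξ 2).re) * p12 + (ξ 1).im * q2
  have hsq : ∀ x, ξ x * ξ x = 2 * Complex.I * ((ξ x).re * (ξ x).im : ℝ) ∨ (ξ x).re ^ 2 ≠ 1 / 2 := by
    intro x
    by_cases hx : (ξ x).re ^ 2 = 1 / 2
    · left
      have hx' : (ξ x).im ^ 2 = 1 / 2 := by linarith [hn x]
      apply Complex.ext
      · simp only [Complex.mul_re, Complex.ofReal_re, Complex.ofReal_im]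
        simp
        linarith
      · simp only [Complex.mul_im, Complex.ofReal_re, Complex.ofReal_im]
        simp
        ring
    · exact Or.inr hx
  have hall : ∀ x, ξ x * ξ x = 2 * Complex.I * ((ξ 0).re * (ξ 0).im : ℝ) := by
    intro x
    fin_cases x
    · exact (hsq 0).resolve_right (fun h => h v0)
    · rw [← e1]; exact (hsq 1).resolve_right (fun h => h (by linarith))
    · rw [← e1, ← e2]; exact (hsq 2).resolve_right (fun h => h (by linarith))
  have hbx : ∀ x, b x = conj (ξ x * ξ x) * a x := fun x => by
    rw [ha, hb, map_mul]
    linear_combination (-g x * conj (ξ x)) * Complex.mul_conj_of_norm_eq_one (hξ x)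
  rcases sq_eq_sq_iff_eq_or_eq_neg.1 hprod with hp | hp
  · refine ⟨-Complex.I, Or.inr rfl, fun x => ?_⟩
    rw [hbx, hall, hp]
    simp [Complex.conj_ofNat]
    left
    ring
  · refine ⟨Complex.I, Or.inl rfl, fun x => ?_⟩
    rw [hbx, hall, hp]
    simp [Complex.conj_ofNat]
    left
    ring

/-- Conjugation inverts unimodular numbers, so it exchanges the first and second symmetric functions
up to the product. -/
lemma unimodular_esymm_two {x y z : ℂ} (hx : ‖x‖ = 1) (hy : ‖y‖ = 1) (hz : ‖z‖ = 1) :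
    x * y + y * z + z * x = x * y * z * conj (x + y + z) := by
  simp only [map_add]
  linear_combination (-y * z) * Complex.mul_conj_of_norm_eq_one hx -
    x * z * Complex.mul_conj_of_norm_eq_one hy - x * y * Complex.mul_conj_of_norm_eq_one hz

/-! ### The explicit form of mixed vectors -/

namespace IsMixedType

variable {a b g ξ : Fin 3 → ℂ} {η : ℂ}

lemma sum_re_sq (h : IsMixedType a b g ξ η) :
    ((ξ 0).re + (ξ 1).re + (ξ 2).re) ^ 2 = 3 / 2 := by
  linear_combination h.re_sq + 2 * h.re_sum

lemma sum_im_sq (h : IsMixedType a b g ξ η) :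
    ((ξ 0).im + (ξ 1).im + (ξ 2).im) ^ 2 = 3 / 2 := by
  linear_combination h.im_sq + 2 * h.im_sum

lemma normSq_sum (h : IsMixedType a b g ξ η) :
    (ξ 0 + ξ 1 + ξ 2) * conj (ξ 0 + ξ 1 + ξ 2) = 3 := by
  rw [Complex.mul_conj, Complex.normSq_apply]
  have : (ξ 0 + ξ 1 + ξ 2).re * (ξ 0 + ξ 1 + ξ 2).re +
      (ξ 0 + ξ 1 + ξ 2).im * (ξ 0 + ξ 1 + ξ 2).im = 3 := by
    simp only [Complex.add_re, Complex.add_im]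
    linear_combination h.sum_re_sq + h.sum_im_sq
  rw [this]
  norm_num

lemma esymm_two_re (h : IsMixedType a b g ξ η) :
    (ξ 0 * ξ 1 + ξ 1 * ξ 2 + ξ 2 * ξ 0).re = 0 := by
  simp only [Complex.add_re, Complex.mul_re]
  linear_combination h.re_sum - h.im_sum

lemma esymm_two_im_sq (h : IsMixedType a b g ξ η) :
    (ξ 0 * ξ 1 + ξ 1 * ξ 2 + ξ 2 * ξ 0).im ^ 2 = 3 := by
  have h1 : (ξ 0 * ξ 1 + ξ 1 * ξ 2 + ξ 2 * ξ 0) *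
      conj (ξ 0 * ξ 1 + ξ 1 * ξ 2 + ξ 2 * ξ 0) = 3 := by
    rw [unimodular_esymm_two (h.norm_ξ 0) (h.norm_ξ 1) (h.norm_ξ 2), map_mul, Complex.conj_conj]
    have h2 : ‖ξ 0 * ξ 1 * ξ 2‖ = 1 := by simp [h.norm_ξ]
    linear_combination h.normSq_sum + (ξ 0 + ξ 1 + ξ 2) * conj (ξ 0 + ξ 1 + ξ 2) *
      Complex.mul_conj_of_norm_eq_one h2
  rw [Complex.mul_conj, Complex.normSq_apply, h.esymm_two_re] at h1
  have h2 : (0 * 0 + (ξ 0 * ξ 1 + ξ 1 * ξ 2 + ξ 2 * ξ 0).im *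
    (ξ 0 * ξ 1 + ξ 1 * ξ 2 + ξ 2 * ξ 0).im : ℝ) = 3 := by exact_mod_cast h1
  linear_combination h2

/-- Expand `(∑ ξ)² = ∑ ξ² + 2 e₂`. If `∑ ξ²` were real, `Im e₂` would be the product of the real and
imaginary parts of `∑ ξ`, with square `9 / 4`. But `e₂` is purely imaginary with `|e₂|² = |∑ ξ|² =
3`. -/
lemma sum_sq_im_ne_zero (h : IsMixedType a b g ξ η) :
    (ξ 0 * ξ 0 + ξ 1 * ξ 1 + ξ 2 * ξ 2).im ≠ 0 := by
  intro h0
  have h1 : (ξ 0 * ξ 1 + ξ 1 * ξ 2 + ξ 2 * ξ 0).im =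
      ((ξ 0).re + (ξ 1).re + (ξ 2).re) * ((ξ 0).im + (ξ 1).im + (ξ 2).im) := by
    simp only [Complex.add_im, Complex.mul_im] at h0 ⊢
    linear_combination (-1 / 2) * h0
  have h2 := h.esymm_two_im_sq
  rw [h1, mul_pow, h.sum_re_sq, h.sum_im_sq] at h2
  norm_num at h2

end IsMixedType

/-- The real part of `mixedRoot`. -/
noncomputable def mixedRe : ℝ := (√3 - 1) / 2

/-- The imaginary part of `mixedRoot`. -/
noncomputable def mixedIm : ℝ := √(1 / 2 + mixedRe)

/-- The unimodular number occurring in the vectors of mixed type. -/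
noncomputable def mixedRoot : ℂ := ⟨mixedRe, mixedIm⟩

lemma sqrt_three_sq : √(3 : ℝ) ^ 2 = 3 := Real.sq_sqrt (by norm_num)

lemma mixedRe_sq : mixedRe ^ 2 = 1 / 2 - mixedRe := by
  have := sqrt_three_sq
  rw [mixedRe]
  linear_combination this / 4

lemma mixedRe_bounds : 0.366 < mixedRe ∧ mixedRe < 0.367 := by
  have h1 : (1.732 : ℝ) < √3 := Real.lt_sqrt_of_sq_lt (by norm_num)
  have h2 : √(3 : ℝ) < 1.734 := (Real.sqrt_lt' (by norm_num)).2 (by norm_num)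
  constructor <;> rw [mixedRe] <;> linarith

lemma mixedIm_sq : mixedIm ^ 2 = 1 / 2 + mixedRe :=
  Real.sq_sqrt (by linarith [mixedRe_bounds.1])

/-- The three numbers that occur, up to a common factor, in the vectors of mixed type. -/
noncomputable def mixedTriple : Fin 3 → ℂ := ![1, mixedRoot, conj mixedRoot]

lemma eq_mixedRoot_or {y : ℂ} (hy : ‖y‖ = 1) (h : y.re = mixedRe) :
    y = mixedRoot ∨ y = conj mixedRoot := by
  have h1 := Complex.re_sq_add_im_sq_of_norm_eq_one hy
  have h2 : y.im ^ 2 = mixedIm ^ 2 := by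
    rw [h] at h1
    linear_combination h1 - mixedRe_sq - mixedIm_sq
  rcases sq_eq_sq_iff_eq_or_eq_neg.1 h2 with h2 | h2
  · exact Or.inl (Complex.ext h h2)
  · exact Or.inr (Complex.ext h h2)

/-- The product being 1, `z` is the conjugate of `y` and the sum is `2 Re y`. The sign `δ = -1`
would require `2 Re y = √3 + 1 > 2`. -/
lemma pair_eq_mixed {y z : ℂ} (hy : ‖y‖ = 1) {δ : ℂ} (hδ : δ = 1 ∨ δ = -1)
    (hs : y + z = √3 - δ) (hp : y * z = 1) :
    δ = 1 ∧ ((y = mixedRoot ∧ z = conj mixedRoot) ∨ (z = mixedRoot ∧ y = conj mixedRoot)) := by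
  have hzy : z = conj y := by
    linear_combination conj y * hp - z * Complex.mul_conj_of_norm_eq_one hy
  have hre : 2 * y.re = √3 - δ.re := by
    have := congrArg Complex.re hs
    rw [hzy] at this
    simp at this
    linarith
  rcases hδ with rfl | rfl
  · refine ⟨rfl, ?_⟩
    have : y.re = mixedRe := by
      rw [mixedRe]
      simp at hre
      linarith
    rcases eq_mixedRoot_or hy this with h | h
    · exact Or.inl ⟨h, by rw [hzy, h]⟩
    · exact Or.inr ⟨by rw [hzy, h, Complex.conj_conj], h⟩
  · exfalso
    simp at hre
    have h1 := Complex.abs_re_le_norm y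
    rw [hy] at h1
    have := le_abs_self y.re
    have := mixedRe_bounds.1
    rw [mixedRe] at this
    linarith

lemma exists_perm_of_ne : ∀ x y z : Fin 3, x ≠ y → y ≠ z → z ≠ x →
    ∃ σ : Equiv.Perm (Fin 3), σ x = 0 ∧ σ y = 1 ∧ σ z = 2 := by decide

lemma exists_perm_mixedTriple {k : Fin 3 → ℂ} {x y z : Fin 3} (hxy : x ≠ y) (hyz : y ≠ z)
    (hzx : z ≠ x) (hall : ∀ w, w = x ∨ w = y ∨ w = z) {δ : ℂ} (hδ : δ = 1 ∨ δ = -1)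
    (hk : ∀ x, ‖k x‖ = 1) (hx : k x = δ) (hs : k x + k y + k z = √3) (hp : k x * k y * k z = δ) :
    ∃ σ : Equiv.Perm (Fin 3), ∀ w, k w = mixedTriple (σ w) := by
  have hδ0 : δ * δ = 1 := by rcases hδ with rfl | rfl <;> norm_num
  obtain ⟨rfl, h⟩ := pair_eq_mixed (z := k z) (hk y) hδ (by rw [← hx]; linear_combination hs)
    (by rw [hx] at hp; linear_combination δ * hp + (1 - k y * k z) * hδ0)
  rcases h with ⟨h1, h2⟩ | ⟨h1, h2⟩
  · obtain ⟨σ, s1, s2, s3⟩ := exists_perm_of_ne x y z hxy hyz hzx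
    refine ⟨σ, fun w => ?_⟩
    rcases hall w with rfl | rfl | rfl
    · rw [s1, hx]; rfl
    · rw [s2, h1]; rfl
    · rw [s3, h2]; rfl
  · obtain ⟨σ, s1, s2, s3⟩ := exists_perm_of_ne x z y hzx.symm hyz.symm hxy.symm
    refine ⟨σ, fun w => ?_⟩
    rcases hall w with rfl | rfl | rfl
    · rw [s1, hx]; rfl
    · rw [s3, h2]; rfl
    · rw [s2, h1]; rfl

namespace IsMixedType

variable {a b g ξ : Fin 3 → ℂ} {η : ℂ}

/-- Let `∑ ξ = √3 φ`; the equal squares of the real and imaginary parts of the sum give `φ² = ±i`.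
The numbers `k = φ̄ ξ` have sum `√3` and product `δ`, hence second symmetric function `√3 δ`. As
that of `ξ` is `±√3 i`, it follows that `δ = ±1`. Then `δ` itself is a root of the cubic `T³ - √3 T²
+ √3 δ T - δ` with roots `k x`, and the other two roots are found by `pair_eq_mixed`. -/
lemma exists_mixedTriple (h : IsMixedType a b g ξ η) :
    ∃ φ : ℂ, ‖φ‖ = 1 ∧ (φ ^ 2 = Complex.I ∨ φ ^ 2 = -Complex.I) ∧
      ∃ σ : Equiv.Perm (Fin 3), ∀ x, ξ x = φ * mixedTriple (σ x) := by
  have h3 : (√3 : ℂ) ^ 2 = 3 := by exact_mod_cast sqrt_three_sq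
  have h30 : (√3 : ℂ) ≠ 0 := by intro h0; rw [h0] at h3; norm_num at h3
  obtain ⟨φ, hφ⟩ : ∃ φ : ℂ, ξ 0 + ξ 1 + ξ 2 = √3 * φ := ⟨(ξ 0 + ξ 1 + ξ 2) / √3, by field_simp⟩
  have hφn : φ * conj φ = 1 := by
    have := h.normSq_sum
    rw [hφ, map_mul, Complex.conj_ofReal] at this
    linear_combination this / 3 - φ * conj φ * h3 / 3
  have hφn' : ‖φ‖ = 1 := Complex.norm_eq_one_of_mul_conj hφn
  have hcs : (((ξ 0).re + (ξ 1).re + (ξ 2).re) * ((ξ 0).im + (ξ 1).im + (ξ 2).im)) ^ 2 =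
      (3 / 2) ^ 2 := by
    rw [mul_pow, h.sum_re_sq, h.sum_im_sq]; norm_num
  have hφ2' : φ ^ 2 = (2 / 3) * Complex.I *
      (((ξ 0).re + (ξ 1).re + (ξ 2).re) * ((ξ 0).im + (ξ 1).im + (ξ 2).im) : ℝ) := by
    have h1 : (ξ 0 + ξ 1 + ξ 2) ^ 2 = 2 * Complex.I *
      (((ξ 0).re + (ξ 1).re + (ξ 2).re) * ((ξ 0).im + (ξ 1).im + (ξ 2).im) : ℝ) := by
      have hr := h.sum_re_sq
      have hi := h.sum_im_sq
      apply Complex.ext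
      · rw [sq]
        simp only [Complex.mul_re, Complex.add_re, Complex.add_im, Complex.ofReal_re,
          Complex.ofReal_im]
        simp
        linarith
      · rw [sq]
        simp only [Complex.mul_im, Complex.add_re, Complex.add_im, Complex.ofReal_re,
          Complex.ofReal_im]
        simp
        ring
    rw [hφ] at h1
    linear_combination h1 / 3 - φ ^ 2 * h3 / 3
  have hφ2 : φ ^ 2 = Complex.I ∨ φ ^ 2 = -Complex.I := by
    rcases sq_eq_sq_iff_eq_or_eq_neg.1 hcs with hh | hh <;> rw [hh] at hφ2'
    · left; rw [hφ2']; push_cast; ring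
    · right; rw [hφ2']; push_cast; ring
  refine ⟨φ, hφn', hφ2, ?_⟩
  have hφ4 : φ ^ 4 = -1 := by
    have : φ ^ 4 = (φ ^ 2) ^ 2 := by ring
    rw [this]
    rcases hφ2 with hh | hh <;> rw [hh] <;> simp
  obtain ⟨τ, hτ⟩ : ∃ τ : ℝ, (ξ 0 * ξ 1 + ξ 1 * ξ 2 + ξ 2 * ξ 0).im = τ := ⟨_, rfl⟩
  have he2 : ξ 0 * ξ 1 + ξ 1 * ξ 2 + ξ 2 * ξ 0 = τ * Complex.I := by
    apply Complex.ext
    · rw [h.esymm_two_re]; simp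
    · rw [hτ]; simp
  have hτ2 : τ ^ 2 = 3 := by rw [← hτ, h.esymm_two_im_sq]
  set k : Fin 3 → ℂ := fun x => conj φ * ξ x with hkdef
  have hk : ∀ x, ‖k x‖ = 1 := fun x => by simp [hkdef, hφn', h.norm_ξ]
  have hξk : ∀ x, ξ x = φ * k x := fun x => by
    simp only [hkdef]; linear_combination (-ξ x) * hφn
  have hsum : k 0 + k 1 + k 2 = √3 := by
    simp only [hkdef]
    linear_combination conj φ * hφ + √3 * hφn
  obtain ⟨δ, hδ⟩ : ∃ δ : ℂ, k 0 * k 1 * k 2 = δ := ⟨_, rfl⟩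
  have hk2 : k 0 * k 1 + k 1 * k 2 + k 2 * k 0 = √3 * δ := by
    rw [unimodular_esymm_two (hk 0) (hk 1) (hk 2), hsum, Complex.conj_ofReal, hδ, mul_comm]
  have hδ2 : δ ^ 2 = 1 := by
    have h1 : φ ^ 2 * (√3 * δ) = τ * Complex.I := by
      rw [← hk2, ← he2, hξk 0, hξk 1, hξk 2]; ring
    have h2 : (φ ^ 2 * (√3 * δ)) ^ 2 = (τ * Complex.I) ^ 2 := by rw [h1]
    have h4 : (τ : ℂ) ^ 2 = 3 := by exact_mod_cast hτ2
    linear_combination (-1 / 3) * h2 + h4 * (-Complex.I ^ 2) / 3 + (1 / 3) * δ ^ 2 * 3 * hφ4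
      + (1 / 3) * φ ^ 4 * δ ^ 2 * h3 - Complex.I_sq
  have hδ1 : δ = 1 ∨ δ = -1 := mul_self_eq_one_iff.1 (by rw [← sq, hδ2])
  have hprod : (δ - k 0) * ((δ - k 1) * (δ - k 2)) = 0 := by
    linear_combination (-δ ^ 2) * hsum + δ * hk2 - hδ + (δ) * hδ2
  rcases mul_eq_zero.1 hprod with h0 | h0
  · have := exists_perm_mixedTriple (k := k) (x := 0) (y := 1) (z := 2) (by decide) (by decide)
      (by decide) (by decide) hδ1 hk (sub_eq_zero.1 h0).symm hsum hδ
    exact this.imp fun σ hσ x => by rw [hξk, hσ]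
  rcases mul_eq_zero.1 h0 with h0 | h0
  · have := exists_perm_mixedTriple (k := k) (x := 1) (y := 2) (z := 0) (by decide) (by decide)
      (by decide) (by decide) hδ1 hk (sub_eq_zero.1 h0).symm (by linear_combination hsum)
      (by linear_combination hδ)
    exact this.imp fun σ hσ x => by rw [hξk, hσ]
  · have := exists_perm_mixedTriple (k := k) (x := 2) (y := 0) (z := 1) (by decide) (by decide)
      (by decide) (by decide) hδ1 hk (sub_eq_zero.1 h0).symm (by linear_combination hsum)
      (by linear_combination hδ)
    exact this.imp fun σ hσ x => by rw [hξk, hσ]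

end IsMixedType

lemma perm_three_cases : ∀ π : Equiv.Perm (Fin 3),
    (π 0 = 0 ∧ π 1 = 1 ∧ π 2 = 2) ∨ (π 0 = 0 ∧ π 1 = 2 ∧ π 2 = 1) ∨
    (π 0 = 1 ∧ π 1 = 0 ∧ π 2 = 2) ∨ (π 0 = 1 ∧ π 1 = 2 ∧ π 2 = 0) ∨
    (π 0 = 2 ∧ π 1 = 0 ∧ π 2 = 1) ∨ (π 0 = 2 ∧ π 1 = 1 ∧ π 2 = 0) := by decide

/-- Two mixed triples never give a quadratic sum that unbiased vectors would require. -/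
lemma mixedTriple_sums (π : Equiv.Perm (Fin 3)) (k : Fin 3 → ℝ)
    (hk : (∀ i, k i = (conj (mixedTriple i) * mixedTriple (π i)).re) ∨
      (∀ i, k i = (conj (mixedTriple i) * mixedTriple (π i)).im)) :
    (∑ i, k i) ^ 2 ≠ 3 / 2 ∧ 3 * (∑ i, k i ^ 2) - (∑ i, k i) ^ 2 ≠ 3 := by
  obtain ⟨b1, b2⟩ := mixedRe_bounds
  have hq := mixedRe_sq
  have hr := mixedIm_sq
  -- With `p = 2 q r`, the squares `q²`, `r²`, `p²` and the product `p r` are all linear in `q`, so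
  -- each case below is settled by the numerical bounds on `q`.
  obtain ⟨q, hq'⟩ : ∃ q, mixedRe = q := ⟨_, rfl⟩
  obtain ⟨r, hr'⟩ : ∃ r, mixedIm = r := ⟨_, rfl⟩
  rw [hq'] at b1 b2 hq hr
  rw [hr'] at hr
  have e1 : q * q - r * r = -2 * q := by linear_combination hq - hr
  have e2 : q * q + r * r = 1 := by linear_combination hq + hr
  obtain ⟨p, hp⟩ : ∃ p, 2 * q * r = p := ⟨_, rfl⟩
  have hp2 : p ^ 2 = 4 * q - 1 := by
    rw [← hp]; linear_combination (4 * r ^ 2 - 4) * hq + 4 * (1 / 2 - q) * hr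
  have hpr : p * r = 1 - q := by rw [← hp]; linear_combination 2 * q * hr + 2 * hq
  have hcq : ∀ i, ∀ j, (conj (mixedTriple i) * mixedTriple j).re =
      ![![1, q, q], ![q, 1, -2 * q], ![q, -2 * q, 1]] i j := by
    intro i j
    fin_cases i <;> fin_cases j <;>
      simp [mixedTriple, mixedRoot, hq', hr'] <;> linarith
  have hci : ∀ i, ∀ j, (conj (mixedTriple i) * mixedTriple j).im =
      ![![0, r, -r], ![-r, 0, -p], ![r, p, 0]] i j := by
    intro i j
    fin_cases i <;> fin_cases j <;>
      simp [mixedTriple, mixedRoot, hq', hr'] <;> linarith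
  simp only [Fin.sum_univ_three]
  rcases hk with hk | hk
  · simp only [hcq] at hk
    rw [hk 0, hk 1, hk 2]
    rcases perm_three_cases π with h | h | h | h | h | h <;> obtain ⟨h0, h1, h2⟩ := h <;>
      rw [h0, h1, h2] <;> constructor <;> intro h <;> simp at h <;> linarith
  · simp only [hci] at hk
    rw [hk 0, hk 1, hk 2]
    rcases perm_three_cases π with h | h | h | h | h | h <;> obtain ⟨h0, h1, h2⟩ := h <;>
      rw [h0, h1, h2] <;> constructor <;> intro h <;> simp at h <;> linarith

lemma unit_sq_cases {φ φ' : ℂ}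
    (h : φ ^ 2 = Complex.I ∨ φ ^ 2 = -Complex.I) (h' : φ' ^ 2 = Complex.I ∨ φ' ^ 2 = -Complex.I) :
    conj φ * φ' = 1 ∨ conj φ * φ' = -1 ∨ conj φ * φ' = Complex.I ∨ conj φ * φ' = -Complex.I := by
  have h4 : (conj φ * φ') ^ 2 = 1 ∨ (conj φ * φ') ^ 2 = -1 := by
    have hc : (conj φ) ^ 2 = conj (φ ^ 2) := by rw [map_pow]
    rw [mul_pow, hc]
    rcases h with h | h <;> rcases h' with h' | h' <;> rw [h, h'] <;> simp
  rcases h4 with h4 | h4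
  · rw [sq, mul_self_eq_one_iff] at h4
    tauto
  · right; right
    rw [← Complex.I_sq] at h4
    exact sq_eq_sq_iff_eq_or_eq_neg.1 h4

lemma re_of_cube_eq_one {θ : ℂ} (hθ3 : θ ^ 3 = 1) : θ.re = 1 ∨ θ.re = -1 / 2 := by
  have hn : ‖θ‖ = 1 := Complex.norm_eq_one_of_pow_eq_one hθ3 (by norm_num)
  have h1 := Complex.re_sq_add_im_sq_of_norm_eq_one hn
  have h2 := congrArg Complex.re hθ3
  simp [pow_succ] at h2
  have h3 : (θ.re - 1) * (2 * θ.re + 1) ^ 2 = 0 := by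
    linear_combination h2 + 3 * θ.re * h1
  rcases mul_eq_zero.1 h3 with h3 | h3
  · left; linarith
  · right; have := pow_eq_zero_iff (two_ne_zero) |>.1 h3; linarith

/-- Two vectors of mixed type are not unbiased. -/
lemma IsMixedType.not_unbiased {a b g ξ a' b' g' ξ' : Fin 3 → ℂ} {η η' : ℂ}
    (h : IsMixedType a b g ξ η) (h' : IsMixedType a' b' g' ξ' η') :
    ‖∑ x, (conj (a x) * a' x + conj (b x) * b' x)‖ ^ 2 ≠ 6 := by
  intro hN
  have hg := fun x => Complex.mul_conj_of_norm_eq_one (h.norm_g x)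
  have hg' := fun x => Complex.mul_conj_of_norm_eq_one (h'.norm_g x)
  obtain ⟨θ, hθ⟩ : ∃ θ, conj η * η' = θ := ⟨_, rfl⟩
  have hη3 : η ^ 3 = 1 := by
    have : η ^ 3 = η * η * η := by ring
    rw [this]
    nth_rw 1 [← h.ratio01]
    nth_rw 1 [← h.ratio12]
    nth_rw 1 [← h.ratio20]
    linear_combination (g 1 * conj (g 1) * g 2 * conj (g 2)) * hg 0 +
      g 2 * conj (g 2) * hg 1 + hg 2
  have hη3' : η' ^ 3 = 1 := by
    have : η' ^ 3 = η' * η' * η' := by ring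
    rw [this]
    nth_rw 1 [← h'.ratio01]
    nth_rw 1 [← h'.ratio12]
    nth_rw 1 [← h'.ratio20]
    linear_combination (g' 1 * conj (g' 1) * g' 2 * conj (g' 2)) * hg' 0 +
      g' 2 * conj (g' 2) * hg' 1 + hg' 2
  have hθ3 : θ ^ 3 = 1 := by
    rw [← hθ, mul_pow, ← map_pow, hη3, hη3']
    simp
  have hθre := re_of_cube_eq_one hθ3
  obtain ⟨φ, hφ, hφ2, σ, hσ⟩ := h.exists_mixedTriple
  obtain ⟨φ', hφ', hφ2', σ', hσ'⟩ := h'.exists_mixedTriple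
  -- The inner product is `2 ∑ m k` with `k` real and `m` unimodular, all cyclic ratios of `m` being
  -- the cube root of unity `θ`. Modulus `√6` thus means `∑ k² + 2 Re θ ∑ k k' = 3 / 2` over the
  -- pairs. For `Re θ = 1` this is `(∑ k)² = 3 / 2`, for `Re θ = -1/2` it is `3 ∑ k² - (∑ k)² = 3`,
  -- and `mixedTriple_sums` excludes both.
  obtain ⟨k, hk⟩ : ∃ k : Fin 3 → ℝ, ∀ x, k x = (conj (ξ x) * ξ' x).re := ⟨_, fun _ => rfl⟩
  obtain ⟨m, hm⟩ : ∃ m : Fin 3 → ℂ, ∀ x, m x = conj (g x) * g' x := ⟨_, fun _ => rfl⟩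
  have hmm : ∀ x, m x * conj (m x) = 1 := fun x => by
    rw [hm, map_mul, Complex.conj_conj]
    linear_combination g x * conj (g x) * hg' x + hg x
  have h01 : m 0 * conj (m 1) = θ := by
    rw [hm, hm, ← hθ, ← h.ratio01, ← h'.ratio01]; simp; ring
  have h12 : m 1 * conj (m 2) = θ := by
    rw [hm, hm, ← hθ, ← h.ratio12, ← h'.ratio12]; simp; ring
  have h20 : m 2 * conj (m 0) = θ := by
    rw [hm, hm, ← hθ, ← h.ratio20, ← h'.ratio20]; simp; ring
  have h01' : m 1 * conj (m 0) = conj θ := by rw [← h01]; simp [mul_comm]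
  have h12' : m 2 * conj (m 1) = conj θ := by rw [← h12]; simp [mul_comm]
  have h20' : m 0 * conj (m 2) = conj θ := by rw [← h20]; simp [mul_comm]
  have hterm : ∀ x, conj (a x) * a' x + conj (b x) * b' x = 2 * (m x * k x) := fun x => by
    have : (2 * k x : ℂ) = conj (ξ x) * ξ' x + ξ x * conj (ξ' x) := by
      have h1 := Complex.add_conj (conj (ξ x) * ξ' x)
      rw [← hk] at h1
      push_cast at h1
      rw [← h1]
      simp
    rw [h.left, h.right, h'.left, h'.right, hm]
    simp only [map_mul, Complex.conj_conj]
    linear_combination (-conj (g x) * g' x) * this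
  have hθc : θ + conj θ = 2 * (θ.re : ℂ) := by
    have := Complex.add_conj θ
    push_cast at this
    exact this
  have hsq : (k 0 ^ 2 + k 1 ^ 2 + k 2 ^ 2) + 2 * θ.re * (k 0 * k 1 + k 1 * k 2 + k 2 * k 0) =
      3 / 2 := by
    have h1 : (∑ x, (conj (a x) * a' x + conj (b x) * b' x)) *
        conj (∑ x, (conj (a x) * a' x + conj (b x) * b' x)) = 6 := by
      rw [Complex.mul_conj']
      exact_mod_cast hN
    simp only [hterm, Fin.sum_univ_three, map_add, map_mul, Complex.conj_ofReal,
      Complex.conj_ofNat] at h1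
    have h2 : ((k 0 ^ 2 + k 1 ^ 2 + k 2 ^ 2 : ℝ) : ℂ) +
        2 * (θ.re : ℂ) * (k 0 * k 1 + k 1 * k 2 + k 2 * k 0) = ((3 / 2 : ℝ) : ℂ) := by
      push_cast
      linear_combination h1 / 4 - k 0 ^ 2 * hmm 0 - k 1 ^ 2 * hmm 1 - k 2 ^ 2 * hmm 2
        - k 0 * k 1 * (h01 + h01' + hθc) - k 1 * k 2 * (h12 + h12' + hθc)
        - k 2 * k 0 * (h20 + h20' + hθc)
    exact_mod_cast h2
  have hperm : ∀ i, conj (ξ (σ.symm i)) * ξ' (σ.symm i) = (conj φ * φ') *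
      (conj (mixedTriple i) * mixedTriple ((σ.symm.trans σ') i)) := fun i => by
    rw [hσ, hσ', map_mul, Equiv.apply_symm_apply, Equiv.trans_apply]
    ring
  obtain ⟨s1, s2⟩ : (∑ i, k i) ^ 2 ≠ 3 / 2 ∧ 3 * (∑ i, k i ^ 2) - (∑ i, k i) ^ 2 ≠ 3 := by
    rw [← Equiv.sum_comp σ.symm, ← Equiv.sum_comp σ.symm (fun i => k i ^ 2)]
    have hneg : ∀ k' : Fin 3 → ℝ, (∀ i, k (σ.symm i) = - k' i) →
        (∑ i, k' i) ^ 2 ≠ 3 / 2 ∧ 3 * (∑ i, k' i ^ 2) - (∑ i, k' i) ^ 2 ≠ 3 →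
        (∑ i, k (σ.symm i)) ^ 2 ≠ 3 / 2 ∧
          3 * (∑ i, k (σ.symm i) ^ 2) - (∑ i, k (σ.symm i)) ^ 2 ≠ 3 := by
      intro k' h1 h2
      simpa only [h1, Finset.sum_neg_distrib, neg_sq] using h2
    rcases unit_sq_cases hφ2 hφ2' with hψ | hψ | hψ | hψ
    · exact mixedTriple_sums (σ.symm.trans σ') _ (Or.inl fun i => by
        rw [hk, hperm, hψ, one_mul])
    · exact hneg _ (fun i => by rw [hk, hperm, hψ, neg_one_mul, Complex.neg_re])
        (mixedTriple_sums (σ.symm.trans σ') _ (Or.inl fun i => rfl))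
    · exact hneg _ (fun i => by rw [hk, hperm, hψ, Complex.I_mul_re])
        (mixedTriple_sums (σ.symm.trans σ') _ (Or.inr fun i => rfl))
    · exact mixedTriple_sums (σ.symm.trans σ') _ (Or.inr fun i => by
        rw [hk, hperm, hψ, neg_mul, Complex.neg_re, Complex.I_mul_re, neg_neg])
  simp only [Fin.sum_univ_three] at s1 s2
  rcases hθre with h1 | h1 <;> rw [h1] at hsq
  · exact s1 (by linear_combination hsq)
  · exact s2 (by linear_combination 2 * hsq)

/-- For product type the sum is `±3i`, for mixed type it is `∑ ξ²`. Its imaginary part is, up to a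
factor, the expectation of `pairingMatrix`, and this nonvanishing is what contradicts the trace
argument. -/
lemma IsFourierUnbiased.inner_im_ne_zero {a b : Fin 3 → ℂ} (h : IsFourierUnbiased a b) :
    (∑ x, a x * conj (b x)).im ≠ 0 := by
  rcases h.isProductType_or_isMixedType with ⟨μ, hμ, hb⟩ | ⟨g, ξ, η, hm⟩
  · have : ∑ x, a x * conj (b x) = 3 * conj μ := by
      have ha := fun x => Complex.mul_conj_of_norm_eq_one (h.norm_left x)
      simp only [Fin.sum_univ_three, hb, map_mul]
      linear_combination conj μ * (ha 0 + ha 1 + ha 2)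
    rw [this]
    rcases hμ with rfl | rfl <;> simp
  · have hab : ∀ x, a x * conj (b x) = ξ x * ξ x := fun x => by
      rw [hm.left, hm.right, map_mul, Complex.conj_conj]
      linear_combination ξ x * ξ x * Complex.mul_conj_of_norm_eq_one (hm.norm_g x)
    simp only [Fin.sum_univ_three, hab]
    exact hm.sum_sq_im_ne_zero

/-! ### Exclusion of the second matrix by a traceless operator -/

/-- A vector in `ℂ³` with a flat Fourier transform has vanishing autocorrelation. -/
lemma autocorrelation_of_flat {ω : ℂ} (h1 : ‖ω‖ = 1) (h : ω ^ 2 + ω + 1 = 0) {s₀ s₁ s₂ : ℂ}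
    (q₀ : ‖s₀ + s₁ + s₂‖ = √6) (q₁ : ‖s₀ + ω * s₁ + ω ^ 2 * s₂‖ = √6)
    (q₂ : ‖s₀ + ω ^ 2 * s₁ + ω * s₂‖ = √6) :
    s₀ * conj s₁ + s₁ * conj s₂ + s₂ * conj s₀ = 0 ∧
      s₀ * conj s₀ + s₁ * conj s₁ + s₂ * conj s₂ = 6 := by
  have hc := star_cube_root h1 h
  have hN : ∀ {z : ℂ}, ‖z‖ = √6 → z * conj z = 6 := by
    intro z hz
    rw [Complex.mul_conj', hz]
    have : √(6 : ℝ) ^ 2 = 6 := Real.sq_sqrt (by norm_num)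
    exact_mod_cast this
  have e0 := hN q₀
  have e1 := hN q₁
  have e2 := hN q₂
  have hω2 : ω ^ 2 = -1 - ω := by linear_combination h
  simp only [map_add, map_mul, map_pow, hc] at e0 e1 e2
  have hω2' : (-1 - ω) ^ 2 = ω := by linear_combination h
  rw [hω2, hω2'] at e1 e2
  constructor
  · linear_combination (e0 + ω * e1 + (-1 - ω) * e2) / 3 + (2 / 3 * s₀ * conj s₁ -
      2 / 3 * s₀ * conj s₂ - 1 / 3 * s₁ * conj s₁ - 1 / 3 * s₂ * conj s₁ + s₁ * conj s₂ -
      2 / 3 * s₁ * conj s₀ - 1 / 3 * s₂ * conj s₂ + 2 / 3 * s₂ * conj s₀) * h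
  · linear_combination (e0 + e1 + e2) / 3 + (2 / 3) * (s₁ * conj s₁ - s₁ * conj s₂ - s₂ * conj s₁ +
      s₂ * conj s₂) * h

/-- The first half of a vector, adapted to the second matrix. -/
def evenPart (ω : ℂ) (v : Fin 6 → ℂ) : Fin 3 → ℂ := ![v 0, ω * v 2, ω * v 4]

/-- The second half of a vector, adapted to the second matrix. -/
def oddPart (ω : ℂ) (v : Fin 6 → ℂ) : Fin 3 → ℂ := ![v 1, ω * v 3, -(ω * v 5)]

lemma IsUnbiasedTo.isFourierUnbiased {ω : ℂ} (h1 : ‖ω‖ = 1) (h : ω ^ 2 + ω + 1 = 0)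
    {v : Fin 6 → ℂ} (hv : IsUnbiasedTo (matM2 ω) v) :
    IsFourierUnbiased (evenPart ω v) (oddPart ω v) := by
  have hc := star_cube_root h1 h
  have ha : ∀ x, ‖evenPart ω v x‖ = 1 := by
    intro x
    fin_cases x <;> simp [evenPart, h1, hv.norm_entry]
  have hb : ∀ x, ‖oddPart ω v x‖ = 1 := by
    intro x
    fin_cases x <;> simp [oddPart, h1, hv.norm_entry]
  have key : ∀ (j : Fin 6) (u z : ℂ), ‖u‖ = 1 → z = u * ((matM2 ω)ᴴ *ᵥ v) j → ‖z‖ = √6 := by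
    intro j u z hu hz
    rw [hz, norm_mul, hu, one_mul, hv.norm_inner]
  -- The phases in `evenPart` and `oddPart` are chosen so that, up to unimodular factors, columns 0,
  -- 3, 5 of `M₂` compute the Fourier coefficients of `a + b` and columns 1, 2, 4 those of `a - b`.
  obtain ⟨s1, s2⟩ := autocorrelation_of_flat h1 h
    (s₀ := evenPart ω v 0 + oddPart ω v 0) (s₁ := evenPart ω v 1 + oddPart ω v 1)
    (s₂ := evenPart ω v 2 + oddPart ω v 2)
    (key 0 ω _ h1 (by
      simp [evenPart, oddPart, matM2, Matrix.mulVec, dotProduct, Fin.sum_univ_succ, hc]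
      linear_combination (v 0 + v 1) * h))
    (key 3 1 _ norm_one (by
      simp [evenPart, oddPart, matM2, Matrix.mulVec, dotProduct, Fin.sum_univ_succ, hc]
      linear_combination (v 2 + v 3 + (ω - 1) * (v 4 - v 5)) * h))
    (key 5 1 _ norm_one (by
      simp [evenPart, oddPart, matM2, Matrix.mulVec, dotProduct, Fin.sum_univ_succ, hc]
      linear_combination (v 4 - v 5 + (ω - 1) * (v 2 + v 3)) * h))
  obtain ⟨d1, d2⟩ := autocorrelation_of_flat h1 h
    (s₀ := evenPart ω v 0 - oddPart ω v 0) (s₁ := evenPart ω v 1 - oddPart ω v 1)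
    (s₂ := evenPart ω v 2 - oddPart ω v 2)
    (key 1 ω _ h1 (by
      simp [evenPart, oddPart, matM2, Matrix.mulVec, dotProduct, Fin.sum_univ_succ, hc]
      linear_combination (v 0 - v 1) * h))
    (key 2 1 _ norm_one (by
      simp [evenPart, oddPart, matM2, Matrix.mulVec, dotProduct, Fin.sum_univ_succ, hc]
      linear_combination (v 2 - v 3 + (ω - 1) * (v 4 + v 5)) * h))
    (key 4 1 _ norm_one (by
      simp [evenPart, oddPart, matM2, Matrix.mulVec, dotProduct, Fin.sum_univ_succ, hc]
      linear_combination (v 4 + v 5 + (ω - 1) * (v 2 - v 3)) * h))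
  have ha' := fun x => Complex.mul_conj_of_norm_eq_one (ha x)
  have hb' := fun x => Complex.mul_conj_of_norm_eq_one (hb x)
  generalize evenPart ω v = a at *
  generalize oddPart ω v = b at *
  simp only [map_add, map_sub] at s1 s2 d1 d2
  refine ⟨ha, hb, ?_, ?_, ?_⟩
  · linear_combination (s1 + d1) / 2
  · linear_combination (s1 - d1) / 2
  · have hz : (a 0 * conj (b 0) + a 1 * conj (b 1) + a 2 * conj (b 2)) +
        conj (a 0 * conj (b 0) + a 1 * conj (b 1) + a 2 * conj (b 2)) = 0 := by
      simp only [map_add, map_mul, Complex.conj_conj]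
      linear_combination s2 - ha' 0 - ha' 1 - ha' 2 - hb' 0 - hb' 1 - hb' 2
    rw [Complex.add_conj] at hz
    have : 2 * (a 0 * conj (b 0) + a 1 * conj (b 1) + a 2 * conj (b 2)).re = 0 := by
      exact_mod_cast hz
    linarith

lemma inner_evenPart_oddPart {ω : ℂ} (h1 : ‖ω‖ = 1) (v w : Fin 6 → ℂ) :
    ∑ x, (conj (evenPart ω v x) * evenPart ω w x + conj (oddPart ω v x) * oddPart ω w x) =
      ∑ k, conj (v k) * w k := by
  have := Complex.mul_conj_of_norm_eq_one h1
  simp [Fin.sum_univ_succ, evenPart, oddPart]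
  linear_combination (conj (v 2) * w 2 + conj (v 3) * w 3 + conj (v 4) * w 4 +
    conj (v 5) * w 5) * this

/-- A Hermitian operator of trace zero, diagonal on the vectors of product type. -/
noncomputable def pairingMatrix : Matrix (Fin 6) (Fin 6) ℂ :=
  !![0, -Complex.I, 0, 0, 0, 0;
     Complex.I, 0, 0, 0, 0, 0;
     0, 0, 0, -Complex.I, 0, 0;
     0, 0, Complex.I, 0, 0, 0;
     0, 0, 0, 0, 0, Complex.I;
     0, 0, 0, 0, -Complex.I, 0]

/-- The operator is the Pauli matrix `Y` on the coordinate pairs `(0,1)`, `(2,3)` and `-Y` on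
`(4,5)`. The sign in the last pair compensates the one in `oddPart`, so that a product vector has
the same eigenvalue `-iμ` in all three pairs. -/
lemma pairingMatrix_mulVec {ω : ℂ} (h1 : ‖ω‖ = 1) {v : Fin 6 → ℂ}
    (h : IsProductType (evenPart ω v) (oddPart ω v)) :
    ∃ τ : ℂ, ∀ i, (pairingMatrix *ᵥ v) i = τ * v i := by
  obtain ⟨μ, hμ, h⟩ := h
  have hω : ω ≠ 0 := by rintro rfl; simp at h1
  have hμ2 : μ * μ = -1 := by rcases hμ with rfl | rfl <;> simp
  have e0 : v 1 = μ * v 0 := h 0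
  have e1 : v 3 = μ * v 2 := by
    have : ω * v 3 = μ * (ω * v 2) := h 1
    apply mul_left_cancel₀ hω
    linear_combination this
  have e2 : v 5 = -(μ * v 4) := by
    have : -(ω * v 5) = μ * (ω * v 4) := h 2
    apply mul_left_cancel₀ hω
    linear_combination -this
  refine ⟨-Complex.I * μ, fun i => ?_⟩
  fin_cases i <;> simp [pairingMatrix, Matrix.mulVec, dotProduct, Fin.sum_univ_succ, e0, e1, e2] <;>
    first
    | ring1
    | linear_combination Complex.I * v 0 * hμ2
    | linear_combination Complex.I * v 2 * hμ2
    | linear_combination Complex.I * v 4 * hμ2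
    | linear_combination (-Complex.I) * v 4 * hμ2

/-- The basis `A` diagonalises `pairingMatrix`, so the eigenvalues `τ` sum to the trace, zero. At a
vector unbiased to `A` all weights in the spectral decomposition are equal, so the quadratic form is
a multiple of `∑ τ = 0`. Computed directly, the form is a nonzero multiple of `Im ∑ a b̄`. -/
lemma false_of_isProductType {ω : ℂ} (h1 : ‖ω‖ = 1) (h : ω ^ 2 + ω + 1 = 0)
    {A B : Matrix (Fin 6) (Fin 6) ℂ} (hA : Aᴴ * A = (6 : ℂ) • 1)
    (hAB : ∀ i j, ‖(Aᴴ * B) i j‖ = √6) (hB : ∀ j, IsUnbiasedTo (matM2 ω) (B.col j))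
    (hP : ∀ j, IsProductType (evenPart ω (A.col j)) (oddPart ω (A.col j))) : False := by
  choose τ hτ using fun j => pairingMatrix_mulVec h1 (hP j)
  have hA' : A * Aᴴ = (6 : ℂ) • 1 := by
    have h2 : ((6 : ℂ)⁻¹ • Aᴴ) * A = 1 := by
      rw [Matrix.smul_mul, hA, smul_smul]; norm_num
    have h3 := mul_eq_one_comm.1 h2
    rw [Matrix.mul_smul] at h3
    rw [← h3, smul_smul]
    norm_num
  have hTA : pairingMatrix * A = A * Matrix.diagonal τ := by
    ext i j
    rw [Matrix.mul_diagonal, mul_comm]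
    exact hτ j i
  have hT : (6 : ℂ) • pairingMatrix = A * Matrix.diagonal τ * Aᴴ := by
    rw [← hTA, Matrix.mul_assoc, hA', Matrix.mul_smul, Matrix.mul_one]
  have htr : ∑ j, τ j = 0 := by
    have h2 : ((6 : ℂ) • pairingMatrix).trace = 6 * ∑ j, τ j := by
      rw [hT, Matrix.trace_mul_comm, ← Matrix.mul_assoc, hA, Matrix.smul_mul, Matrix.one_mul,
        Matrix.trace_smul, Matrix.trace_diagonal, smul_eq_mul]
    have h3 : pairingMatrix.trace = 0 := by
      simp [Matrix.trace, pairingMatrix, Fin.sum_univ_succ]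
    rw [Matrix.trace_smul, h3, smul_zero] at h2
    linear_combination -h2 / 6
  have hw : (Bᴴ * ((6 : ℂ) • pairingMatrix) * B) 0 0 = 0 := by
    have h2 : Bᴴ * ((6 : ℂ) • pairingMatrix) * B = (Aᴴ * B)ᴴ * Matrix.diagonal τ * (Aᴴ * B) := by
      rw [hT, Matrix.conjTranspose_mul, Matrix.conjTranspose_conjTranspose]
      simp only [Matrix.mul_assoc]
    rw [h2, Matrix.mul_apply]
    have h3 : ∀ j, ((Aᴴ * B)ᴴ * Matrix.diagonal τ) 0 j * (Aᴴ * B) j 0 = 6 * τ j := by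
      intro j
      rw [Matrix.mul_diagonal, Matrix.conjTranspose_apply]
      have h4 := Complex.mul_conj' ((Aᴴ * B) j 0)
      rw [hAB] at h4
      have h5 : ((√6 : ℝ) : ℂ) ^ 2 = 6 := by rw [sq]; exact sqrt_six_mul_self
      rw [h5] at h4
      change conj ((Aᴴ * B) j 0) * τ j * (Aᴴ * B) j 0 = _
      linear_combination τ j * h4
    simp only [h3, ← Finset.mul_sum, htr, mul_zero]
  have hne := ((hB 0).isFourierUnbiased h1 h).inner_im_ne_zero
  apply hne
  have hcalc : (Bᴴ * ((6 : ℂ) • pairingMatrix) * B) 0 0 =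
      6 * Complex.I * (∑ x, evenPart ω (B.col 0) x * conj (oddPart ω (B.col 0) x) -
        conj (∑ x, evenPart ω (B.col 0) x * conj (oddPart ω (B.col 0) x))) := by
    have := Complex.mul_conj_of_norm_eq_one h1
    rw [Matrix.mul_smul, Matrix.smul_mul, Matrix.smul_apply]
    simp [pairingMatrix, Matrix.mul_apply, Fin.sum_univ_succ, evenPart, oddPart]
    linear_combination (-6 * Complex.I) * (B 2 0 * conj (B 3 0) - B 4 0 * conj (B 5 0) -
      conj (B 2 0) * B 3 0 + conj (B 4 0) * B 5 0) * this
  rw [hcalc, Complex.sub_conj] at hw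
  have : ((∑ x, evenPart ω (B.col 0) x * conj (oddPart ω (B.col 0) x)).im : ℂ) = 0 := by
    push_cast at hw
    linear_combination (-1 / 12) * hw + ((∑ x, evenPart ω (B.col 0) x *
      conj (oddPart ω (B.col 0) x)).im : ℂ) * Complex.I_sq
  exact_mod_cast this

/-- If `A` contains a mixed vector, no vector of `B` can be mixed. So one of the two bases consists
of product vectors, and the trace argument applies to it with the other basis as the test. -/
theorem not_hasUnbiasedPair_matM2 {ω : ℂ} (h1 : ‖ω‖ = 1) (h : ω ^ 2 + ω + 1 = 0) :
    ¬ HasUnbiasedPair (matM2 ω) := by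
  rintro ⟨A, B, hA, hB, hAA, hBB, hAB⟩
  have hBA : ∀ i j, ‖(Bᴴ * A) i j‖ = √6 := by
    intro i j
    rw [← hAB j i, ← norm_star, ← Matrix.conjTranspose_apply, Matrix.conjTranspose_mul,
      Matrix.conjTranspose_conjTranspose]
  have hinner : ∀ i j, ‖∑ x, (conj (evenPart ω (A.col i) x) * evenPart ω (B.col j) x +
      conj (oddPart ω (A.col i) x) * oddPart ω (B.col j) x)‖ ^ 2 = 6 := by
    intro i j
    rw [inner_evenPart_oddPart h1]
    have : ∑ k, conj (A.col i k) * B.col j k = (Aᴴ * B) i j := rfl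
    rw [this, hAB, Real.sq_sqrt (by norm_num)]
  have hA' := fun j => (hA j).isFourierUnbiased h1 h
  have hB' := fun j => (hB j).isFourierUnbiased h1 h
  by_cases hP : ∀ j, IsProductType (evenPart ω (A.col j)) (oddPart ω (A.col j))
  · exact false_of_isProductType h1 h hAA hAB hB hP
  · push Not at hP
    obtain ⟨i, hi⟩ := hP
    obtain ⟨g, ξ, η, hi⟩ := (hA' i).isProductType_or_isMixedType.resolve_left hi
    refine false_of_isProductType h1 h hBB hBA hA fun j => ?_
    refine (hB' j).isProductType_or_isMixedType.resolve_right ?_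
    rintro ⟨g', ξ', η', hj⟩
    exact hi.not_unbiased hj (hinner i j)

/-! ### The first matrix in three blocks of size two -/

/-- The conditions for `(a, b)` to be unbiased to the standard basis and to `matM1`, in adapted
coordinates. -/
structure IsConferenceUnbiased (a b : Fin 3 → ℂ) : Prop where
  norm_left : ∀ j, ‖a j‖ = 1
  norm_right : ∀ j, ‖b j‖ = 1
  fst : ∀ j, ‖(1 - Complex.I) * a j + 2 * b j - (∑ k, a k + ∑ k, b k)‖ = √6
  snd : ∀ j, ‖2 * a j - (1 + Complex.I) * b j - (∑ k, a k - ∑ k, b k)‖ = √6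

/-- The first half of a vector, adapted to the first matrix. -/
def leftPart (v : Fin 6 → ℂ) : Fin 3 → ℂ := ![-v 0, v 2, v 3]

/-- The second half of a vector, adapted to the first matrix. -/
def rightPart (v : Fin 6 → ℂ) : Fin 3 → ℂ := ![-v 1, v 4, v 5]

/-- Here `M₁ᴴ = -i + C`. With the coordinates paired as `(0,1)`, `(2,4)`, `(3,5)` and the first pair
negated, every diagonal block of `C` is `X = [0 1; 1 0]` and every off-diagonal block is `-(X + Z) =
[-1 -1; -1 1]`. This makes the conditions symmetric in the three blocks. -/
lemma IsUnbiasedTo.isConferenceUnbiased {v : Fin 6 → ℂ} (hv : IsUnbiasedTo matM1 v) :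
    IsConferenceUnbiased (leftPart v) (rightPart v) := by
  have key : ∀ (j : Fin 6) (z : ℂ), z = (matM1ᴴ *ᵥ v) j ∨ z = -(matM1ᴴ *ᵥ v) j → ‖z‖ = √6 := by
    rintro j z (hz | hz) <;> rw [hz]
    · exact hv.norm_inner j
    · rw [norm_neg]; exact hv.norm_inner j
  constructor
  · intro j
    fin_cases j <;> simp [leftPart, hv.norm_entry]
  · intro j
    fin_cases j <;> simp [rightPart, hv.norm_entry]
  · intro j
    fin_cases j
    · refine key 0 _ (Or.inr ?_)
      simp [leftPart, rightPart, matM1, Matrix.mulVec, dotProduct, Fin.sum_univ_succ]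
      ring
    · refine key 2 _ (Or.inl ?_)
      simp [leftPart, rightPart, matM1, Matrix.mulVec, dotProduct, Fin.sum_univ_succ]
      ring
    · refine key 3 _ (Or.inl ?_)
      simp [leftPart, rightPart, matM1, Matrix.mulVec, dotProduct, Fin.sum_univ_succ]
      ring
  · intro j
    fin_cases j
    · refine key 1 _ (Or.inr ?_)
      simp [leftPart, rightPart, matM1, Matrix.mulVec, dotProduct, Fin.sum_univ_succ]
      ring
    · refine key 4 _ (Or.inl ?_)
      simp [leftPart, rightPart, matM1, Matrix.mulVec, dotProduct, Fin.sum_univ_succ]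
      ring
    · refine key 5 _ (Or.inl ?_)
      simp [leftPart, rightPart, matM1, Matrix.mulVec, dotProduct, Fin.sum_univ_succ]
      ring

lemma inner_leftPart_rightPart (v w : Fin 6 → ℂ) :
    ∑ j, (conj (leftPart v j) * leftPart w j + conj (rightPart v j) * rightPart w j) =
      ∑ k, conj (v k) * w k := by
  simp [Fin.sum_univ_succ, leftPart, rightPart]
  ring

/-! ### Spinors, Bloch vectors and the real polynomial system -/

/-- The real polynomial system that describes the vectors unbiased to `matM1`. -/
structure IsBlochSystem (b s g c : ℝ) (x t y : Fin 3 → ℝ) : Prop where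
  sphere : 3 * b ^ 2 + 6 * s ^ 2 + 2 * g ^ 2 = 1
  fst : ∀ j, x j * (3 * b * x j + 6 * s * t j + 2 * g * y j - 2 * g) + b * (c + 2 * y j) = 0
  snd : ∀ j, t j * (3 * b * x j + 6 * s * t j + 2 * g * y j + g) + s * (c - y j) = 0
  radius : ∀ j, 3 * x j ^ 2 + 6 * t j ^ 2 + 2 * y j ^ 2 = 1 - 2 * c
  sum_x : x 0 + x 1 + x 2 = 1
  sum_t : t 0 + t 1 + t 2 = 0
  sum_y : y 0 + y 1 + y 2 = 0
  lt_one : c < 1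

/-- The vectors with three blocks `(1 - i q·σ) d / 2` for a spinor `d = (d₀, d₁)` with squared
norm `D` and Bloch vector given by `(b, s, g)`, the `q` being given by `(x, t, y)`. -/
structure IsBlochForm (u v : Fin 3 → ℂ) (d₀ d₁ : ℂ) (D b s g : ℝ) (x t y : Fin 3 → ℝ) : Prop where
  normSq_fst : 2 * (d₀.re ^ 2 + d₀.im ^ 2) = D * (1 + (b + 2 * s))
  normSq_snd : 2 * (d₁.re ^ 2 + d₁.im ^ 2) = D * (1 - (b + 2 * s))
  inner_re : 2 * (d₁.re * d₀.re + d₁.im * d₀.im) = D * (b - s - g)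
  inner_im : 2 * (d₁.im * d₀.re - d₁.re * d₀.im) = D * (-b + s - g)
  left : ∀ j, 2 * u j = (1 - Complex.I * (x j + 2 * t j)) * d₀ -
    (Complex.I * (x j - t j - y j) + (-x j + t j - y j)) * d₁
  right : ∀ j, 2 * v j = (-(Complex.I * (x j - t j - y j)) + (-x j + t j - y j)) * d₀ +
    (1 + Complex.I * (x j + 2 * t j)) * d₁

lemma Complex.re_sq_add_im_sq_of_norm_eq_sqrt {z : ℂ} {r : ℝ} (hr : 0 ≤ r) (h : ‖z‖ = √r) :
    z.re ^ 2 + z.im ^ 2 = r := by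
  have := Complex.sq_norm z
  rw [h, Complex.normSq_apply, Real.sq_sqrt hr] at this
  linarith

/-- A vector of `ℂ²` whose inner product with `d` has real part `D / 2` is of the form
`(1 - i q·σ) d / 2`. -/
lemma exists_rotation (d₀ d₁ a b : ℂ) {D : ℝ} (hD : D ≠ 0)
    (hd : d₀.re ^ 2 + d₀.im ^ 2 + (d₁.re ^ 2 + d₁.im ^ 2) = D)
    (h : a.re * d₀.re + a.im * d₀.im + (b.re * d₁.re + b.im * d₁.im) = D / 2) :
    ∃ x t y : ℝ, 2 * a = (1 - Complex.I * (x + 2 * t)) * d₀ -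
        (Complex.I * (x - t - y) + (-x + t - y)) * d₁ ∧
      2 * b = (-(Complex.I * (x - t - y)) + (-x + t - y)) * d₀ +
        (1 + Complex.I * (x + 2 * t)) * d₁ := by
  -- `(P₁ + i P₂, Q₁ + i Q₂)` is `i (2 (a, b) - d)`. By `hPQ`, `2 (a, b) - d` is real-orthogonal to
  -- `d`; that complement is spanned by `-i X d`, `-i Y d`, `-i Z d`, and `qX, qY, qZ` are the
  -- coefficients.
  obtain ⟨P₁, hP₁⟩ : ∃ r, r = -(2 * a.im - d₀.im) := ⟨_, rfl⟩
  obtain ⟨P₂, hP₂⟩ : ∃ r, r = 2 * a.re - d₀.re := ⟨_, rfl⟩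
  obtain ⟨Q₁, hQ₁⟩ : ∃ r, r = -(2 * b.im - d₁.im) := ⟨_, rfl⟩
  obtain ⟨Q₂, hQ₂⟩ : ∃ r, r = 2 * b.re - d₁.re := ⟨_, rfl⟩
  have hPQ : P₂ * d₀.re - P₁ * d₀.im + (Q₂ * d₁.re - Q₁ * d₁.im) = 0 := by
    rw [hP₁, hP₂, hQ₁, hQ₂]
    linear_combination 2 * h - hd
  have ha₁ : a.re = (P₂ + d₀.re) / 2 := by rw [hP₂]; ring
  have ha₂ : a.im = (-P₁ + d₀.im) / 2 := by rw [hP₁]; ring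
  have hb₁ : b.re = (Q₂ + d₁.re) / 2 := by rw [hQ₂]; ring
  have hb₂ : b.im = (-Q₁ + d₁.im) / 2 := by rw [hQ₁]; ring
  obtain ⟨qZ, hZ⟩ : ∃ r, r = (P₁ * d₀.re + P₂ * d₀.im - (Q₁ * d₁.re + Q₂ * d₁.im)) / D := ⟨_, rfl⟩
  obtain ⟨qX, hX⟩ : ∃ r, r = (P₁ * d₁.re + P₂ * d₁.im + (Q₁ * d₀.re + Q₂ * d₀.im)) / D := ⟨_, rfl⟩
  obtain ⟨qY, hY⟩ : ∃ r, r = -((P₂ * d₁.re - P₁ * d₁.im) - (Q₂ * d₀.re - Q₁ * d₀.im)) / D :=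
    ⟨_, rfl⟩
  rw [eq_div_iff hD] at hZ hX hY
  -- Coordinates of `q` in the orthogonal frame `(1,-1,1)`, `(-1,1,2)`, `(-1,-1,0)`, whose squared
  -- lengths are 3, 6, 2.
  refine ⟨(qX - qY + qZ) / 3, (-qX + qY + 2 * qZ) / 6, -(qX + qY) / 2, ?_, ?_⟩
  · apply Complex.ext
    · simp
      rw [ha₁]
      apply mul_left_cancel₀ hD
      linear_combination (-d₀.im) * hZ + d₁.re * hY - d₁.im * hX + d₀.re * hPQ - P₂ * hd
    · simp
      rw [ha₂]
      apply mul_left_cancel₀ hD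
      linear_combination (d₀.re) * hZ + d₁.im * hY + d₁.re * hX + d₀.im * hPQ + P₁ * hd
  · apply Complex.ext
    · simp
      rw [hb₁]
      apply mul_left_cancel₀ hD
      linear_combination (d₁.im) * hZ - d₀.re * hY - d₀.im * hX + d₁.re * hPQ - Q₂ * hd
    · simp
      rw [hb₂]
      apply mul_left_cancel₀ hD
      linear_combination (-d₁.re) * hZ - d₀.im * hY + d₀.re * hX + d₁.im * hPQ + Q₁ * hd

namespace IsBlochForm

variable {u v : Fin 3 → ℂ} {d₀ d₁ : ℂ} {D b s g : ℝ} {x t y : Fin 3 → ℝ}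

lemma left_re (h : IsBlochForm u v d₀ d₁ D b s g x t y) (j : Fin 3) :
    (u j).re = (d₀.re + (x j + 2 * t j) * d₀.im - (-x j + t j - y j) * d₁.re +
      (x j - t j - y j) * d₁.im) / 2 := by
  have := congrArg Complex.re (h.left j)
  simp at this
  linarith

lemma left_im (h : IsBlochForm u v d₀ d₁ D b s g x t y) (j : Fin 3) :
    (u j).im = (d₀.im - (x j + 2 * t j) * d₀.re - (-x j + t j - y j) * d₁.im -
      (x j - t j - y j) * d₁.re) / 2 := by
  have := congrArg Complex.im (h.left j)
  simp at this
  linarith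

lemma right_re (h : IsBlochForm u v d₀ d₁ D b s g x t y) (j : Fin 3) :
    (v j).re = ((x j - t j - y j) * d₀.im + (-x j + t j - y j) * d₀.re + d₁.re -
      (x j + 2 * t j) * d₁.im) / 2 := by
  have := congrArg Complex.re (h.right j)
  simp at this
  linarith

lemma right_im (h : IsBlochForm u v d₀ d₁ D b s g x t y) (j : Fin 3) :
    (v j).im = (-(x j - t j - y j) * d₀.re + (-x j + t j - y j) * d₀.im + d₁.im +
      (x j + 2 * t j) * d₁.re) / 2 := by
  have := congrArg Complex.im (h.right j)
  simp at this
  linarith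

end IsBlochForm

/-- A nonzero spinor is not annihilated by a nonzero real combination of the Pauli matrices. -/
lemma eq_zero_of_spinor {d₀ d₁ : ℂ} {X Y Z : ℝ}
    (hd : d₀.re ^ 2 + d₀.im ^ 2 + (d₁.re ^ 2 + d₁.im ^ 2) ≠ 0)
    (h₁ : Z * d₀.re + X * d₁.re + Y * d₁.im = 0) (h₂ : Z * d₀.im + X * d₁.im - Y * d₁.re = 0)
    (h₃ : X * d₀.re - Y * d₀.im - Z * d₁.re = 0) (h₄ : X * d₀.im + Y * d₀.re - Z * d₁.im = 0) :
    X = 0 ∧ Y = 0 ∧ Z = 0 := by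
  have h : (d₀.re ^ 2 + d₀.im ^ 2 + (d₁.re ^ 2 + d₁.im ^ 2)) * (X ^ 2 + Y ^ 2 + Z ^ 2) = 0 := by
    linear_combination (Z * d₀.re + X * d₁.re + Y * d₁.im) * h₁ +
      (Z * d₀.im + X * d₁.im - Y * d₁.re) * h₂ + (X * d₀.re - Y * d₀.im - Z * d₁.re) * h₃ +
      (X * d₀.im + Y * d₀.re - Z * d₁.im) * h₄
  have h' := (mul_eq_zero.1 h).resolve_left hd
  refine ⟨?_, ?_, ?_⟩ <;> nlinarith [sq_nonneg X, sq_nonneg Y, sq_nonneg Z]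

namespace IsConferenceUnbiased

variable {u v : Fin 3 → ℂ}

lemma fst_sq (h : IsConferenceUnbiased u v) (j : Fin 3) :
    ((u j).re + (u j).im + 2 * (v j).re - ((∑ k, u k).re + (∑ k, v k).re)) ^ 2 +
      ((u j).im - (u j).re + 2 * (v j).im - ((∑ k, u k).im + (∑ k, v k).im)) ^ 2 = 6 := by
  have := Complex.re_sq_add_im_sq_of_norm_eq_sqrt (by norm_num) (h.fst j)
  generalize ∑ k, u k = A at *
  generalize ∑ k, v k = B at *
  simp at this
  linarith

lemma snd_sq (h : IsConferenceUnbiased u v) (j : Fin 3) :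
    (2 * (u j).re - (v j).re + (v j).im - ((∑ k, u k).re - (∑ k, v k).re)) ^ 2 +
      (2 * (u j).im - (v j).im - (v j).re - ((∑ k, u k).im - (∑ k, v k).im)) ^ 2 = 6 := by
  have := Complex.re_sq_add_im_sq_of_norm_eq_sqrt (by norm_num) (h.snd j)
  generalize ∑ k, u k = A at *
  generalize ∑ k, v k = B at *
  simp at this
  linarith

/-- With `w_j = (u_j, v_j)` and `W = ∑ w_j`, the two norm conditions at `j` add up to `‖(-i + Z +
2X) w_j - (Z + X) W‖² = 12`. As `‖w_j‖² = 2`, the term quadratic in `w_j` is exactly 12, and the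
cross term leaves `Re ⟨d, w_j⟩ = ‖d‖² / 2` for `d = (3 + i (X - Y + Z)) W / 6`. Since `‖d‖² = ‖W‖² /
3`, the hypothesis `hV` gives `d ≠ 0`, and `exists_rotation` applies. -/
lemma exists_isBlochForm (h : IsConferenceUnbiased u v) (hV : ¬ (∑ k, u k = 0 ∧ ∑ k, v k = 0)) :
    ∃ (d₀ d₁ : ℂ) (D b s g : ℝ) (x t y : Fin 3 → ℝ), 0 < D ∧
      IsBlochForm u v d₀ d₁ D b s g x t y ∧ 3 * b ^ 2 + 6 * s ^ 2 + 2 * g ^ 2 = 1 ∧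
      2 * (∑ k, u k) = (3 - Complex.I) * d₀ - (Complex.I - 1) * d₁ ∧
      2 * (∑ k, v k) = (-1 - Complex.I) * d₀ + (3 + Complex.I) * d₁ := by
  have hu := fun j => Complex.re_sq_add_im_sq_of_norm_eq_one (h.norm_left j)
  have hv := fun j => Complex.re_sq_add_im_sq_of_norm_eq_one (h.norm_right j)
  have h1 := h.fst_sq
  have h2 := h.snd_sq
  generalize ∑ k, u k = A at *
  generalize ∑ k, v k = B at *
  obtain ⟨d₀, hd₀⟩ : ∃ d, d = ((3 + Complex.I) * A + (Complex.I - 1) * B) / 6 := ⟨_, rfl⟩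
  obtain ⟨d₁, hd₁⟩ : ∃ d, d = ((1 + Complex.I) * A + (3 - Complex.I) * B) / 6 := ⟨_, rfl⟩
  have r₀ : d₀.re = (3 * A.re - A.im - B.im - B.re) / 6 := by rw [hd₀]; simp; ring
  have i₀ : d₀.im = (3 * A.im + A.re + B.re - B.im) / 6 := by rw [hd₀]; simp; ring
  have r₁ : d₁.re = (A.re - A.im + 3 * B.re + B.im) / 6 := by rw [hd₁]; simp; ring
  have i₁ : d₁.im = (A.re + A.im + 3 * B.im - B.re) / 6 := by rw [hd₁]; simp; ring
  obtain ⟨D, hD⟩ : ∃ D, d₀.re ^ 2 + d₀.im ^ 2 + (d₁.re ^ 2 + d₁.im ^ 2) = D := ⟨_, rfl⟩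
  have hDA : A.re ^ 2 + A.im ^ 2 + (B.re ^ 2 + B.im ^ 2) = 3 * D := by
    rw [← hD, r₀, i₀, r₁, i₁]; ring
  have hDpos : 0 < D := by
    by_contra hneg
    apply hV
    have z1 : A.re = 0 := by
      nlinarith [sq_nonneg A.re, sq_nonneg A.im, sq_nonneg B.re, sq_nonneg B.im]
    have z2 : A.im = 0 := by
      nlinarith [sq_nonneg A.re, sq_nonneg A.im, sq_nonneg B.re, sq_nonneg B.im]
    have z3 : B.re = 0 := by
      nlinarith [sq_nonneg A.re, sq_nonneg A.im, sq_nonneg B.re, sq_nonneg B.im]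
    have z4 : B.im = 0 := by
      nlinarith [sq_nonneg A.re, sq_nonneg A.im, sq_nonneg B.re, sq_nonneg B.im]
    exact ⟨Complex.ext z1 z2, Complex.ext z3 z4⟩
  have hL : ∀ j, (u j).re * d₀.re + (u j).im * d₀.im + ((v j).re * d₁.re + (v j).im * d₁.im) =
      D / 2 := by
    intro j
    rw [r₀, i₀, r₁, i₁]
    linear_combination (-1 / 12) * h1 j + (-1 / 12) * h2 j + hu j / 2 + hv j / 2 + hDA / 6
  choose x t y hx hy using fun j => exists_rotation d₀ d₁ (u j) (v j) hDpos.ne' hD (hL j)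
  -- `(X, Y, Z)` is the Bloch vector of `d`, a unit vector; `(b, s, g)` are its coordinates in the
  -- same frame as for the points.
  obtain ⟨X, hX⟩ : ∃ X, X = 2 * (d₁.re * d₀.re + d₁.im * d₀.im) / D := ⟨_, rfl⟩
  obtain ⟨Y, hY⟩ : ∃ Y, Y = 2 * (d₁.im * d₀.re - d₁.re * d₀.im) / D := ⟨_, rfl⟩
  obtain ⟨Z, hZ⟩ : ∃ Z, Z = (d₀.re ^ 2 + d₀.im ^ 2 - (d₁.re ^ 2 + d₁.im ^ 2)) / D := ⟨_, rfl⟩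
  rw [eq_div_iff hDpos.ne'] at hX hY hZ
  have hsph : X ^ 2 + Y ^ 2 + Z ^ 2 = 1 := by
    apply mul_left_cancel₀ (pow_pos hDpos 2).ne'
    have e : D ^ 2 * (X ^ 2 + Y ^ 2 + Z ^ 2) = (X * D) ^ 2 + (Y * D) ^ 2 + (Z * D) ^ 2 := by ring
    rw [e, hX, hY, hZ, ← hD]
    ring
  refine ⟨d₀, d₁, D, (X - Y + Z) / 3, (-X + Y + 2 * Z) / 6, -(X + Y) / 2, x, t, y, hDpos,
    ⟨?_, ?_, ?_, ?_, hx, hy⟩, ?_, ?_, ?_⟩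
  · linear_combination hD - hZ
  · linear_combination hD + hZ
  · linear_combination -hX
  · linear_combination -hY
  · linear_combination hsph
  · rw [hd₀, hd₁]
    linear_combination (A / 3) * Complex.I_sq
  · rw [hd₀, hd₁]
    linear_combination (B / 3) * Complex.I_sq

/-- The conditions `|u_j| = 1`, `|v_j| = 1` and `fst` are Hermitian forms in `d`, so they involve
`d` only through `D` and the Bloch vector (`ka`, `kb`, `kc`); the system consists of combinations of
these three. The parameter `c`, defined by `D (1 - c) = 4`, replaces the scale `D`, and `‖w_j‖² = 2`
becomes `|q_j|² = 1 - 2c`. -/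
lemma exists_isBlochSystem (h : IsConferenceUnbiased u v)
    (hV : ¬ (∑ k, u k = 0 ∧ ∑ k, v k = 0)) :
    ∃ (d₀ d₁ : ℂ) (D b s g c : ℝ) (x t y : Fin 3 → ℝ), D * (1 - c) = 4 ∧
      IsBlochForm u v d₀ d₁ D b s g x t y ∧ IsBlochSystem b s g c x t y := by
  obtain ⟨d₀, d₁, D, b, s, g, x, t, y, hD, hF, hsph, hA, hB⟩ := h.exists_isBlochForm hV
  have h1 := h.fst_sq
  have hu := fun j => Complex.re_sq_add_im_sq_of_norm_eq_one (h.norm_left j)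
  have hv := fun j => Complex.re_sq_add_im_sq_of_norm_eq_one (h.norm_right j)
  have hn : d₀.re ^ 2 + d₀.im ^ 2 + (d₁.re ^ 2 + d₁.im ^ 2) = D := by
    linear_combination hF.normSq_fst / 2 + hF.normSq_snd / 2
  obtain ⟨c, hc⟩ : ∃ c : ℝ, D * (1 - c) = 4 := ⟨1 - 4 / D, by field_simp; ring⟩
  have hsum : x 0 + x 1 + x 2 = 1 ∧ t 0 + t 1 + t 2 = 0 ∧ y 0 + y 1 + y 2 = 0 := by
    have r1 := congrArg Complex.re hA
    have r2 := congrArg Complex.im hA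
    have r3 := congrArg Complex.re hB
    have r4 := congrArg Complex.im hB
    simp [Fin.sum_univ_three, hF.left_re, hF.left_im, hF.right_re, hF.right_im] at r1 r2 r3 r4
    -- Comparing the summed block form with `hA` and `hB` gives `((∑ q_j - (1,-1,1))·σ) d = 0`, so
    -- the sum of the points is the first frame vector.
    obtain ⟨k1, k2, k3⟩ := eq_zero_of_spinor (d₀ := d₀) (d₁ := d₁)
      (X := x 0 + x 1 + x 2 - (t 0 + t 1 + t 2) - (y 0 + y 1 + y 2) - 1)
      (Y := -(x 0 + x 1 + x 2) + (t 0 + t 1 + t 2) - (y 0 + y 1 + y 2) + 1)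
      (Z := x 0 + x 1 + x 2 + 2 * (t 0 + t 1 + t 2) - 1) (by rw [hn]; exact hD.ne')
      (by linear_combination -r2) (by linear_combination r1)
      (by linear_combination -r4) (by linear_combination r3)
    refine ⟨?_, ?_, ?_⟩ <;> linarith
  have hrA : 2 * (∑ k, u k).re = 3 * d₀.re + d₀.im + d₁.im + d₁.re := by
    have := congrArg Complex.re hA
    generalize ∑ k, u k = A at *
    simp at this
    linarith
  have hiA : 2 * (∑ k, u k).im = 3 * d₀.im - d₀.re - d₁.re + d₁.im := by
    have := congrArg Complex.im hA
    generalize ∑ k, u k = A at *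
    simp at this
    linarith
  have hrB : 2 * (∑ k, v k).re = -d₀.re + d₀.im + 3 * d₁.re - d₁.im := by
    have := congrArg Complex.re hB
    generalize ∑ k, v k = A at *
    simp at this
    linarith
  have hiB : 2 * (∑ k, v k).im = -d₀.im - d₀.re + 3 * d₁.im + d₁.re := by
    have := congrArg Complex.im hB
    generalize ∑ k, v k = A at *
    simp at this
    linarith
  generalize ∑ k, u k = A at *
  generalize ∑ k, v k = B at *
  have eA : A.re = (3 * d₀.re + d₀.im + d₁.im + d₁.re) / 2 := by linarith
  have eA' : A.im = (3 * d₀.im - d₀.re - d₁.re + d₁.im) / 2 := by linarith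
  have eB : B.re = (-d₀.re + d₀.im + 3 * d₁.re - d₁.im) / 2 := by linarith
  have eB' : B.im = (-d₀.im - d₀.re + 3 * d₁.im + d₁.re) / 2 := by linarith
  obtain ⟨n1, n2, n3, n4, -, -⟩ := id hF
  have ka : ∀ j, D * ((1 + (x j + 2 * t j) ^ 2) * (1 + (b + 2 * s)) / 2 +
      ((x j - t j - y j) ^ 2 + (-x j + t j - y j) ^ 2) * (1 - (b + 2 * s)) / 2 -
      ((-x j + t j - y j) - (x j - t j - y j) * (x j + 2 * t j)) * (b - s - g) +
      ((x j - t j - y j) + (-x j + t j - y j) * (x j + 2 * t j)) * (-b + s - g)) =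
      D * (1 - c) := by
    intro j
    have := hu j
    rw [hF.left_re, hF.left_im] at this
    linear_combination 4 * this - (1 + (x j + 2 * t j) ^ 2) / 2 * n1 -
      ((x j - t j - y j) ^ 2 + (-x j + t j - y j) ^ 2) / 2 * n2 +
      ((-x j + t j - y j) - (x j - t j - y j) * (x j + 2 * t j)) * n3 -
      ((x j - t j - y j) + (-x j + t j - y j) * (x j + 2 * t j)) * n4 - hc
  have kb : ∀ j, D * ((1 + (x j + 2 * t j) ^ 2) * (1 - (b + 2 * s)) / 2 +
      ((x j - t j - y j) ^ 2 + (-x j + t j - y j) ^ 2) * (1 + (b + 2 * s)) / 2 +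
      ((-x j + t j - y j) - (x j - t j - y j) * (x j + 2 * t j)) * (b - s - g) -
      ((x j - t j - y j) + (-x j + t j - y j) * (x j + 2 * t j)) * (-b + s - g)) =
      D * (1 - c) := by
    intro j
    have := hv j
    rw [hF.right_re, hF.right_im] at this
    linear_combination 4 * this - (1 + (x j + 2 * t j) ^ 2) / 2 * n2 -
      ((x j - t j - y j) ^ 2 + (-x j + t j - y j) ^ 2) / 2 * n1 -
      ((-x j + t j - y j) - (x j - t j - y j) * (x j + 2 * t j)) * n3 +
      ((x j - t j - y j) + (-x j + t j - y j) * (x j + 2 * t j)) * n4 - hc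
  have kc : ∀ j, D * (((1 / 2 + 3 / 2 * x j + y j) ^ 2 + (1 / 2 - 3 / 2 * x j + y j) ^ 2) *
      (1 + (b + 2 * s)) / 2 + ((y j - 1) ^ 2 + 9 * t j ^ 2) * (1 - (b + 2 * s)) / 2 +
      (-(1 / 2 + 3 / 2 * x j + y j) * (y j - 1) + (1 / 2 - 3 / 2 * x j + y j) * (3 * t j)) *
        (b - s - g) -
      ((y j - 1) * -(1 / 2 - 3 / 2 * x j + y j) - (1 / 2 + 3 / 2 * x j + y j) * (3 * t j)) *
        (-b + s - g)) = D * (1 - c) * (3 / 2) := by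
    intro j
    have := h1 j
    rw [hF.left_re, hF.left_im, hF.right_re, hF.right_im, eA, eA', eB, eB'] at this
    linear_combination this - ((1 / 2 + 3 / 2 * x j + y j) ^ 2 +
      (1 / 2 - 3 / 2 * x j + y j) ^ 2) / 2 * n1 - ((y j - 1) ^ 2 + 9 * t j ^ 2) / 2 * n2 -
      (-(1 / 2 + 3 / 2 * x j + y j) * (y j - 1) + (1 / 2 - 3 / 2 * x j + y j) * (3 * t j)) * n3 +
      ((y j - 1) * -(1 / 2 - 3 / 2 * x j + y j) - (1 / 2 + 3 / 2 * x j + y j) * (3 * t j)) * n4 -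
      3 / 2 * hc
  refine ⟨d₀, d₁, D, b, s, g, c, x, t, y, hc, hF, hsph, fun j => ?_, fun j => ?_, fun j => ?_,
    hsum.1, hsum.2.1, hsum.2.2, ?_⟩
  · apply mul_left_cancel₀ hD.ne'
    linear_combination (2 * b / 4) * ka j + ((2 * b - 2) / 4) * kb j + kc j / 3
  · apply mul_left_cancel₀ hD.ne'
    linear_combination ((1 + 2 * s) / 4) * ka j + (2 * s / 4) * kb j - kc j / 6
  · apply mul_left_cancel₀ hD.ne'
    linear_combination ka j + kb j
  · have : 0 < 1 - c := by
      by_contra hneg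
      have : D * (1 - c) ≤ 0 := mul_nonpos_of_nonneg_of_nonpos hD.le (by linarith)
      linarith
    linarith

end IsConferenceUnbiased

/-! ### The three points up to order -/

lemma IsBlochSystem.comp_perm {b s g c : ℝ} {x t y : Fin 3 → ℝ} (h : IsBlochSystem b s g c x t y)
    (σ : Equiv.Perm (Fin 3)) : IsBlochSystem b s g c (x ∘ σ) (t ∘ σ) (y ∘ σ) := by
  have key : ∀ z : Fin 3 → ℝ, (z ∘ σ) 0 + (z ∘ σ) 1 + (z ∘ σ) 2 = z 0 + z 1 + z 2 := by
    intro z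
    rw [← Fin.sum_univ_three, ← Fin.sum_univ_three]
    exact Equiv.sum_comp σ z
  exact ⟨h.sphere, fun j => h.fst _, fun j => h.snd _, fun j => h.radius _, by rw [key, h.sum_x],
    by rw [key, h.sum_t], by rw [key, h.sum_y], h.lt_one⟩

/-- The points `(x, t, y)` are, up to their order, the points `(x', t', y')`. -/
def IsReordering (x t y x' t' y' : Fin 3 → ℝ) : Prop :=
  ∃ σ : Equiv.Perm (Fin 3), ∀ j, x (σ j) = x' j ∧ t (σ j) = t' j ∧ y (σ j) = y' j

lemma IsReordering.of_comp_perm {x t y x' t' y' : Fin 3 → ℝ} {σ : Equiv.Perm (Fin 3)}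
    (h : IsReordering (x ∘ σ) (t ∘ σ) (y ∘ σ) x' t' y') : IsReordering x t y x' t' y' := by
  obtain ⟨ρ, h⟩ := h
  exact ⟨ρ.trans σ, h⟩

lemma exists_perm_of_surjOn {ℓ r : Fin 3 → ℝ} (hr : Function.Injective r)
    (h : ∀ i, ∃ j, ℓ j = r i) : ∃ σ : Equiv.Perm (Fin 3), ∀ i, ℓ (σ i) = r i := by
  choose f hf using h
  have hinj : Function.Injective f := fun i j hij => hr (by rw [← hf i, ← hf j, hij])
  exact ⟨Equiv.ofBijective f (Finite.injective_iff_bijective.1 hinj), hf⟩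

lemma exists_perm_of_injective {ℓ r : Fin 3 → ℝ} (hl : Function.Injective ℓ)
    (h : ∀ j, ∃ i, ℓ j = r i) : ∃ σ : Equiv.Perm (Fin 3), ∀ i, ℓ (σ i) = r i := by
  choose f hf using h
  have hinj : Function.Injective f := fun i j hij => hl (by rw [hf i, hf j, hij])
  let e := Equiv.ofBijective f (Finite.injective_iff_bijective.1 hinj)
  exact ⟨e.symm, fun i => by rw [hf]; exact congrArg r (e.apply_symm_apply i)⟩

/-! ### Solutions with `s = 0` -/

namespace IsBlochSystem

variable {b g c : ℝ} {x t y : Fin 3 → ℝ}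

lemma add_sq_pos (h : IsBlochSystem b 0 g c x t y) : 0 < b ^ 2 + g ^ 2 := by
  nlinarith [h.sphere, sq_nonneg b, sq_nonneg g]

/-- Solutions with `s = 0` and exactly one vanishing `t`. -/
lemma one_zero (h : IsBlochSystem b 0 g c x t y) (h0 : t 0 = 0) (h1 : t 1 ≠ 0) :
    x 2 = x 1 ∧ y 2 = y 1 ∧ t 2 = -t 1 ∧ x 0 = 1 - 2 * x 1 ∧ y 0 = -2 * y 1 ∧
    ((b = 0 ∧ g ^ 2 = 1 / 2 ∧ c = -2 ∧ t 1 ^ 2 = 3 / 4 ∧ x 1 = 0 ∧ y 1 = -1 / 2) ∨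
    (∃ f ε : ℝ, f ^ 2 = 5 ∧ ε ^ 2 = 1 ∧ b = ε * (4 + f) / 11 ∧ g = ε * (3 - 2 * f) / 11 ∧
      c = (18 * f - 49) / 11 ∧ t 1 ^ 2 = ((f - 1) / 2) ^ 2 ∧ x 1 = (2 * f - 3) / 11 ∧
      y 1 = (1 + 3 * f) / 22)) := by
  have ht2 : t 2 = -t 1 := by linarith [h.sum_t]
  have h2 : t 2 ≠ 0 := by rw [ht2]; exact neg_ne_zero.2 h1
  have u1 : 3 * b * x 1 + 2 * g * y 1 + g = 0 := by
    apply (mul_eq_zero.1 (_ : t 1 * (3 * b * x 1 + 2 * g * y 1 + g) = 0)).resolve_left h1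
    linear_combination h.snd 1
  have u2 : 3 * b * x 2 + 2 * g * y 2 + g = 0 := by
    apply (mul_eq_zero.1 (_ : t 2 * (3 * b * x 2 + 2 * g * y 2 + g) = 0)).resolve_left h2
    linear_combination h.snd 2
  have w1 : -3 * g * x 1 + b * (c + 2 * y 1) = 0 := by linear_combination h.fst 1 - x 1 * u1
  have w2 : -3 * g * x 2 + b * (c + 2 * y 2) = 0 := by linear_combination h.fst 2 - x 2 * u2
  -- The points 1 and 2 satisfy the same two linear equations in `(x, y)`, with determinant `6 (b² +
  -- g²)`, so these coordinates agree.
  have hpos := h.add_sq_pos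
  have hx : x 2 = x 1 := by
    apply mul_left_cancel₀ hpos.ne'
    linear_combination (b / 3) * (u2 - u1) - (g / 3) * (w2 - w1)
  have hy : y 2 = y 1 := by
    apply mul_left_cancel₀ hpos.ne'
    linear_combination (g / 2) * (u2 - u1) + (b / 2) * (w2 - w1)
  have hx0 : x 0 = 1 - 2 * x 1 := by linarith [h.sum_x]
  have hy0 : y 0 = -2 * y 1 := by linarith [h.sum_y]
  refine ⟨hx, hy, ht2, hx0, hy0, ?_⟩
  have r0 := h.radius 0
  have r1 := h.radius 1
  have f0 := h.fst 0
  rw [h0, hx0, hy0] at r0 f0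
  generalize x 1 = X at *
  generalize y 1 = Y at *
  have hs := h.sphere
  have key : b * (c - (6 * X + 4 * Y - 3)) = 0 := by
    linear_combination f0 + 2 * (1 - 2 * X) * u1
  rcases mul_eq_zero.1 key with hb | hc
  · left
    subst hb
    have hg : g ≠ 0 := by rintro rfl; norm_num at hs
    have hY' : Y = -1 / 2 := by
      apply mul_left_cancel₀ hg
      linear_combination u1 / 2
    have hX' : X = 0 := by
      apply mul_left_cancel₀ hg
      linear_combination -w1 / 3
    subst hY' hX'
    refine ⟨rfl, by linarith, by linarith, by linarith, rfl, rfl⟩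
  · right
    have hb : b ≠ 0 := by
      rintro rfl
      have hg : g ≠ 0 := by rintro rfl; norm_num at hs
      have hY' : Y = -1 / 2 := by
        apply mul_left_cancel₀ hg
        linear_combination u1 / 2
      have hX' : X = 0 := by
        apply mul_left_cancel₀ hg
        linear_combination -w1 / 3
      subst hY' hX'
      linarith
    have hc' : c = 6 * X + 4 * Y - 3 := by linarith
    rw [hc'] at w1 r0
    have e1 : 3 * X ^ 2 + 2 * Y ^ 2 + 2 * Y - 1 = 0 := by linear_combination r0 / 4
    have e2 : X * (2 * Y + 1) = Y - Y ^ 2 := by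
      apply mul_left_cancel₀ hb
      linear_combination (X * u1 + (2 * Y + 1) * w1 / 3 - b * e1) / 2
    have hY2 : 2 * Y + 1 ≠ 0 := by
      intro hh
      rw [hh, mul_zero] at e2
      have : Y = -1 / 2 := by linarith
      rw [this] at e2
      norm_num at e2
    -- Elimination of `X` between `e1` and `e2`. The first factor is positive, and the second has
    -- the roots `(1 + 3f) / 22` with `f² = 5`, which is where `f` comes from.
    have e3 : (Y ^ 2 + Y + 1) * (11 * Y ^ 2 - Y - 1) = 0 := by
      linear_combination (2 * Y + 1) ^ 2 * e1 - 3 * (X * (2 * Y + 1) + (Y - Y ^ 2)) * e2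
    have e4 : 11 * Y ^ 2 - Y - 1 = 0 :=
      (mul_eq_zero.1 e3).resolve_left (by nlinarith [sq_nonneg (2 * Y + 1)])
    obtain ⟨f, hf⟩ : ∃ f, Y = (1 + 3 * f) / 22 := ⟨(22 * Y - 1) / 3, by ring⟩
    have hf2 : f ^ 2 = 5 := by
      rw [hf] at e4
      linear_combination (44 / 9) * e4
    have hX' : X = (2 * f - 3) / 11 := by
      apply mul_right_cancel₀ hY2
      rw [e2, hf]
      linear_combination (-3 / 44) * hf2
    have hg : g = (2 - f) * b := by
      apply mul_right_cancel₀ hY2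
      rw [hX'] at u1
      rw [hf] at u1 ⊢
      linear_combination u1 + (3 / 11) * b * hf2
    have hb2 : 121 * b ^ 2 = (4 + f) ^ 2 := by
      rw [hg] at hs
      linear_combination (21 + 8 * f) * hs + (b ^ 2 * (22 - 16 * f) - 1) * hf2
    have h4f : 4 + f ≠ 0 := by
      intro hh
      have : f = -4 := by linarith
      rw [this] at hf2
      norm_num at hf2
    refine ⟨f, 11 * b / (4 + f), hf2, ?_, ?_, ?_, ?_, ?_, hX', hf⟩
    · field_simp
      linear_combination hb2
    · field_simp
    · rw [hg]
      field_simp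
      linear_combination -hf2
    · rw [hc', hX', hf]; ring
    · rw [hc', hX', hf] at r1
      linear_combination r1 / 6 - (3 / 11) * hf2

/-- There are no solutions with `s = 0` and all `t` nonzero. -/
lemma not_all_ne_zero (h : IsBlochSystem b 0 g c x t y) : ¬ ∀ j, t j ≠ 0 := by
  intro ht
  have u : ∀ j, 3 * b * x j + 2 * g * y j + g = 0 := by
    intro j
    apply (mul_eq_zero.1 (_ : t j * (3 * b * x j + 2 * g * y j + g) = 0)).resolve_left (ht j)
    linear_combination h.snd j
  -- Sum of the three linear equations, using `∑ x = 1` and `∑ y = 0`.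
  have hbg : g = -b := by
    linear_combination (u 0 + u 1 + u 2 - 3 * b * h.sum_x - 2 * g * h.sum_y) / 3
  subst hbg
  have hb : b ≠ 0 := by
    rintro rfl
    have := h.sphere
    norm_num at this
  have w : ∀ j, 3 * x j + 2 * y j + c = 0 := by
    intro j
    apply mul_left_cancel₀ hb
    linear_combination h.fst j - x j * u j
  have u' : ∀ j, 3 * x j - 2 * y j - 1 = 0 := by
    intro j
    apply mul_left_cancel₀ hb
    linear_combination u j
  have hc : c = -1 := by linarith [w 0, w 1, w 2, h.sum_x, h.sum_y]
  subst hc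
  have hx : ∀ j, x j = 1 / 3 := fun j => by linarith [w j, u' j]
  have hy : ∀ j, y j = 0 := fun j => by linarith [w j, u' j]
  have ht2 : ∀ j, t j ^ 2 = (2 / 3) ^ 2 := by
    intro j
    have := h.radius j
    rw [hx, hy] at this
    linarith
  -- Three numbers `±2/3` cannot add up to zero.
  have ht3 : ∀ j, t j = 2 / 3 ∨ t j = -(2 / 3) := fun j => sq_eq_sq_iff_eq_or_eq_neg.1 (ht2 j)
  have := h.sum_t
  rcases ht3 0 with e0 | e0 <;> rcases ht3 1 with e1 | e1 <;> rcases ht3 2 with e2 | e2 <;>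
    rw [e0, e1, e2] at this <;> norm_num at this

/-- Planar solutions with two equal points. -/
lemma planar_equal (h : IsBlochSystem b 0 g c x t y) (ht : ∀ j, t j = 0) (hx : x 1 = x 2)
    (hy : y 1 = y 2) :
    x 0 = 1 - 2 * x 1 ∧ y 0 = -2 * y 1 ∧
    ((x 1 = 3 / 5 ∧ y 1 = 2 / 5 ∧ c = -1 / 5 ∧ ∃ f : ℝ, f ^ 2 = 5 ∧ b = 3 * f / 25 ∧
      g = 7 * f / 25) ∨
    (x 1 = 1 / 3 ∧ y 1 = 0 ∧ c = 1 / 3 ∧ ∃ f : ℝ, f ^ 2 = 5 ∧ b = f / 5 ∧ g = f / 5)) := by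
  have hx0 : x 0 = 1 - 2 * x 1 := by linarith [h.sum_x]
  have hy0 : y 0 = -2 * y 1 := by linarith [h.sum_y]
  refine ⟨hx0, hy0, ?_⟩
  have r0 := h.radius 0
  have r1 := h.radius 1
  have f0 := h.fst 0
  have f1 := h.fst 1
  have hs := h.sphere
  have hc1 := h.lt_one
  rw [ht, hx0, hy0] at r0 f0
  rw [ht] at r1 f1
  generalize x 1 = X at *
  generalize y 1 = Y at *
  have hc : c = 1 - 2 * X := by linear_combination (4 * r1 - r0) / 6
  subst hc
  have hX0 : 0 < X := by linarith
  have e0 : 3 * X ^ 2 + 2 * Y ^ 2 = 4 * X - 1 := by linear_combination r1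
  have e1 : g * (X * (Y - 1)) = b * (Y ^ 2 - Y - X) := by
    linear_combination f1 / 2 - b * e0 / 2
  have e2 : g * ((1 - 2 * X) * (2 * Y + 1)) = b * (X - 4 * Y ^ 2 - 2 * Y) := by
    linear_combination -f0 / 2 + 2 * b * e0
  have hb : b ≠ 0 := by
    rintro rfl
    have hg : g ≠ 0 := by rintro rfl; norm_num at hs
    rw [zero_mul] at e1 e2
    have e1' := (mul_eq_zero.1 ((mul_eq_zero.1 e1).resolve_left hg)).resolve_left hX0.ne'
    have e2' := (mul_eq_zero.1 e2).resolve_left hg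
    have hY1 : Y = 1 := by linarith
    subst hY1
    have : X = 1 / 2 := by linarith
    subst this
    norm_num at e0
  -- Compatibility of `e1` and `e2`, two linear equations for the ratio of `g` to `b`.
  have e3 : X * (Y - 1) * (X - 4 * Y ^ 2 - 2 * Y) =
      (1 - 2 * X) * (2 * Y + 1) * (Y ^ 2 - Y - X) := by
    apply mul_left_cancel₀ hb
    linear_combination (1 - 2 * X) * (2 * Y + 1) * e1 - X * (Y - 1) * e2
  have e4 : 4 * (1 - X) * Y = (3 * X - 1) ^ 2 := by
    linear_combination 2 * e3 - (1 - 2 * Y) * e0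
  -- Squaring `e4` and inserting `e0` eliminates `Y`, because `4X - 1 - 3X² = (1 - X)(3X - 1)`. The
  -- bracket is a difference of cubes, with the only real zero `X = 3 / 5`.
  have e5 : (3 * X - 1) * ((2 - 2 * X) ^ 3 - (3 * X - 1) ^ 3) = 0 := by
    linear_combination (4 * (1 - X) * Y + (3 * X - 1) ^ 2) * e4 - 8 * (1 - X) ^ 2 * e0
  rcases mul_eq_zero.1 e5 with e5 | e5
  · right
    have hX' : X = 1 / 3 := by linarith
    subst hX'
    have hY' : Y = 0 := by linarith
    subst hY'
    refine ⟨rfl, rfl, by norm_num, ?_⟩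
    have hg : g = b := by linarith
    subst hg
    exact ⟨5 * g, by linarith, by ring, by ring⟩
  · left
    have hX' : 2 - 2 * X = 3 * X - 1 :=
      (Odd.strictMono_pow (by decide : Odd 3)).injective (by linarith)
    have hX' : X = 3 / 5 := by linarith
    subst hX'
    have hY' : Y = 2 / 5 := by linarith
    subst hY'
    refine ⟨rfl, rfl, by norm_num, 25 * b / 3, ?_, by ring, by linarith⟩
    have hg : g = 7 / 3 * b := by linarith
    rw [hg] at hs
    linarith

/-- Planar solutions have `b ≠ 0`. -/
lemma planar_ne_zero (h : IsBlochSystem b 0 g c x t y) (ht : ∀ j, t j = 0) : b ≠ 0 := by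
  rintro rfl
  have hs := h.sphere
  have hg : g ≠ 0 := by rintro rfl; norm_num at hs
  have h1 : ∀ j, x j = 0 ∨ y j = 1 := by
    intro j
    have : x j * (y j - 1) = 0 := by
      apply mul_left_cancel₀ hg
      linear_combination h.fst j / 2
    rcases mul_eq_zero.1 this with h | h
    · exact Or.inl h
    · exact Or.inr (by linarith)
  have hr : ∀ j, 3 * x j ^ 2 + 2 * y j ^ 2 = 1 - 2 * c := by
    intro j
    have := h.radius j
    rw [ht] at this
    linarith
  have sx := h.sum_x
  have sy := h.sum_y
  have r0 := hr 0
  have r1 := hr 1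
  have r2 := hr 2
  -- Each point lies on the line `x = 0` or on the line `y = 1`; `one` and `two` exclude exactly one
  -- and exactly two points on the latter by comparing the radii.
  have one : ∀ {X Y Y' r : ℝ}, X = 1 → 1 + Y + Y' = 0 → 3 * X ^ 2 + 2 = r → 2 * Y ^ 2 = r →
      2 * Y' ^ 2 = r → False := by
    intro X Y Y' r hX hY hr h1 h2
    have h3 : Y = Y' := by
      have : (Y + Y') * (Y - Y') = 0 := by linear_combination (h1 - h2) / 2
      rcases mul_eq_zero.1 this with h | h <;> linarith
    have h4 : Y = -1 / 2 := by linarith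
    rw [h4] at h1
    rw [hX] at hr
    linarith
  have two : ∀ {X X' Y r : ℝ}, X + X' = 1 → Y = -2 → 3 * X ^ 2 + 2 = r → 3 * X' ^ 2 + 2 = r →
      2 * Y ^ 2 = r → False := by
    intro X X' Y r hX hY h1 h2 hr
    have h3 : X = X' := by
      have : (X + X') * (X - X') = 0 := by linear_combination (h1 - h2) / 3
      rcases mul_eq_zero.1 this with h | h <;> linarith
    have h4 : X = 1 / 2 := by linarith
    rw [h4] at h1
    rw [hY] at hr
    linarith
  rcases h1 0 with e0 | e0 <;> rcases h1 1 with e1 | e1 <;> rcases h1 2 with e2 | e2 <;>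
    simp only [e0, e1, e2] at sx sy r0 r1 r2
  · linarith
  · exact one (r := 1 - 2 * c) (X := x 2) (Y := y 0) (Y' := y 1) (by linarith) (by linarith) (by linarith)
      (by linarith) (by linarith)
  · exact one (r := 1 - 2 * c) (X := x 1) (Y := y 0) (Y' := y 2) (by linarith) (by linarith) (by linarith)
      (by linarith) (by linarith)
  · exact two (r := 1 - 2 * c) (X := x 1) (X' := x 2) (Y := y 0) (by linarith) (by linarith) (by linarith)
      (by linarith) (by linarith)
  · exact one (r := 1 - 2 * c) (X := x 0) (Y := y 1) (Y' := y 2) (by linarith) (by linarith) (by linarith)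
      (by linarith) (by linarith)
  · exact two (r := 1 - 2 * c) (X := x 0) (X' := x 2) (Y := y 1) (by linarith) (by linarith) (by linarith)
      (by linarith) (by linarith)
  · exact two (r := 1 - 2 * c) (X := x 0) (X' := x 1) (Y := y 2) (by linarith) (by linarith) (by linarith)
      (by linarith) (by linarith)
  · linarith

/-- Planar solutions have `g ≠ 0`. -/
lemma planar_ne_zero' (h : IsBlochSystem b 0 g c x t y) (ht : ∀ j, t j = 0) : g ≠ 0 := by
  rintro rfl
  have hb := h.planar_ne_zero ht
  have hc1 := h.lt_one
  have hr : ∀ j, 3 * x j ^ 2 + 2 * y j ^ 2 = 1 - 2 * c := by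
    intro j
    have := h.radius j
    rw [ht] at this
    linarith
  -- All `y j` are roots of one quadratic with root sum 1. With `∑ y = 0` they are either all zero,
  -- against `c < 1`, or one of them is 2; then `c = -3`, and the squared radius 7 is smaller than
  -- `2 · 2²`.
  have hy : ∀ j, 2 * y j ^ 2 - 2 * y j = 1 - c := by
    intro j
    apply mul_left_cancel₀ hb
    linear_combination -h.fst j + b * hr j
  have h01 : y 0 = y 1 ∨ y 0 + y 1 = 1 := by
    have : (y 0 - y 1) * (y 0 + y 1 - 1) = 0 := by linear_combination (hy 0 - hy 1) / 2
    rcases mul_eq_zero.1 this with h | h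
    · left; linarith
    · right; linarith
  have h12 : y 1 = y 2 ∨ y 1 + y 2 = 1 := by
    have : (y 1 - y 2) * (y 1 + y 2 - 1) = 0 := by linear_combination (hy 1 - hy 2) / 2
    rcases mul_eq_zero.1 this with h | h
    · left; linarith
    · right; linarith
  have sy := h.sum_y
  have y0 := hy 0
  have y1 := hy 1
  have y2 := hy 2
  have r0 := hr 0
  have r1 := hr 1
  have r2 := hr 2
  rcases h01 with e | e <;> rcases h12 with e' | e'
  · have : y 0 = 0 := by linarith
    rw [this] at y0
    linarith
  · have : y 2 = 2 := by linarith
    rw [this] at y2 r2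
    nlinarith [sq_nonneg (x 2)]
  · have : y 0 = 2 := by linarith
    rw [this] at y0 r0
    nlinarith [sq_nonneg (x 0)]
  · have : y 1 = 2 := by linarith
    rw [this] at y1 r1
    nlinarith [sq_nonneg (x 1)]

/-- Planar solutions with three different points. -/
lemma planar_distinct (h : IsBlochSystem b 0 g c x t y) (ht : ∀ j, t j = 0)
    (hne : ∀ i j, x i = x j → y i = y j → i = j) :
    ∃ f : ℝ, f ^ 2 = 5 ∧ b = f / 5 ∧ g = f / 5 ∧ c = -5 ∧ IsReordering x t y
      ![-1, 1 + 2 * f / 5, 1 - 2 * f / 5] ![0, 0, 0] ![-2, 1 - 3 * f / 5, 1 + 3 * f / 5] := by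
  have hb := h.planar_ne_zero ht
  have hg := h.planar_ne_zero' ht
  have hs := h.sphere
  have hc1 := h.lt_one
  obtain ⟨k, hk⟩ : ∃ k, k = b * (1 - c) / 2 := ⟨_, rfl⟩
  have hk0 : k ≠ 0 := by
    rw [hk]
    exact div_ne_zero (mul_ne_zero hb (by linarith)) two_ne_zero
  -- `u` and `ℓ` are the components of the points along and across the Bloch vector; `sphere`
  -- inverts the change of coordinates.
  obtain ⟨ℓ, hℓ⟩ : ∃ ℓ : Fin 3 → ℝ, ∀ j, ℓ j = g * x j - b * y j := ⟨_, fun _ => rfl⟩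
  obtain ⟨u, hu⟩ : ∃ u : Fin 3 → ℝ, ∀ j, u j = 3 * b * x j + 2 * g * y j := ⟨_, fun _ => rfl⟩
  have hx : ∀ j, x j = b * u j + 2 * g * ℓ j := fun j => by
    rw [hℓ, hu]; linear_combination -x j * hs
  have hy : ∀ j, y j = g * u j - 3 * b * ℓ j := fun j => by
    rw [hℓ, hu]; linear_combination -y j * hs
  have hr : ∀ j, u j ^ 2 + 6 * ℓ j ^ 2 = 1 - 2 * c := fun j => by
    have := h.radius j
    rw [ht, hx, hy] at this
    linear_combination this - (u j ^ 2 + 6 * ℓ j ^ 2) * hs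
  have hp : ∀ j, ℓ j * (g * u j - 3 * b * ℓ j - 1) = -k := fun j => by
    have h1 := h.fst j
    have h2 := h.radius j
    rw [ht] at h1 h2
    rw [← hy, hℓ, hk]
    linear_combination (h1 - b * h2) / 2
  have hℓ0 : ∀ j, ℓ j ≠ 0 := fun j h0 => by
    have := hp j
    rw [h0] at this
    apply hk0
    linarith
  have hinj : ∀ i j, i ≠ j → ℓ i ≠ ℓ j := by
    intro i j hij he
    have h1 := hp i
    have h2 := hp j
    rw [he] at h1
    have h3 : u i = u j := by
      apply mul_left_cancel₀ hg
      apply mul_left_cancel₀ (hℓ0 j)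
      linear_combination h1 - h2
    exact hij (hne i j (by rw [hx, hx, he, h3]) (by rw [hy, hy, he, h3]))
  -- Eliminating `u` between `hr` and `hp` leaves a quartic with the three distinct roots `ℓ j`.
  have hq : ∀ j, 3 * ℓ j ^ 4 + 6 * b * ℓ j ^ 3 + (1 - 6 * b * k - g ^ 2 * (1 - 2 * c)) * ℓ j ^ 2 -
      2 * k * ℓ j + k ^ 2 = 0 := fun j => by
    linear_combination g ^ 2 * ℓ j ^ 2 * hr j - 3 * ℓ j ^ 4 * hs -
      (ℓ j * (g * u j) + ℓ j * (3 * b * ℓ j + 1) - k) * hp j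
  have s1 : ℓ 0 + ℓ 1 + ℓ 2 = g := by
    rw [hℓ, hℓ, hℓ]
    linear_combination g * h.sum_x - b * h.sum_y
  have su : u 0 + u 1 + u 2 = 3 * b := by
    rw [hu, hu, hu]
    linear_combination 3 * b * h.sum_x + 2 * g * h.sum_y
  have d01 := sub_ne_zero.2 (hinj 0 1 (by decide))
  have d12 := sub_ne_zero.2 (hinj 1 2 (by decide))
  have d20 := sub_ne_zero.2 (hinj 2 0 (by decide))
  obtain ⟨σ, hσ⟩ : ∃ σ, σ = ℓ 0 * ℓ 1 + ℓ 1 * ℓ 2 + ℓ 2 * ℓ 0 := ⟨_, rfl⟩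
  obtain ⟨P, hP⟩ : ∃ P, P = ℓ 0 * ℓ 1 * ℓ 2 := ⟨_, rfl⟩
  have hP0 : P ≠ 0 := by
    rw [hP]
    exact mul_ne_zero (mul_ne_zero (hℓ0 0) (hℓ0 1)) (hℓ0 2)
  have hcub : ∀ j, ℓ j ^ 3 - g * ℓ j ^ 2 + σ * ℓ j - P = 0 := by
    intro j
    fin_cases j <;> simp only [Fin.zero_eta, Fin.mk_one, Fin.reduceFinMk] <;> rw [hσ, hP, ← s1] <;>
      ring
  have hkσ : k * σ = 3 * P := by
    have h0 := hp 0
    have h1 := hp 1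
    have h2 := hp 2
    rw [hσ, hP]
    linear_combination ℓ 1 * ℓ 2 * h0 + ℓ 0 * ℓ 2 * h1 + ℓ 0 * ℓ 1 * h2 -
      ℓ 0 * ℓ 1 * ℓ 2 * (g * su - 3 * b * s1)
  -- `A`, `B`, `C` are the coefficients of the remainder of the quartic modulo the cubic with roots
  -- `ℓ j`. A polynomial of degree at most two with three distinct zeros vanishes, so all three are
  -- zero, and this determines `k`, `P`, `σ` and `c`.
  obtain ⟨A, hA⟩ : ∃ A, A = 1 - 6 * b * k - g ^ 2 * (1 - 2 * c) - 3 * σ + 3 * (2 * b + g) * g :=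
    ⟨_, rfl⟩
  obtain ⟨B, hB⟩ : ∃ B, B = -2 * k + 3 * P - 3 * (2 * b + g) * σ := ⟨_, rfl⟩
  obtain ⟨C, hC⟩ : ∃ C, C = k ^ 2 + 3 * (2 * b + g) * P := ⟨_, rfl⟩
  have hquad : ∀ j, A * ℓ j ^ 2 + B * ℓ j + C = 0 := fun j => by
    rw [hA, hB, hC]
    linear_combination hq j - (3 * ℓ j + 3 * (2 * b + g)) * hcub j
  have l01 : A * (ℓ 0 + ℓ 1) + B = 0 := by
    apply mul_left_cancel₀ d01
    linear_combination hquad 0 - hquad 1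
  have l12 : A * (ℓ 1 + ℓ 2) + B = 0 := by
    apply mul_left_cancel₀ d12
    linear_combination hquad 1 - hquad 2
  have A0 : A = 0 := by
    apply mul_left_cancel₀ d20
    linear_combination l12 - l01
  have B0 : B = 0 := by rw [A0] at l01; linarith
  have C0 : C = 0 := by have := hquad 0; rw [A0, B0] at this; linarith
  rw [hA] at A0
  rw [hB] at B0
  rw [hC] at C0
  have hkz : k = 2 * b + g := by
    have e1 : P * (k - (2 * b + g)) = 0 := by
      linear_combination (k * B0 + 2 * C0) / 3 + (2 * b + g) * hkσ
    have := (mul_eq_zero.1 e1).resolve_left hP0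
    linarith
  have hPk : P = -k / 3 := by
    rw [← hkz] at C0
    apply mul_left_cancel₀ hk0
    linear_combination C0 / 3
  have hσ1 : σ = -1 := by
    apply mul_left_cancel₀ hk0
    rw [hkσ, hPk]
    ring
  have hg10 : g ^ 2 * (1 - 2 * c - 11) = 0 := by
    rw [hσ1, hkz] at A0
    linear_combination -A0 - 4 * hs
  have hc : c = -5 := by
    have := (mul_eq_zero.1 hg10).resolve_left (pow_ne_zero 2 hg)
    linarith
  have hbg : b = g := by
    rw [hc] at hk
    linarith
  subst hbg
  have hb2 : 5 * b ^ 2 = 1 := by linarith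
  have hk3 : k = 3 * b := by linarith
  -- For the parameters found, the cubic with roots `ℓ j` factors as `(r - b)(r² - 1)`.
  have hroot : ∀ r : ℝ, (r - b) * (r ^ 2 - 1) = 0 → ∃ j, ℓ j = r := by
    intro r hr
    have : (ℓ 0 - r) * ((ℓ 1 - r) * (ℓ 2 - r)) = 0 := by
      linear_combination -hr - hP + r * hσ + r ^ 2 * s1 + hPk - r * hσ1 - hk3 / 3
    rcases mul_eq_zero.1 this with h | h
    · exact ⟨0, by linarith⟩
    rcases mul_eq_zero.1 h with h | h
    · exact ⟨1, by linarith⟩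
    · exact ⟨2, by linarith⟩
  have hb1 : b ≠ 1 := by rintro rfl; norm_num at hb2
  have hb1' : b ≠ -1 := by rintro rfl; norm_num at hb2
  obtain ⟨ρ, hρ⟩ := exists_perm_of_surjOn (ℓ := ℓ) (r := ![b, 1, -1])
    (by
      intro i j
      fin_cases i <;> fin_cases j <;> simp [hb1, hb1', hb1.symm, hb1'.symm] <;> norm_num)
    (by
      intro i
      apply hroot
      fin_cases i <;> simp)
  have hub : ∀ j, b * ℓ j * u j = 3 * b * ℓ j ^ 2 + ℓ j - 3 * b := fun j => by
    linear_combination hp j - hk3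
  have u0 : u (ρ 0) = -7 * b := by
    have := hub (ρ 0)
    rw [hρ 0] at this
    simp at this
    apply mul_left_cancel₀ (mul_ne_zero hb hb)
    linear_combination this + 2 * b * hb2
  have u1 : u (ρ 1) = 5 * b := by
    have := hub (ρ 1)
    rw [hρ 1] at this
    simp at this
    apply mul_left_cancel₀ hb
    linear_combination this - hb2
  have u2 : u (ρ 2) = 5 * b := by
    have := hub (ρ 2)
    rw [hρ 2] at this
    simp at this
    apply mul_left_cancel₀ hb
    linear_combination this - hb2
  refine ⟨5 * b, by linarith, by ring, by ring, hc, ρ, fun j => ?_⟩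
  fin_cases j
  · refine ⟨?_, ht _, ?_⟩
    · rw [hx]; simp [u0, hρ 0]; linarith
    · rw [hy]; simp [u0, hρ 0]; linarith
  · refine ⟨?_, ht _, ?_⟩
    · rw [hx]; simp [u1, hρ 1]; linarith
    · rw [hy]; simp [u1, hρ 1]; linarith
  · refine ⟨?_, ht _, ?_⟩
    · rw [hx]; simp [u2, hρ 2]; linarith
    · rw [hy]; simp [u2, hρ 2]; linarith

end IsBlochSystem

/-! ### Solutions with `s ≠ 0`: Fourier modes and the possible parameters -/

/-- The discrete Fourier modes of the polynomial system satisfied by three different points. -/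
structure IsModeSystem (X X' T T' Y Y' b g c : ℂ) : Prop where
  e10 : 2*X'*Y*g + 2*X*Y'*g + 6*X*X'*b + b*c + 6*X'*T + 6*X*T' - 2/3*g + 1/3*b = 0
  e11 : 2*X'*Y'*g + 3*X'^2*b + 2/3*Y*g + 2*Y*b + 6*X'*T' - 2*X*g + 2*X*b + 2*T = 0
  e12 : 2*X*Y*g + 3*X^2*b + 2/3*Y'*g + 2*Y'*b - 2*X'*g + 2*X'*b + 6*X*T + 2*T' = 0
  e20 : 2*T'*Y*g + 2*T*Y'*g + 3*X'*T*b + 3*X*T'*b + 12*T*T' + c = 0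
  e21 : 2*T'*Y'*g + 3*X'*T'*b + 6*T'^2 + T*g + T*b - Y = 0
  e22 : 2*T*Y*g + 3*X*T*b + T'*g + T'*b + 6*T^2 - Y' = 0
  r0 : 4*Y*Y' + 12*T*T' + 6*X*X' + 2*c - 2/3 = 0
  r1 : 2*Y'^2 + 6*T'^2 + 3*X'^2 + 2*X = 0
  r2 : 2*Y^2 + 6*T^2 + 3*X^2 + 2*X' = 0
  d0 : - 8*Y'^3*g^2 - 8*Y^3*g^2 + 24*T'^2*Y'*g^2 + 24*T^2*Y*g^2 - 36*X'*Y'^2*b*g + 36*X'*T'^2*b*g +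
    12*X'^2*Y'*g^2 - 36*X'^2*Y'*b^2 + 18*X'^3*b*g - 36*X*Y^2*b*g + 36*X*T^2*b*g + 12*X^2*Y*g^2 -
    36*X^2*Y*b^2 + 18*X^3*b*g - 16*Y*Y'*g^2 + 48*Y*Y'*b*g - 72*T'*Y'^2*g + 72*T'^3*g - 72*T*Y^2*g +
    96*T*T'*g^2 - 48*T*T'*b*g + 144*T*T'*b^2 + 72*T^3*g - 16*X'*Y*g^2 - 24*X'*Y*b*g + 48*X'*Y*b^2 -
    144*X'*T'*Y'*b + 36*X'^2*T'*g - 16*X*Y'*g^2 - 24*X*Y'*b*g + 48*X*Y'*b^2 - 144*X*T*Y*b -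
    24*X*X'*g^2 - 72*X*X'*b*g - 72*X*X'*b^2 + 36*X^2*T*g - 48*T'*Y*g + 96*T'*Y*b - 144*T'^2*Y' -
    48*T*Y'*g + 96*T*Y'*b - 144*T^2*Y - 48*X'*T*g - 72*X'*T*b - 48*X*T'*g - 72*X*T'*b - 16/3*g^2 -
    64/3*b*g - 16*b^2 + 144*T*T' - 72*X*X' - 16 = 0
  d1 : - 24*Y^2*Y'*g^2 + 48*T*T'*Y*g^2 + 24*T^2*Y'*g^2 - 36*X'*Y^2*b*g + 36*X'*T^2*b*g - 72*X*Y*Y'*b*g +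
    72*X*T*T'*b*g + 24*X*X'*Y*g^2 - 72*X*X'*Y*b^2 + 12*X^2*Y'*g^2 - 36*X^2*Y'*b^2 + 54*X^2*X'*b*g -
    8*Y'^2*g^2 + 24*Y'^2*b*g - 72*T'*Y^2*g + 48*T'^2*g^2 - 24*T'^2*b*g + 72*T'^2*b^2 - 144*T*Y*Y'*g +
    216*T^2*T'*g - 16*X'*Y'*g^2 - 24*X'*Y'*b*g + 48*X'*Y'*b^2 - 144*X'*T*Y*b - 12*X'^2*g^2 -
    36*X'^2*b*g - 36*X'^2*b^2 - 144*X*T'*Y*b - 144*X*T*Y'*b + 72*X*X'*T*g + 36*X^2*T'*g + 64/3*Y*g^2 +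
    16*Y*b*g - 16*Y*b^2 - 48*T'*Y'*g + 96*T'*Y'*b - 288*T*T'*Y - 144*T^2*Y' - 48*X'*T'*g - 72*X'*T'*b
    + 16*X*g^2 + 48*X*b*g + 48*X*b^2 + 72*T'^2 + 64*T*g + 48*T*b - 36*X'^2 + 48*X = 0
  d2 : - 24*Y*Y'^2*g^2 + 24*T'^2*Y*g^2 + 48*T*T'*Y'*g^2 - 72*X'*Y*Y'*b*g + 72*X'*T*T'*b*g + 12*X'^2*Y*g^2
    - 36*X'^2*Y*b^2 - 36*X*Y'^2*b*g + 36*X*T'^2*b*g + 24*X*X'*Y'*g^2 - 72*X*X'*Y'*b^2 + 54*X*X'^2*b*g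
    - 8*Y^2*g^2 + 24*Y^2*b*g - 144*T'*Y*Y'*g - 72*T*Y'^2*g + 216*T*T'^2*g + 48*T^2*g^2 - 24*T^2*b*g +
    72*T^2*b^2 - 144*X'*T'*Y*b - 144*X'*T*Y'*b + 36*X'^2*T*g - 16*X*Y*g^2 - 24*X*Y*b*g + 48*X*Y*b^2 -
    144*X*T'*Y'*b + 72*X*X'*T'*g - 12*X^2*g^2 - 36*X^2*b*g - 36*X^2*b^2 + 64/3*Y'*g^2 + 16*Y'*b*g -
    16*Y'*b^2 - 144*T'^2*Y - 48*T*Y*g + 96*T*Y*b - 288*T*T'*Y' + 16*X'*g^2 + 48*X'*b*g + 48*X'*b^2 -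
    48*X*T*g - 72*X*T*b + 64*T'*g + 48*T'*b + 72*T^2 - 36*X^2 + 48*X' = 0

namespace IsModeSystem

variable {X X' T T' Y Y' b g c : ℂ}

set_option maxHeartbeats 4000000 in
/-- The only possible values of the parameter `c`. -/
lemma parameter_cubic (h : IsModeSystem X X' T T' Y Y' b g c) : (2 * c + 1) * (c + 1) * (c - 1) = 0 := by
  -- A certificate of ideal membership: the cubic in `c` is an explicit polynomial combination of
  -- the twelve mode equations, and only a ring identity has to be checked. The four statements
  -- after this one, for the two admissible values of `c`, are certified in the same way.
  linear_combination (596/729*Y*Y'*b*c + 5336/10935*Y^3*g - 166/45*T'*Y*c^2 - 17428/10935*T'*Y*g^2 + 1762/3645*T'*Y*b*g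
    - 17932/3645*T'*Y*b^2 + 44/5*T'*Y^2*Y' + 4148/1215*T'^2*Y'*b - 166/45*T*Y'*c^2 -
    17428/10935*T*Y'*g^2 + 1762/3645*T*Y'*b*g - 17932/3645*T*Y'*b^2 - 152/15*T*Y*Y'^2 +
    596/243*T*T'*b*c + 132/5*T*T'^2*Y - 5336/3645*T^2*Y*g - 152/5*T^2*T'*Y' + 172/729*X'*Y'^2*g -
    161/162*X'*Y'^2*b - 596/729*X'*Y*g*c + 332/45*X'*T'*Y'*c + 152/45*X'*T'*Y^2 - 1289/405*X'*T'^2*g +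
    2941/810*X'*T'^2*b + 2/15*X'*T*c^2 + 32/405*X'*T*g^2 + 18184/3645*X'*T*b*g + 181/243*X'*T*b^2 -
    152/45*X'*T*Y*Y' + 161/162*X'^2*Y'*g + 6539/2430*X'^2*Y'*b - 4/15*X'^2*T'*c - 631/270*X'^3*g -
    596/729*X*Y'*g*c + 1897/3645*X*Y^2*g - 1909/3645*X*Y^2*b + 2/15*X*T'*c^2 + 32/405*X*T'*g^2 +
    18184/3645*X*T'*b*g + 181/243*X*T'*b^2 - 508/45*X*T'*Y*Y' + 508/45*X*T*Y'^2 + 332/45*X*T*Y*c +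
    1318/1215*X*T^2*g + 263/405*X*T^2*b - 298/243*X*X'*b*c + 66/5*X*X'*T'*Y - 76/5*X*X'*T*Y' +
    178/15*X*X'^2*T + 4577/3645*X^2*Y*g + 319/90*X^2*Y*b - 4/15*X^2*T*c - 178/15*X^2*X'*T' -
    3358/1215*X^3*g + 298/729*b*c^2 + 20186/10935*Y*Y'*g + 111956/10935*Y*Y'*b - 356/135*T'*Y'^2 +
    1900/243*T'*Y*c - 2002/1215*T*Y'*c + 15602/729*T*Y^2 - 17576/3645*T*T'*g - 18758/1215*T*T'*b +
    190/3*T^3 - 43609/21870*X'*Y*g + 10699/7290*X'*Y*b + 5051/1215*X'*T'*Y' - 71/135*X'*T*c +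
    7399/2430*X'^2*T' - 7544/3645*X*Y'*g + 1562/3645*X*Y'*b - 7519/1215*X*T'*c + 5051/1215*X*T*Y -
    1201/7290*X*X'*g + 6859/1215*X*X'*b + 55409/1215*X^2*T + 856/3645*g*c + 1178/10935*b*c -
    10861/3645*T'*Y + 1829/3645*T*Y' + 50587/1458*X'*T + 41938/3645*X*T' + 1238/10935*g + 11/15*b) *
    h.e10 + (- 16399/10935*Y*Y'^2*g - 596/729*Y^2*b*c + 32/1215*T'*b*g*c + 9074/3645*T'*b^2*c +
    152/45*T'*Y*Y'*c - 548/45*T'*Y^3 - 24527/3645*T'^2*Y*g - 118/405*T'^2*Y*b - 1810/729*T*Y*g^2 +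
    14048/3645*T*Y*b*g - 9002/3645*T*Y*b^2 + 548/45*T*Y^2*Y' - 296/405*T*T'*Y'*g + 236/405*T*T'*Y'*b +
    4*T^2*T'*Y - 4*T^3*Y' + 16177/3645*X'*Y*Y'*g - 1909/3645*X'*Y*Y'*b - 152/45*X'*T'*Y'^2 -
    424/45*X'*T'*Y*c + 332/45*X'*T*Y'*c + 152/45*X'*T*Y^2 - 448/135*X'*T*T'*g - 356/15*X'*T^3 -
    2668/3645*X'^2*Y*g + 631/135*X'^2*Y*b - 4/15*X'^2*T*c - 631/405*X*Y'^2*g - 161/81*X*Y'^2*b +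
    596/243*X*Y*g*c + 92/45*X*T'*Y'*c + 68/15*X*T'*Y^2 + 8332/1215*X*T'^2*g - 2941/405*X*T'^2*b -
    8786/3645*X*T*g^2 + 4573/3645*X*T*b*g - 362/243*X*T*b^2 - 508/45*X*T*Y*Y' + 356/15*X*T^2*T' +
    161/162*X*X'*Y'*g + 4/15*X*X'*T'*c + 142/5*X*X'*T*Y - 86/243*X*X'^2*g + 596/243*X^2*b*c -
    66/5*X^2*T'*Y - 76/5*X^2*T*Y' - 178/15*X^2*X'*T + 178/15*X^3*T' + 1192/729*Y'*g*c +
    7673/2430*Y'*b*c - 17363/10935*Y^2*g + 212468/10935*Y^2*b - 16/45*T'*c^2 - 24089/10935*T'*g^2 -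
    22021/2187*T'*b*g - 1882/3645*T'*b^2 - 65966/3645*T'*Y*Y' - 7796/405*T*Y'^2 + 1526/135*T*Y*c -
    41198/405*T*T'^2 - 301/27*T^2*g + 1502/1215*T^2*b - 8819/3645*X'*g*c + 4285/972*X'*b*c -
    1906/1215*X'*T'*Y + 5131/1215*X'*T*Y' - 10313/2430*X'^2*T - 58633/2187*X*Y*g - 23624/3645*X*Y*b -
    551/45*X*T'*Y' - 4516/1215*X*T*c - 63559/2430*X*X'*T' + 18833/7290*X^2*g - 10961/1215*X^2*b -
    286918/10935*Y'*g - 1068041/21870*Y'*b - 3826/1215*T'*c - 16136/3645*T*Y + 186227/7290*X'*g -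
    1063727/14580*X'*b - 19594/729*X*T - 1515292/10935*T') * h.e11 + (1192/729*Y'^2*b*c -
    32798/10935*Y^2*Y'*g - 63446/10935*T'*Y'*g^2 - 3236/3645*T'*Y'*b*g + 9098/1215*T'*Y'*b^2 -
    304/45*T'*Y*Y'^2 - 2074/1215*T'^2*b*c + 284/5*T'^3*Y + 32/1215*T*b*g*c + 9074/3645*T*b^2*c +
    304/45*T*Y'^3 + 152/45*T*Y*Y'*c + 448/729*T*T'*Y*g - 284/5*T*T'^2*Y' - 526/1215*T^2*Y'*g -
    1192/729*X'*Y'*g*c - 6716/3645*X'*Y^2*g - 9154/3645*X'*Y^2*b + 8498/3645*X'*T'*g^2 -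
    49871/3645*X'*T'*b*g - 362/243*X'*T'*b^2 - 152/45*X'*T'*Y*Y' - 508/45*X'*T*Y'^2 + 92/45*X'*T*Y*c +
    389/135*X'*T^2*g - 526/405*X'*T^2*b + 76/5*X'^2*T'*Y + 76/5*X'^2*T*Y' - 178/15*X'^3*T +
    18251/3645*X*Y*Y'*g - 9154/3645*X*Y*Y'*b + 508/45*X*T'*Y'^2 + 332/45*X*T'*Y*c - 424/45*X*T*Y'*c -
    152/45*X*T*Y^2 - 5398/1215*X*T*T'*g + 1909/3645*X*X'*Y*g - 152/5*X*X'*T'*Y' + 4/15*X*X'*T*c +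
    178/15*X*X'^2*T' + 6716/1215*X^2*Y'*b - 4/15*X^2*T'*c - 1897/2430*X^2*X'*g - 3208/729*Y'^2*g -
    119104/3645*Y'^2*b - 4768/2187*Y*g*c - 5347/1458*Y*b*c - 224/27*T'*Y'*c + 38392/3645*T'*Y^2 -
    159614/3645*T'^2*g - 3992/135*T'^2*b - 16/45*T*c^2 - 15361/2187*T*g^2 - 55661/10935*T*b*g -
    1882/3645*T*b^2 - 37316/3645*T*Y*Y' + 19288/405*T^2*T' + 113962/3645*X'*Y'*g - 15631/3645*X'*Y'*b
    - 3596/1215*X'*T'*c - 11437/1215*X'*T*Y - 1265/243*X'^2*g + 2027/1215*X*g*c - 31709/7290*X*b*c +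
    5951/243*X*T'*Y + 25246/1215*X*T*Y' - 27329/1215*X*X'*T + 12853/243*X^2*T' + 1200254/32805*Y*g +
    122977/2430*Y*b + 12892/729*T'*Y' - 37079/3645*T*c + 176272/3645*X'*T' - 364594/10935*X*g +
    42553/810*X*b + 282103/2187*T) * h.e12 + (- 29632/10935*Y*Y'*g^2 - 14576/2187*Y*Y'*b*g -
    7234/3645*T'*Y'^2*g - 1192/729*T'*Y*g*c - 118/405*T'^3*g - 1192/729*T*Y'*g*c - 36872/3645*T*T'*g^2
    + 74032/3645*T*T'*b*g - 36584/1215*T*T'*b^2 + 712/45*T*T'*Y*Y' + 712/15*T^2*T'^2 + 166/45*X'*Y*c^2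
    + 17428/10935*X'*Y*g^2 - 614/135*X'*Y*b*g - 18508/3645*X'*Y*b^2 - 44/5*X'*Y^2*Y' +
    5356/1215*X'*T'*Y'*g - 7588/1215*X'*T'*Y'*b - 152/5*X'*T*T'*Y + 4*X'*T^2*Y' - 332/45*X'^2*Y'*c -
    152/45*X'^2*Y^2 - 221/135*X'^2*T'*g + 356/15*X'^2*T^2 + 4/15*X'^3*c + 166/45*X*Y'*c^2 +
    17428/10935*X*Y'*g^2 - 614/135*X*Y'*b*g - 18508/3645*X*Y'*b^2 + 152/15*X*Y*Y'^2 +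
    2074/1215*X*T'*b*c - 132/5*X*T'^2*Y + 5356/1215*X*T*Y*g + 284/5*X*T*T'*Y' - 4/15*X*X'*c^2 +
    9074/3645*X*X'*g^2 + 44/3*X*X'*Y*Y' - 142/5*X*X'^2*Y - 508/45*X^2*Y'^2 - 332/45*X^2*Y*c -
    2678/405*X^2*T*g + 152/5*X^2*X'*Y' + 4/15*X^3*c - 2/45*c^3 + 8942/10935*b*g*c - 11789/10935*b^2*c
    - 712/135*Y'^3 - 7324/3645*Y*Y'*c - 224/135*Y^3 - 14948/3645*T'*Y*g - 84452/3645*T'*Y*b -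
    1376/243*T'^2*Y' - 21844/3645*T*Y'*g - 19652/729*T*Y'*b - 29072/1215*T*T'*c + 488/45*T^2*Y +
    1321/81*X'*Y'^2 - 13136/1215*X'*Y*c + 31291/405*X'*T'^2 + 37552/3645*X'*T*g + 7246/405*X'*T*b -
    2258/405*X'^2*Y' + 29537/2430*X'^3 + 4522/1215*X*Y'*c - 10958/405*X*Y^2 + 25792/3645*X*T'*g +
    8974/405*X*T'*b - 21398/405*X*T^2 + 5006/405*X*X'*c - 10424/1215*X^2*Y - 73877/1215*X^3 +
    547/729*c^2 + 26228/10935*g^2 + 32936/3645*b*g + 17411/3645*b^2 - 35252/3645*Y*Y' - 20384/405*T*T'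
    - 19582/3645*X'*Y - 17842/1215*X*Y' - 877/15*X*X' - 11288/1215*c + 151471/32805) * h.e20 + (-
    23948/10935*Y^2*g^2 + 99886/10935*Y^2*b*g + 8296/3645*T'*Y*Y'*g + 7234/3645*T*Y'^2*g +
    1192/729*T*Y*g*c - 118/405*T*T'^2*g + 18628/1215*T^2*g^2 - 9482/1215*T^2*b*g + 36584/1215*T^2*b^2
    - 712/45*T^2*Y*Y' - 712/15*T^3*T' - 32/1215*X'*b*g*c - 9074/3645*X'*b^2*c - 152/45*X'*Y*Y'*c +
    92/45*X'*Y^3 + 128/45*X'*T'*Y*g + 236/405*X'*T'*Y*b + 362/1215*X'*T*Y'*g + 1376/243*X'*T*Y'*b +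
    132/5*X'*T^2*Y + 152/45*X'^2*Y'^2 + 424/45*X'^2*Y*c - 593/135*X'^2*T*g + 63446/10935*X*Y*g^2 -
    6904/1215*X*Y*b*g + 72592/3645*X*Y*b^2 - 92/45*X*Y^2*Y' - 2678/405*X*T*b*c - 132/5*X*T^2*Y' -
    424/45*X*X'*Y'*c - 356/45*X*X'*Y^2 - 356/15*X*X'*T^2 + 8642/3645*X^2*g^2 + 508/45*X^2*Y*Y' -
    29398/32805*Y'*g^2 + 31978/2187*Y'*b*g - 80168/10935*Y'*b^2 + 1216/135*Y*Y'^2 + 12832/3645*Y^2*c -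
    874/135*T'*g*c + 31874/3645*T'*b*c - 3328/405*T'^2*Y - 50132/729*T*Y*g + 26144/729*T*Y*b +
    20252/1215*T*T'*Y' + 404/15*T^2*c + 4/9*X'*c^2 - 19430/2187*X'*g^2 + 14704/1215*X'*b*g +
    41798/3645*X'*b^2 + 1222/1215*X'*Y*Y' - 264/5*X'*T*T' + 952/1215*X'^2*Y + 304/135*X*Y'^2 -
    34/135*X*Y*c + 50912/3645*X*T*g - 1550/81*X*T*b + 23462/1215*X*X'*Y' + 1814/405*X^2*c +
    7198/1215*Y'*c + 157436/3645*Y^2 + 588032/10935*T'*g - 484586/3645*T'*b - 796/45*T^2 -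
    2008/1215*X'*c + 28658/3645*X*Y - 7912/405*X^2 + 91682/2187*Y' + 159416/1215*X') * h.e21 +
    (27904/10935*Y'^2*g^2 - 9002/10935*Y'^2*b*g + 73168/3645*T'^2*g^2 - 64742/3645*T'^2*b*g +
    36584/1215*T'^2*b^2 - 712/45*T'^2*Y*Y' - 712/15*T*T'^3 + 1810/729*X'*Y'*g^2 + 13856/3645*X'*Y'*b*g
    + 304/45*X'*Y*Y'^2 - 132/5*X'*T'^2*Y + 132/5*X'*T*T'*Y' + 152/45*X'^2*Y*Y' - 356/15*X'^2*T*T' -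
    32/1215*X*b*g*c - 9074/3645*X*b^2*c - 304/45*X*Y'^3 - 152/45*X*Y*Y'*c - 424/45*X*X'*Y*c +
    424/45*X^2*Y'*c + 152/45*X^2*Y^2 + 4220/729*Y'^2*c + 15746/3645*Y*g^2 - 30242/3645*Y*b*g +
    2408/405*Y*b^2 + 124/27*Y^2*Y' + 16532/405*T'*Y'*g + 92572/3645*T'*Y'*b + 35032/1215*T'^2*c +
    242/3645*T*g*c - 12544/3645*T*b*c - 88/3*T*T'*Y + 172/15*T^2*Y' + 112/27*X'*Y'*c - 928/45*X'*Y^2 -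
    3088/45*X'*T^2 - 6244/1215*X'^2*c + 4/9*X*c^2 + 8522/3645*X*g^2 + 6088/3645*X*b*g -
    30794/3645*X*b^2 + 2936/135*X*Y*Y' - 112/405*X*X'*Y + 166/405*X^2*Y' - 52154/3645*Y'^2 +
    9716/3645*Y*c + 135214/1215*T'^2 - 43216/1215*T*g + 448756/3645*T*b + 710/81*X'*Y' +
    1687/1215*X'^2 + 65452/3645*X*c - 163324/3645*Y - 369184/3645*X) * h.e22 + (2/45*T'*Y*g*c^2 +
    83/45*T'*Y*b*c^2 - 4/135*T'*Y*b*g^2 - 8/405*T'*Y*b^2*g - 4/135*T'*Y*b^3 - 152/45*T'*Y^2*Y'*b +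
    2/45*T*Y'*g*c^2 + 83/45*T*Y'*b*c^2 - 4/135*T*Y'*b*g^2 - 8/405*T*Y'*b^2*g - 4/135*T*Y'*b^3 +
    76/45*T*Y*Y'^2*b + 76/5*T*T'^2*Y*b + 76/15*X'*T'*Y^2*g - 149/729*b^2*c^2 - 2/45*Y*Y'*c^2 +
    4858/3645*Y*Y'*g^2 + 22561/10935*Y*Y'*b*g - 3571/729*Y*Y'*b^2 - 10/27*T'*Y'^2*g - 19/135*T'*Y'^2*b
    - 3751/3645*T'*Y*g*c - 2824/1215*T'*Y*b*c - 35*T'^3*b - 3751/3645*T*Y'*g*c + 2927/1215*T*Y'*b*c -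
    356/135*T*Y^2*g - 644/135*T*Y^2*b + 2/15*T*T'*c^2 + 6226/1215*T*T'*g^2 - 3007/405*T*T'*b*g +
    17501/1215*T*T'*b^2 - 178/45*T^3*g + 446/45*T^3*b - 83/45*X'*Y*c^2 - 5828/3645*X'*Y*g^2 +
    5252/1215*X'*Y*b*g - 3397/3645*X'*Y*b^2 - 76/45*X'*Y^2*Y' - 506/135*X'*T'*Y'*g - 8/15*X'*T*g*c -
    89/45*X'*T*b*c + 178/45*X'^2*T'*g - 83/45*X*Y'*c^2 - 5828/3645*X*Y'*g^2 + 5252/1215*X*Y'*b*g -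
    3397/3645*X*Y'*b^2 - 76/45*X*Y*Y'^2 - 8/15*X*T'*g*c - 76/5*X*T'^2*Y + 416/135*X*T*Y*g +
    1/15*X*X'*c^2 - 1472/1215*X*X'*g^2 - 178/45*X^2*T*g + 1/45*c^3 - 853/2187*b*g*c + 7631/21870*b^2*c
    - 1001/3645*Y*Y'*c - 178/135*Y^3 + 19456/1215*T'*Y*g + 70531/3645*T'*Y*b - 406/45*T'^2*Y' +
    27082/3645*T*Y'*g + 37288/3645*T*Y'*b + 1075/243*T*T'*c - 712/45*T^2*Y + 76/45*X'*Y'^2 +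
    6091/1215*X'*Y*c + 862/45*X'*T'^2 - 3056/405*X'*T*g + 4292/405*X'*T*b - 2738/1215*X*Y'*c -
    23/45*X*Y^2 - 23866/1215*X*T'*g - 1159/45*X*T^2 - 19357/2430*X*X'*c + 4609/7290*c^2 -
    10352/10935*g^2 - 43856/10935*b*g - 1037/486*b^2 - 6098/3645*Y*Y' + 71518/1215*T*T' +
    1528/1215*X'*Y + 2741/405*X*Y' + 5887/810*X*X' + 58568/10935*c - 2431/2430) * h.r0 +
    (596/729*Y^2*g^2*c + 152/15*T'*Y^3*b - 4/45*T*Y*g*c^2 - 166/45*T*Y*b*c^2 + 8/135*T*Y*b*g^2 +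
    16/405*T*Y*b^2*g + 8/135*T*Y*b^3 - 152/45*T*Y^2*Y'*b + 298/243*X*Y*b*g*c - 152/15*X*T'*Y^2*g +
    8819/10935*Y'*g^2*c - 4768/2187*Y'*b*g*c - 1192/729*Y'*b^2*c - 62191/10935*Y^2*g^2 -
    6983/3645*Y^2*b*g + 118/1215*Y^2*b^2 - 32/405*T'*g^3 - 4453/1215*T'*b*g^2 + 4453/1215*T'*b^2*g -
    9098/1215*T'*b^3 - 20/27*T'*Y*Y'*g + 190/27*T'*Y*Y'*b + 136/45*T*Y'^2*g - 304/45*T*Y'^2*b +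
    16442/3645*T*Y*g*c - 5854/1215*T*Y*b*c + 356/45*T*T'^2*g + 3506/45*T*T'^2*b - 4/15*T^2*c^2 -
    1153/405*T^2*g^2 - 187/405*T^2*b*g - 35356/1215*T^2*b^2 + 10229/3645*X'*b*g*c - 4285/972*X'*b^2*c
    + 1012/135*X'*T*Y'*g + 112/9*X'*T*Y'*b - 356/45*X'^2*T*g + 166/45*X*Y*c^2 + 4111/729*X*Y*g^2 -
    2822/243*X*Y*b*g + 859/135*X*Y*b^2 + 152/45*X*Y^2*Y' + 16/15*X*T*g*c - 2/15*X^2*c^2 +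
    2944/1215*X^2*g^2 - 40597/10935*Y'*g^2 + 43129/1215*Y'*b*g + 119104/3645*Y'*b^2 + 64/15*Y^2*c +
    680/729*T'*g*c - 1597/1215*T'*b*c - 152/15*T'^2*Y - 150812/3645*T*Y*g + 2744/405*T*Y*b +
    224/9*T*T'*Y' + 874/243*T^2*c - 4/45*X'*c^2 - 7124/1215*X'*g^2 - 40913/1458*X'*b*g +
    981779/14580*X'*b^2 - 1724/45*X'*T*T' - 152/45*X*Y'^2 - 136/243*X*Y*c + 3038/243*X*T*g +
    19357/1215*X^2*c + 20162/3645*Y'*c - 1532/3645*Y^2 - 22006/405*T'*g + 429022/3645*T'*b -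
    106298/1215*T^2 - 29537/7290*X'*c - 170/81*X*Y - 184/15*X^2 - 26077/3645*Y' - 6829/1215*X') * h.r1
    + (- 4/45*T'*Y'*g*c^2 - 166/45*T'*Y'*b*c^2 + 8/135*T'*Y'*b*g^2 + 16/405*T'*Y'*b^2*g +
    8/135*T'*Y'*b^3 - 152/45*T'*Y*Y'^2*b - 152/5*T'^3*Y*b + 4/45*Y'^2*c^2 + 74644/10935*Y'^2*g^2 +
    25024/10935*Y'^2*b*g + 35356/3645*Y'^2*b^2 - 121/10935*Y*g^2*c + 1028/1215*Y*b*g*c +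
    596/729*Y*b^2*c - 422/729*T'*Y'*g*c + 302/1215*T'*Y'*b*c + 772/135*T'*Y^2*g + 548/45*T'*Y^2*b -
    1834/243*T'^2*g^2 + 1252/81*T'^2*b*g - 1786/729*T*g^3 + 4477/1215*T*b*g^2 - 22073/3645*T*b^2*g +
    9002/3645*T*b^3 - 232/135*T*Y*Y'*g - 356/135*T*Y*Y'*b + 712/45*T^2*T'*g - 536/45*T^2*T'*b +
    166/45*X'*Y'*c^2 + 17857/3645*X'*Y'*b^2 + 152/45*X'*Y*Y'^2 + 16/15*X'*T'*g*c + 152/5*X'*T'^2*Y -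
    86/45*X'*T*Y*b + 241/486*X*b*g*c + 19789/7290*X*b^2*c - 832/135*X*T'*Y*g + 356/45*X^2*T'*g -
    2710/729*Y'^2*c + 83696/10935*Y*g^2 - 255046/10935*Y*b*g - 212468/10935*Y*b^2 + 356/135*Y^2*Y' +
    21172/1215*T'*Y'*g - 131308/3645*T'*Y'*b - 424/15*T'^2*c - 14657/3645*T*g*c - 10867/729*T*b*c +
    1352/45*T*T'*Y - 152/15*T^2*Y' - 6836/1215*X'*Y'*c + 46/45*X'*Y^2 + 48121/1215*X'*T'*g +
    66/5*X'*T^2 - 149/81*X*g^2 + 155209/7290*X*b*g - 368269/7290*X*b^2 + 1724/45*X*T*T' +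
    12838/1215*Y'^2 + 14246/3645*Y*c - 440/81*T'^2 + 19334/405*T*g - 46781/405*T*b - 6287/405*X'*Y' +
    3907/405*X*c + 77116/3645*Y + 1016/243*X) * h.r2 + (1334/10935*X'*Y - 4819/14580*X*X' +
    953/14580*c + 1519/14580) * h.d0 + (298/2187*Y'*c - 893/2187*T'*g + 4501/21870*T'*b -
    4577/21870*X*Y + 1679/3645*X^2 - 37573/21870*Y' + 743/14580*X') * h.d1 + (- 149/2187*Y*c +
    59/2430*T'^2 - 16/1215*T*g - 4549/7290*T*b - 161/972*X'*Y' + 631/1620*X'^2 + 12532/6561*Y +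
    3074/10935*X) * h.d2

set_option maxHeartbeats 4000000 in
/-- A consequence of the system for `c = -1`. -/
lemma mul_of_neg_one (h : IsModeSystem X X' T T' Y Y' b g (-1)) : 4 * b * g + 3 = 0 := by
  linear_combination (24*Y*Y'*g - 39/4*Y*Y'*b + 72*T*T'*g - 297/4*T*T'*b + 39/8*X'*Y*g - 45/8*X'*Y*b + 39/8*X*Y'*g -
    45/8*X*Y'*b + 189/4*X*X'*g + 297/8*X'*T + 297/8*X*T' - 61/4*g + 63/4*b) * h.e10 + (- 243/2*Y^2*g -
    693/8*Y^2*b - 81/2*T^2*g - 189/2*T^2*b + 693/8*X*Y*g - 1791/16*X*Y*b - 1125/16*X^2*g + 333/2*Y'*g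
    + 1053/4*Y'*b - 324*T*Y - 1269/8*X'*g + 1935/8*X'*b + 189/2*X*T + 2763/4*T') * h.e11 +
    (825/16*Y'^2*g + 483/4*Y'^2*b - 3897/16*T'^2*g - 27/4*T'^2*b - 483/4*X'*Y'*g + 549/8*X'*Y'*b +
    279/32*X'^2*g - 1609/8*Y*g - 1941/8*Y*b + 1593/4*T'*Y' + 27/4*X'*T' + 1623/16*X*g - 585/2*X*b -
    6147/8*T) * h.e12 + (- 33*T'*Y*g - 189/2*T'*Y*b - 33*T*Y'*g - 189/2*T*Y'*b + 567/4*X'*T*g +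
    27/4*X'*T*b + 567/4*X*T'*g + 27/4*X*T'*b + 39*Y*Y' - 81*T*T' - 189/4*X'*Y - 189/4*X*Y' - 54*X*X' -
    21/2) * h.e20 + (1215/4*T*Y*g + 189*T*Y*b - 2889/8*X*T*g + 891/4*X*T*b - 693/4*Y^2 - 111/4*T'*g +
    3573/4*T'*b + 783/2*T^2 + 1377/8*X*Y - 27*X^2 - 1353/4*Y' - 981/2*X') * h.e21 + (- 201*T'*Y'*g +
    189*T'*Y'*b + 249/2*Y'^2 - 459/2*T'^2 + 27/2*T*g - 972*T*b - 189*X'*Y' - 459/4*X'^2 + 333*Y +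
    2079/4*X) * h.e22 + (- 5/8*Y*Y'*g^2 - 111/4*Y*Y'*b*g + 117/8*Y*Y'*b^2 - 171/8*T*T'*g^2 -
    45/4*T*T'*b*g - 351/8*T*T'*b^2 - 15/8*X'*Y*g^2 - 105/8*X'*Y*b*g - 189/8*X'*Y*b^2 - 15/8*X*Y'*g^2 -
    105/8*X*Y'*b*g - 189/8*X*Y'*b^2 + 171/16*X*X'*g^2 - 3/2*T'*Y*g + 45/4*T'*Y*b - 3/2*T*Y'*g +
    45/4*T*Y'*b - 477/8*X'*T*g - 477/8*X*T'*g + 79/16*g^2 + 23/8*b*g - 9/16*b^2 - 27/8*Y*Y' -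
    621/8*T*T' + 27/4*X'*Y + 27/4*X*Y' + 81/16*X*X' + 99/16) * h.r0 + (205/8*Y^2*g^2 + 24*Y^2*b*g +
    351/4*T^2*b^2 + 15/2*X*Y*g^2 + 957/16*X*Y*b*g + 189/4*X*Y*b^2 - 171/8*X^2*g^2 + 177/16*Y'*g^2 -
    2933/16*Y'*b*g - 483/4*Y'*b^2 + 1029/8*T*Y*g - 45/2*T*Y*b - 447/16*X'*g^2 + 879/16*X'*b*g -
    2745/8*X'*b^2 + 261/2*X*T*g + 2463/16*T'*g - 3411/4*T'*b + 621/4*T^2 - 27/2*X*Y - 81/8*X^2 +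
    249/4*Y' - 405/4*X') * h.r1 + (- 39/2*Y'^2*g^2 + 63/2*Y'^2*b*g - 117/4*Y'^2*b^2 + 171/4*T'^2*g^2 +
    45/2*T'^2*b*g + 189/4*X'*Y'*b^2 + 75/8*Y*g^2 + 237*Y*b*g + 693/8*Y*b^2 - 108*T'*Y'*g -
    45/2*T'*Y'*b + 108*X'*T'*g - 99/16*X*g^2 + 225/8*X*b*g + 5949/16*X*b^2 + 27/4*Y'^2 - 117/2*T*g +
    3753/4*T*b - 27/2*X'*Y' - 693/8*Y + 1377/16*X) * h.r2 + (- 9/16) * h.d0 + (61/8*Y' - 135/16*X') *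
    h.d1 + (- 231/32*Y + 423/64*X) * h.d2

set_option maxHeartbeats 4000000 in
/-- A consequence of the system for `c = -1`. -/
lemma sq_of_neg_one (h : IsModeSystem X X' T T' Y Y' b g (-1)) : 6 * b ^ 2 - 2 * g ^ 2 + 3 = 0 := by
  linear_combination (- 96*Y*Y'*g + 147/4*Y*Y'*b - 288*T*T'*g + 1197/4*T*T'*b - 111/8*X'*Y*g + 189/8*X'*Y*b -
    111/8*X*Y'*g + 189/8*X*Y'*b - 765/4*X*X'*g + 27/2*X*X'*b - 1089/8*X'*T - 1089/8*X*T' + 281/4*g -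
    315/4*b) * h.e10 + (975/2*Y^2*g + 2853/8*Y^2*b + 333/2*T^2*g + 765/2*T^2*b - 2997/8*X*Y*g +
    7263/16*X*Y*b + 4437/16*X^2*g - 27*X^2*b - 1353/2*Y'*g - 4365/4*Y'*b + 1296*T*Y + 5253/8*X'*g -
    7983/8*X'*b - 873/2*X*T - 11283/4*T') * h.e11 + (- 3225/16*Y'^2*g - 1995/4*Y'^2*b +
    15705/16*T'^2*g + 99/4*T'^2*b + 1995/4*X'*Y'*g - 2133/8*X'*Y'*b - 1143/32*X'^2*g + 6649/8*Y*g +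
    7989/8*Y*b - 6345/4*T'*Y' - 99/4*X'*T' - 6807/16*X*g + 2457/2*X*b + 25395/8*T) * h.e12 +
    (141*T'*Y*g + 765/2*T'*Y*b + 141*T*Y'*g + 765/2*T*Y'*b - 2295/4*X'*T*g - 99/4*X'*T*b -
    2295/4*X*T'*g - 99/4*X*T'*b - 165*Y*Y' + 351*T*T' + 765/4*X'*Y + 765/4*X*Y' + 225*X*X' + 97/2) *
    h.e20 + (- 5007/4*T*Y*g - 765*T*Y*b + 11529/8*X*T*g - 3627/4*X*T*b + 2853/4*Y^2 + 591/4*T'*g -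
    14565/4*T'*b - 3231/2*T^2 - 5409/8*X*Y + 99*X^2 + 5481/4*Y' + 4029/2*X') * h.e21 + (825*T'*Y'*g -
    765*T'*Y'*b - 1041/2*Y'^2 + 1827/2*T'^2 - 123/2*T*g + 3960*T*b + 765*X'*Y' + 1827/4*X'^2 - 1365*Y
    - 8655/4*X) * h.e22 + (29/8*Y*Y'*g^2 + 447/4*Y*Y'*b*g - 477/8*Y*Y'*b^2 + 675/8*T*T'*g^2 +
    189/4*T*T'*b*g + 1431/8*T*T'*b^2 + 63/8*X'*Y*g^2 + 429/8*X'*Y*b*g + 765/8*X'*Y*b^2 + 63/8*X*Y'*g^2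
    + 429/8*X*Y'*b*g + 765/8*X*Y'*b^2 - 675/16*X*X'*g^2 + 21/2*T'*Y*g - 189/4*T'*Y*b + 21/2*T*Y'*g -
    189/4*T*Y'*b + 1917/8*X'*T*g + 1917/8*X*T'*g - 335/16*g^2 - 115/8*b*g + 81/16*b^2 + 99/8*Y*Y' +
    2565/8*T*T' - 99/4*X'*Y - 99/4*X*Y' - 297/16*X*X' - 507/16) * h.r0 + (- 877/8*Y^2*g^2 - 96*Y^2*b*g
    - 1431/4*T^2*b^2 - 63/2*X*Y*g^2 - 3981/16*X*Y*b*g - 765/4*X*Y*b^2 + 675/8*X^2*g^2 - 817/16*Y'*g^2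
    + 11957/16*Y'*b*g + 1995/4*Y'*b^2 - 4341/8*T*Y*g + 189/2*T*Y*b + 1791/16*X'*g^2 - 3807/16*X'*b*g +
    11241/8*X'*b^2 - 1053/2*X*T*g - 10431/16*T'*g + 13923/4*T'*b - 2565/4*T^2 + 99/2*X*Y + 297/8*X^2 -
    1041/4*Y' + 1629/4*X') * h.r1 + (159/2*Y'^2*g^2 - 255/2*Y'^2*b*g + 477/4*Y'^2*b^2 - 675/4*T'^2*g^2
    - 189/2*T'^2*b*g - 765/4*X'*Y'*b^2 - 283/8*Y*g^2 - 963*Y*b*g - 2853/8*Y*b^2 + 432*T'*Y'*g +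
    189/2*T'*Y'*b - 432*X'*T'*g + 387/16*X*g^2 - 825/8*X*b*g - 24381/16*X*b^2 - 99/4*Y'^2 + 501/2*T*g
    - 15273/4*T*b + 99/2*X'*Y' + 2853/8*Y - 5409/16*X) * h.r2 + (33/16) * h.d0 + (- 253/8*Y' +
    543/16*X') * h.d1 + (951/32*Y - 1671/64*X) * h.d2

set_option maxHeartbeats 4000000 in
/-- A consequence of the system for `c = -1 / 2`. -/
lemma linear_of_neg_half (h : IsModeSystem X X' T T' Y Y' b g (-1 / 2)) : b + 2 * g = 0 := by
  linear_combination (- 12*T'*Y*g + 77*T'*Y*b - 12*T*Y'*g + 77*T*Y'*b - 72*X'*T'^2 - 69*X'*T*g + 45/2*X'*T*b -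
    69*X*T'*g + 45/2*X*T'*b - 72*X*T^2 + 25/2*Y*Y' - 93/2*T*T' + 28*X'*Y + 28*X*Y' - 33/4*X*X' +
    371/24) * h.e10 + (36*T'^2*Y - 24*T*Y*g + 76*T*Y*b - 36*T*T'*Y' - 36*X'*T*T' + 36*X*T'^2 +
    16*X*T*g - 45*X*T*b - 28*Y^2 + 124/3*T'*g - 41*T'*b - 108*T^2 - 56*X*Y - 15*X^2 + 100/3*Y' -
    91*X') * h.e11 + (- 24*T'*Y'*g - 48*T'*Y'*b - 36*T*T'*Y + 36*T^2*Y' + 140*X'*T'*g - 45*X'*T'*b +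
    36*X'*T^2 - 36*X*T*T' + 3*Y'^2 - 15*T'^2 - 124/3*T*g - 41*T*b - 56*X'*Y' + 63/2*X'^2 + 100/3*Y +
    64*X) * h.e12 + (40/3*Y*Y'*g + 208*T*T'*g - 168*T*T'*b + 12*X'*Y*g - 57*X'*Y*b + 72*X'^2*T' +
    12*X*Y'*g - 57*X*Y'*b + 50*X*X'*g + 72*X^2*T - 36*T'*Y - 36*T*Y' + 78*X'*T + 78*X*T' + 107/18*g +
    395/12*b) * h.e20 + (- 268/3*Y^2*g - 228*T^2*g + 168*T^2*b - 36*X'*T'*Y + 36*X'*T*Y' - 36*X'^2*T +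
    24*X*Y*g - 220*X*Y*b + 36*X*X'*T' + 62*X^2*g - 308/3*Y'*g + 404/3*Y'*b - 136*T*Y - 614/3*X'*g -
    53*X'*b - 48*X*T + 28*T') * h.e21 + (104/3*Y'^2*g - 104*T'^2*g + 168*T'^2*b + 24*X'*Y'*g +
    28*X'*Y'*b + 36*X*T'*Y - 36*X*T*Y' + 36*X*X'*T - 36*X^2*T' + 188/3*Y*g - 92/3*Y*b + 112*T'*Y' -
    48*X'*T' + 2*X*g + 195*X*b + 28*T) * h.e22 + (- 15*T'*Y*g^2 + 3/2*T'*Y*b*g - 29/2*T'*Y*b^2 -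
    15*T*Y'*g^2 + 3/2*T*Y'*b*g - 29/2*T*Y'*b^2 + 59/3*Y*Y'*g - 25/2*Y*Y'*b - 123*T*T'*g + 147/2*T*T'*b
    + 31/4*X'*Y*g + 21/2*X'*Y*b + 31/4*X*Y'*g + 21/2*X*Y'*b - 3/2*X*X'*g + 34*T'*Y + 34*T*Y' -
    39/4*X'*T - 39/4*X*T' - 55/6*g - 577/48*b) * h.r0 + (30*T*Y*g^2 - 3*T*Y*b*g + 29*T*Y*b^2 -
    56/3*Y^2*g + 28*Y^2*b + 68*T'*g^2 - 36*T'*b*g + 48*T'*b^2 + 126*T^2*g - 27*T^2*b - 31*X*Y*g -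
    21*X*Y*b + 3*X^2*g + 49/3*Y'*g - 3*Y'*b - 68*T*Y + 21*X'*g + 70*X'*b - 27*X*T + 53*T') * h.r1 +
    (30*T'*Y'*g^2 - 3*T'*Y'*b*g + 29*T'*Y'*b^2 - 62/3*Y'^2*g - 3*Y'^2*b + 120*T'^2*g - 120*T'^2*b +
    6*T*g^2 + 26*T*b*g - 76*T*b^2 - 21*X'*Y'*b - 106/3*Y*g + 28*Y*b - 68*T'*Y' + 66*X'*T' - 12*X*g -
    54*X*b - 40*T) * h.r2 + (- 19/3*T') * h.d1 + (4*T) * h.d2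

set_option maxHeartbeats 4000000 in
/-- A consequence of the system for `c = -1 / 2`. -/
lemma sq_of_neg_half (h : IsModeSystem X X' T T' Y Y' (-2 * g) g (-1 / 2)) : 3 * g ^ 2 - 1 = 0 := by
  linear_combination (18350/776937*Y*Y'*g + 11146/258979*T*T'*g - 18350/258979*X'*Y*g - 18350/258979*X*Y'*g +
    450389/258979*X*X'*g - 1373950/258979*T'*Y - 1373950/258979*T*Y' - 885732/258979*X'*T -
    885732/258979*X*T' - 7710779/2330811*g) * h.e10 + (- 27650/110991*Y^2*g - 47254/258979*T^2*g +
    217727/110991*X*Y*g - 103654/36997*X^2*g - 706120/332973*Y'*g + 171824/258979*T*Y +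
    1468021/1553874*X'*g + 130823/36997*X*T - 332785/776937*T') * h.e11 + (- 27650/110991*Y'^2*g -
    47254/258979*T'^2*g + 114073/110991*X'*Y'*g - 187850/332973*Y*g + 171824/258979*T'*Y' +
    27169/36997*X'*T' + 5821489/1553874*X*g - 1058363/776937*T) * h.e12 + (105654/258979*X'*T*g +
    105654/258979*X*T'*g + 186546/258979*Y*Y' - 192726/36997*T*T' + 832662/258979*X'*Y +
    832662/258979*X*Y' + 104715/258979*X*X' - 448573/517958) * h.e20 + (- 186546/258979*Y^2 +
    88861/258979*T'*g + 192726/36997*T^2 + 560352/258979*X*Y + 159111/36997*X^2 + 415811/258979*Y' -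
    22212/258979*X') * h.e21 + (- 186546/258979*Y'^2 + 192726/36997*T'^2 + 88861/258979*T*g +
    560352/258979*X'*Y' + 159111/36997*X'^2 + 415811/258979*Y - 22212/258979*X) * h.e22 + (-
    1180421/258979*T'*Y*g - 1180421/258979*T*Y'*g - 398122/258979*g^2 - 24184/36997*Y*Y' -
    51774/258979*T*T' - 348399/258979*X'*Y - 348399/258979*X*Y' + 36276/36997*X*X' + 1928245/3107748)
    * h.r0 + (- 490201/1553874*Y'*g^2 + 2360842/258979*T*Y*g + 861113/517958*X'*g^2 +
    148509/517958*T'*g - 456090/258979*T^2 + 696798/258979*X*Y - 72552/36997*X^2 - 93273/258979*Y' -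
    58400/258979*X') * h.r1 + (- 490201/1553874*Y*g^2 + 2360842/258979*T'*Y'*g + 861113/517958*X*g^2 +
    48368/36997*Y'^2 + 559638/258979*T'^2 + 148509/517958*T*g + 696798/258979*X'*Y' - 93273/258979*Y +
    280176/258979*X) * h.r2 + (464897/18646488) * h.d0 + (- 14600/776937*X') * h.d1 + (-
    14600/776937*X) * h.d2

end IsModeSystem

/-- The determinant of the linear relations satisfied by the difference of two of the points, in
terms of the third point. -/
def detForm {R : Type*} [CommRing R] (b g x t y : R) : R :=
  (3 - 3 * x) * ((6 * (1 - x)) * (-2 * g * t - 2) -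
    (2 * g * (1 - x) + 4 * b) * (3 * b - (3 * b * x + 6 * t + 2 * g * y) + 2 * g - 6 * t)) -
  (-6 * t) * ((3 * b - (3 * b * x + 6 * t + 2 * g * y) - 4 * g + 3 * b * (1 - x)) *
    (-2 * g * t - 2) - (2 * g * (1 - x) + 4 * b) * (-3 * b * t)) +
  (-2 * y) * ((3 * b - (3 * b * x + 6 * t + 2 * g * y) - 4 * g + 3 * b * (1 - x)) *
    (3 * b - (3 * b * x + 6 * t + 2 * g * y) + 2 * g - 6 * t) - (6 * (1 - x)) * (-3 * b * t))

/-- Splitting of the first equation into Fourier modes. -/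
lemma modes_fst {z X X' T T' Y Y' b g c : ℂ} (hz : z ^ 3 = 1)
    (h : (1 / 3 + z * X + z ^ 2 * X') * (3 * b * (1 / 3 + z * X + z ^ 2 * X') + 6 * (z * T + z ^ 2 * T') +
      2 * g * (z * Y + z ^ 2 * Y') - 2 * g) + b * (c + 2 * (z * Y + z ^ 2 * Y')) = 0) :
    (2*X'*Y*g + 2*X*Y'*g + 6*X*X'*b + b*c + 6*X'*T + 6*X*T' - 2/3*g + 1/3*b) +
    z * (2*X'*Y'*g + 3*X'^2*b + 2/3*Y*g + 2*Y*b + 6*X'*T' - 2*X*g + 2*X*b + 2*T) +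
    z ^ 2 * (2*X*Y*g + 3*X^2*b + 2/3*Y'*g + 2*Y'*b - 2*X'*g + 2*X'*b + 6*X*T + 2*T') = 0 := by
  linear_combination h - ((2)*X'*Y'*g*(z) + (2)*X'*Y*g*(1) + (3)*X'^2*b*(z) + (2)*X*Y'*g*(1) + (6)*X*X'*b*(1) +
    (6)*X'*T'*(z) + (6)*X'*T*(1) + (6)*X*T'*(1)) * hz

/-- Splitting of the second equation into Fourier modes. -/
lemma modes_snd {z X X' T T' Y Y' b g c : ℂ} (hz : z ^ 3 = 1)
    (h : (z * T + z ^ 2 * T') * (3 * b * (1 / 3 + z * X + z ^ 2 * X') + 6 * (z * T + z ^ 2 * T') + 2 * g *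
      (z * Y + z ^ 2 * Y') + g) + (c - (z * Y + z ^ 2 * Y')) = 0) :
    (2*T'*Y*g + 2*T*Y'*g + 3*X'*T*b + 3*X*T'*b + 12*T*T' + c) +
    z * (2*T'*Y'*g + 3*X'*T'*b + 6*T'^2 + T*g + T*b - Y) +
    z ^ 2 * (2*T*Y*g + 3*X*T*b + T'*g + T'*b + 6*T^2 - Y') = 0 := by
  linear_combination h - ((2)*T'*Y'*g*(z) + (2)*T'*Y*g*(1) + (2)*T*Y'*g*(1) + (3)*X'*T'*b*(z) + (3)*X'*T*b*(1) +
    (3)*X*T'*b*(1) + (6)*T'^2*(z) + (12)*T*T'*(1)) * hz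

/-- Splitting of the third equation into Fourier modes. -/
lemma modes_radius {z X X' T T' Y Y' c : ℂ} (hz : z ^ 3 = 1)
    (h : 3 * (1 / 3 + z * X + z ^ 2 * X') ^ 2 + 6 * (z * T + z ^ 2 * T') ^ 2 + 2 * (z * Y + z ^ 2 * Y') ^ 2
      = 1 - 2 * c) :
    (4*Y*Y' + 12*T*T' + 6*X*X' + 2*c - 2/3) +
    z * (2*Y'^2 + 6*T'^2 + 3*X'^2 + 2*X) +
    z ^ 2 * (2*Y^2 + 6*T^2 + 3*X^2 + 2*X') = 0 := by
  linear_combination h - ((2)*Y'^2*(z) + (4)*Y*Y'*(1) + (6)*T'^2*(z) + (12)*T*T'*(1) + (3)*X'^2*(z) + (6)*X*X'*(1)) * hz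

/-- Splitting of the determinant equation into Fourier modes. -/
lemma modes_det {z X X' T T' Y Y' b g : ℂ} (hz : z ^ 3 = 1)
    (h : detForm b g (1 / 3 + z * X + z ^ 2 * X') (z * T + z ^ 2 * T') (z * Y + z ^ 2 * Y') = 0) :
    (- 8*Y'^3*g^2 - 8*Y^3*g^2 + 24*T'^2*Y'*g^2 + 24*T^2*Y*g^2 - 36*X'*Y'^2*b*g + 36*X'*T'^2*b*g +
    12*X'^2*Y'*g^2 - 36*X'^2*Y'*b^2 + 18*X'^3*b*g - 36*X*Y^2*b*g + 36*X*T^2*b*g + 12*X^2*Y*g^2 -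
    36*X^2*Y*b^2 + 18*X^3*b*g - 16*Y*Y'*g^2 + 48*Y*Y'*b*g - 72*T'*Y'^2*g + 72*T'^3*g - 72*T*Y^2*g +
    96*T*T'*g^2 - 48*T*T'*b*g + 144*T*T'*b^2 + 72*T^3*g - 16*X'*Y*g^2 - 24*X'*Y*b*g + 48*X'*Y*b^2 -
    144*X'*T'*Y'*b + 36*X'^2*T'*g - 16*X*Y'*g^2 - 24*X*Y'*b*g + 48*X*Y'*b^2 - 144*X*T*Y*b -
    24*X*X'*g^2 - 72*X*X'*b*g - 72*X*X'*b^2 + 36*X^2*T*g - 48*T'*Y*g + 96*T'*Y*b - 144*T'^2*Y' -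
    48*T*Y'*g + 96*T*Y'*b - 144*T^2*Y - 48*X'*T*g - 72*X'*T*b - 48*X*T'*g - 72*X*T'*b - 16/3*g^2 -
    64/3*b*g - 16*b^2 + 144*T*T' - 72*X*X' - 16) +
    z * (- 24*Y^2*Y'*g^2 + 48*T*T'*Y*g^2 + 24*T^2*Y'*g^2 - 36*X'*Y^2*b*g + 36*X'*T^2*b*g - 72*X*Y*Y'*b*g +
    72*X*T*T'*b*g + 24*X*X'*Y*g^2 - 72*X*X'*Y*b^2 + 12*X^2*Y'*g^2 - 36*X^2*Y'*b^2 + 54*X^2*X'*b*g -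
    8*Y'^2*g^2 + 24*Y'^2*b*g - 72*T'*Y^2*g + 48*T'^2*g^2 - 24*T'^2*b*g + 72*T'^2*b^2 - 144*T*Y*Y'*g +
    216*T^2*T'*g - 16*X'*Y'*g^2 - 24*X'*Y'*b*g + 48*X'*Y'*b^2 - 144*X'*T*Y*b - 12*X'^2*g^2 -
    36*X'^2*b*g - 36*X'^2*b^2 - 144*X*T'*Y*b - 144*X*T*Y'*b + 72*X*X'*T*g + 36*X^2*T'*g + 64/3*Y*g^2 +
    16*Y*b*g - 16*Y*b^2 - 48*T'*Y'*g + 96*T'*Y'*b - 288*T*T'*Y - 144*T^2*Y' - 48*X'*T'*g - 72*X'*T'*b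
    + 16*X*g^2 + 48*X*b*g + 48*X*b^2 + 72*T'^2 + 64*T*g + 48*T*b - 36*X'^2 + 48*X) +
    z ^ 2 * (- 24*Y*Y'^2*g^2 + 24*T'^2*Y*g^2 + 48*T*T'*Y'*g^2 - 72*X'*Y*Y'*b*g + 72*X'*T*T'*b*g + 12*X'^2*Y*g^2
    - 36*X'^2*Y*b^2 - 36*X*Y'^2*b*g + 36*X*T'^2*b*g + 24*X*X'*Y'*g^2 - 72*X*X'*Y'*b^2 + 54*X*X'^2*b*g
    - 8*Y^2*g^2 + 24*Y^2*b*g - 144*T'*Y*Y'*g - 72*T*Y'^2*g + 216*T*T'^2*g + 48*T^2*g^2 - 24*T^2*b*g +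
    72*T^2*b^2 - 144*X'*T'*Y*b - 144*X'*T*Y'*b + 36*X'^2*T*g - 16*X*Y*g^2 - 24*X*Y*b*g + 48*X*Y*b^2 -
    144*X*T'*Y'*b + 72*X*X'*T'*g - 12*X^2*g^2 - 36*X^2*b*g - 36*X^2*b^2 + 64/3*Y'*g^2 + 16*Y'*b*g -
    16*Y'*b^2 - 144*T'^2*Y - 48*T*Y*g + 96*T*Y*b - 288*T*T'*Y' + 16*X'*g^2 + 48*X'*b*g + 48*X'*b^2 -
    48*X*T*g - 72*X*T*b + 64*T'*g + 48*T'*b + 72*T^2 - 36*X^2 + 48*X') = 0 := by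
  rw [detForm] at h
  linear_combination h - ((-8)*Y'^3*g^2*(1 + z^3) + (-24)*Y*Y'^2*g^2*(z^2) + (-24)*Y^2*Y'*g^2*(z) + (-8)*Y^3*g^2*(1) +
    (24)*T'^2*Y'*g^2*(1 + z^3) + (24)*T'^2*Y*g^2*(z^2) + (48)*T*T'*Y'*g^2*(z^2) + (48)*T*T'*Y*g^2*(z)
    + (24)*T^2*Y'*g^2*(z) + (24)*T^2*Y*g^2*(1) + (-36)*X'*Y'^2*b*g*(1 + z^3) + (-72)*X'*Y*Y'*b*g*(z^2)
    + (-36)*X'*Y^2*b*g*(z) + (36)*X'*T'^2*b*g*(1 + z^3) + (72)*X'*T*T'*b*g*(z^2) + (36)*X'*T^2*b*g*(z)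
    + (12)*X'^2*Y'*g^2*(1 + z^3) + (-36)*X'^2*Y'*b^2*(1 + z^3) + (12)*X'^2*Y*g^2*(z^2) +
    (-36)*X'^2*Y*b^2*(z^2) + (18)*X'^3*b*g*(1 + z^3) + (-36)*X*Y'^2*b*g*(z^2) + (-72)*X*Y*Y'*b*g*(z) +
    (-36)*X*Y^2*b*g*(1) + (36)*X*T'^2*b*g*(z^2) + (72)*X*T*T'*b*g*(z) + (36)*X*T^2*b*g*(1) +
    (24)*X*X'*Y'*g^2*(z^2) + (-72)*X*X'*Y'*b^2*(z^2) + (24)*X*X'*Y*g^2*(z) + (-72)*X*X'*Y*b^2*(z) +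
    (54)*X*X'^2*b*g*(z^2) + (12)*X^2*Y'*g^2*(z) + (-36)*X^2*Y'*b^2*(z) + (12)*X^2*Y*g^2*(1) +
    (-36)*X^2*Y*b^2*(1) + (54)*X^2*X'*b*g*(z) + (18)*X^3*b*g*(1) + (-8)*Y'^2*g^2*(z) +
    (24)*Y'^2*b*g*(z) + (-16)*Y*Y'*g^2*(1) + (48)*Y*Y'*b*g*(1) + (-72)*T'*Y'^2*g*(1 + z^3) +
    (-144)*T'*Y*Y'*g*(z^2) + (-72)*T'*Y^2*g*(z) + (48)*T'^2*g^2*(z) + (-24)*T'^2*b*g*(z) +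
    (72)*T'^2*b^2*(z) + (72)*T'^3*g*(1 + z^3) + (-72)*T*Y'^2*g*(z^2) + (-144)*T*Y*Y'*g*(z) +
    (-72)*T*Y^2*g*(1) + (96)*T*T'*g^2*(1) + (-48)*T*T'*b*g*(1) + (144)*T*T'*b^2*(1) +
    (216)*T*T'^2*g*(z^2) + (216)*T^2*T'*g*(z) + (72)*T^3*g*(1) + (-16)*X'*Y'*g^2*(z) +
    (-24)*X'*Y'*b*g*(z) + (48)*X'*Y'*b^2*(z) + (-16)*X'*Y*g^2*(1) + (-24)*X'*Y*b*g*(1) +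
    (48)*X'*Y*b^2*(1) + (-144)*X'*T'*Y'*b*(1 + z^3) + (-144)*X'*T'*Y*b*(z^2) + (-144)*X'*T*Y'*b*(z^2)
    + (-144)*X'*T*Y*b*(z) + (-12)*X'^2*g^2*(z) + (-36)*X'^2*b*g*(z) + (-36)*X'^2*b^2*(z) +
    (36)*X'^2*T'*g*(1 + z^3) + (36)*X'^2*T*g*(z^2) + (-16)*X*Y'*g^2*(1) + (-24)*X*Y'*b*g*(1) +
    (48)*X*Y'*b^2*(1) + (-144)*X*T'*Y'*b*(z^2) + (-144)*X*T'*Y*b*(z) + (-144)*X*T*Y'*b*(z) +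
    (-144)*X*T*Y*b*(1) + (-24)*X*X'*g^2*(1) + (-72)*X*X'*b*g*(1) + (-72)*X*X'*b^2*(1) +
    (72)*X*X'*T'*g*(z^2) + (72)*X*X'*T*g*(z) + (36)*X^2*T'*g*(z) + (36)*X^2*T*g*(1) +
    (-48)*T'*Y'*g*(z) + (96)*T'*Y'*b*(z) + (-48)*T'*Y*g*(1) + (96)*T'*Y*b*(1) + (-144)*T'^2*Y'*(1 +
    z^3) + (-144)*T'^2*Y*(z^2) + (-48)*T*Y'*g*(1) + (96)*T*Y'*b*(1) + (-288)*T*T'*Y'*(z^2) +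
    (-288)*T*T'*Y*(z) + (-144)*T^2*Y'*(z) + (-144)*T^2*Y*(1) + (-48)*X'*T'*g*(z) + (-72)*X'*T'*b*(z) +
    (-48)*X'*T*g*(1) + (-72)*X'*T*b*(1) + (-48)*X*T'*g*(1) + (-72)*X*T'*b*(1) + (72)*T'^2*(z) +
    (144)*T*T'*(1) + (-36)*X'^2*(z) + (-72)*X*X'*(1)) * hz

/-- Inversion of the Fourier transform on the three cube roots of unity: a polynomial of degree at
most two vanishing at all of them is zero. -/
lemma eq_zero_of_modes {ζ w₀ w₁ w₂ : ℂ} (hζ : ζ ^ 2 + ζ + 1 = 0) (h₀ : w₀ + 1 * w₁ + 1 ^ 2 * w₂ = 0)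
    (h₁ : w₀ + ζ * w₁ + ζ ^ 2 * w₂ = 0) (h₂ : w₀ + ζ ^ 2 * w₁ + (ζ ^ 2) ^ 2 * w₂ = 0) :
    w₀ = 0 ∧ w₁ = 0 ∧ w₂ = 0 := by
  refine ⟨?_, ?_, ?_⟩
  · linear_combination (h₀ + h₁ + h₂) / 3 - (w₁ / 3 + (ζ ^ 2 - ζ + 1) * w₂ / 3) * hζ
  · linear_combination (h₀ + ζ ^ 2 * h₁ + ζ * h₂) / 3 -
      (w₀ / 3 + 2 * (ζ - 1) * w₁ / 3 + (ζ ^ 3 - ζ + 1) * w₂ / 3) * hζ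
  · linear_combination (h₀ + ζ * h₁ + ζ ^ 2 * h₂) / 3 -
      (w₀ / 3 + (ζ ^ 2 - ζ + 1) * w₁ / 3 + (ζ ^ 4 - ζ ^ 3 + 2 * ζ - 2) * w₂ / 3) * hζ

lemma exists_modes {ζ : ℂ} (hζ : ζ ^ 2 + ζ + 1 = 0) {a₀ a₁ a₂ s : ℂ} (h : a₀ + a₁ + a₂ = 3 * s) :
    ∃ X X' : ℂ, a₀ = s + 1 * X + 1 ^ 2 * X' ∧ a₁ = s + ζ * X + ζ ^ 2 * X' ∧
      a₂ = s + ζ ^ 2 * X + (ζ ^ 2) ^ 2 * X' := by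
  refine ⟨(a₀ + ζ ^ 2 * a₁ + ζ * a₂) / 3, (a₀ + ζ * a₁ + ζ ^ 2 * a₂) / 3, ?_, ?_, ?_⟩
  · linear_combination h / 3 - (a₁ + a₂) / 3 * hζ
  · linear_combination h / 3 - (a₀ / 3 + 2 * (ζ - 1) * a₁ / 3 + (ζ ^ 2 - ζ + 1) * a₂ / 3) * hζ
  · linear_combination h / 3 - (a₀ * (ζ ^ 2 - ζ + 1) / 3 + (ζ ^ 3 - ζ + 1) * a₁ / 3 +
      (ζ ^ 4 - ζ ^ 3 + 2 * ζ - 2) * a₂ / 3) * hζ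

/-- A vector in the kernel of a `3 × 3` matrix with nonvanishing determinant is zero. -/
lemma det_eq_zero_of_kernel {a₁ a₂ a₃ b₁ b₂ b₃ c₁ c₂ c₃ x y z : ℝ}
    (h₁ : a₁ * x + a₂ * y + a₃ * z = 0) (h₂ : b₁ * x + b₂ * y + b₃ * z = 0)
    (h₃ : c₁ * x + c₂ * y + c₃ * z = 0) (hne : ¬ (x = 0 ∧ y = 0 ∧ z = 0)) :
    a₁ * (b₂ * c₃ - b₃ * c₂) - a₂ * (b₁ * c₃ - b₃ * c₁) + a₃ * (b₁ * c₂ - b₂ * c₁) = 0 := by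
  by_contra hd
  refine hne ⟨?_, ?_, ?_⟩ <;> apply mul_left_cancel₀ hd
  · linear_combination (b₂ * c₃ - b₃ * c₂) * h₁ - (a₂ * c₃ - a₃ * c₂) * h₂ +
      (a₂ * b₃ - a₃ * b₂) * h₃
  · linear_combination -(b₁ * c₃ - b₃ * c₁) * h₁ + (a₁ * c₃ - a₃ * c₁) * h₂ -
      (a₁ * b₃ - a₃ * b₁) * h₃
  · linear_combination (b₁ * c₂ - b₂ * c₁) * h₁ - (a₁ * c₂ - a₂ * c₁) * h₂ +
      (a₁ * b₂ - a₂ * b₁) * h₃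

/-- The polynomial system, scaled so that `s = 1`. -/
structure IsScaledSystem (b g c : ℝ) (x t y : Fin 3 → ℝ) : Prop where
  fst : ∀ j, x j * (3 * b * x j + 6 * t j + 2 * g * y j - 2 * g) + b * (c + 2 * y j) = 0
  snd : ∀ j, t j * (3 * b * x j + 6 * t j + 2 * g * y j + g) + (c - y j) = 0
  radius : ∀ j, 3 * x j ^ 2 + 6 * t j ^ 2 + 2 * y j ^ 2 = 1 - 2 * c
  sum_x : x 0 + x 1 + x 2 = 1
  sum_t : t 0 + t 1 + t 2 = 0
  sum_y : y 0 + y 1 + y 2 = 0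
  lt_one : c < 1

/-- The equations `fst` and `snd` are homogeneous linear in `(b, s, g)`, and the others but `sphere`
do not contain these parameters. So `s` can be normalised to 1, and `sphere` is kept for recovering
`s` afterwards. -/
lemma IsBlochSystem.isScaledSystem {b s g c : ℝ} {x t y : Fin 3 → ℝ}
    (h : IsBlochSystem b s g c x t y) (hs : s ≠ 0) : IsScaledSystem (b / s) (g / s) c x t y := by
  refine ⟨fun j => ?_, fun j => ?_, h.radius, h.sum_x, h.sum_t, h.sum_y, h.lt_one⟩
  · have := h.fst j
    field_simp
    linear_combination this
  · have := h.snd j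
    field_simp
    linear_combination this

namespace IsScaledSystem

variable {b g c : ℝ} {x t y : Fin 3 → ℝ}

/-- Subtracting the equations at `j` and `k` eliminates `c` and leaves expressions bilinear in the
difference and the sum of the two points. The sum is given by the point `i`, so the nonzero
difference lies in the kernel of a matrix that depends only on `b`, `g` and the point `i`. -/
lemma detForm_eq_zero (h : IsScaledSystem b g c x t y) {i j k : Fin 3}
    (hx : x i + x j + x k = 1) (ht : t i + t j + t k = 0) (hy : y i + y j + y k = 0)
    (hne : ¬ (x j = x k ∧ t j = t k ∧ y j = y k)) : detForm b g (x i) (t i) (y i) = 0 := by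
  have e1 : x i = 1 - x j - x k := by linarith
  have e2 : t i = -t j - t k := by linarith
  have e3 : y i = -y j - y k := by linarith
  rw [detForm]
  have fj := h.fst j
  have fk := h.fst k
  have sj := h.snd j
  have sk := h.snd k
  have rj := h.radius j
  have rk := h.radius k
  refine det_eq_zero_of_kernel (x := x j - x k) (y := t j - t k) (z := y j - y k) ?_ ?_ ?_ ?_
  · rw [e1, e2, e3]
    linear_combination rj - rk
  · rw [e1, e2, e3]
    linear_combination 2 * (fj - fk)
  · rw [e1, e2, e3]
    linear_combination 2 * (sj - sk)
  · rintro ⟨h1, h2, h3⟩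
    exact hne ⟨by linarith, by linarith, by linarith⟩

lemma detForm_eq_zero_of_injective (h : IsScaledSystem b g c x t y)
    (hne : ∀ i j, x i = x j → t i = t j → y i = y j → i = j) (i : Fin 3) :
    detForm b g (x i) (t i) (y i) = 0 := by
  have sx := h.sum_x
  have st := h.sum_t
  have sy := h.sum_y
  fin_cases i
  · exact h.detForm_eq_zero (j := 1) (k := 2) sx st sy
      fun hh => absurd (hne _ _ hh.1 hh.2.1 hh.2.2) (by decide)
  · exact h.detForm_eq_zero (i := 1) (j := 2) (k := 0) (by linarith) (by linarith) (by linarith)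
      fun hh => absurd (hne _ _ hh.1 hh.2.1 hh.2.2) (by decide)
  · exact h.detForm_eq_zero (i := 2) (j := 0) (k := 1) (by linarith) (by linarith) (by linarith)
      fun hh => absurd (hne _ _ hh.1 hh.2.1 hh.2.2) (by decide)

/-- The three points are the values at `z = 1, ζ, ζ²` of a single expression of degree two in `z`,
with means `1/3, 0, 0` as constant terms. Each equation, reduced modulo `z³ = 1`, is a polynomial of
degree at most two in `z` with three zeros, so its coefficients vanish. -/
lemma exists_isModeSystem (h : IsScaledSystem b g c x t y)
    (hne : ∀ i j, x i = x j → t i = t j → y i = y j → i = j) :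
    ∃ X X' T T' Y Y' : ℂ, IsModeSystem X X' T T' Y Y' b g c := by
  obtain ⟨ζ, hζ⟩ : ∃ ζ : ℂ, ζ ^ 2 + ζ + 1 = 0 := ⟨_, (cube_root_properties (Or.inl rfl)).2⟩
  have hζ3 : ζ ^ 3 = 1 := by linear_combination (ζ - 1) * hζ
  have hζ3' : (ζ ^ 2) ^ 3 = 1 := by
    have : (ζ ^ 2) ^ 3 = (ζ ^ 3) ^ 2 := by ring
    rw [this, hζ3, one_pow]
  have h13 : (1 : ℂ) ^ 3 = 1 := one_pow 3
  obtain ⟨X, X', x0, x1, x2⟩ := exists_modes hζ (a₀ := x 0) (a₁ := x 1) (a₂ := x 2) (s := 1 / 3)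
    (by have := h.sum_x; norm_num; exact_mod_cast this)
  obtain ⟨T, T', t0, t1, t2⟩ := exists_modes hζ (a₀ := t 0) (a₁ := t 1) (a₂ := t 2) (s := 0)
    (by have := h.sum_t; norm_num; exact_mod_cast this)
  obtain ⟨Y, Y', y0, y1, y2⟩ := exists_modes hζ (a₀ := y 0) (a₁ := y 1) (a₂ := y 2) (s := 0)
    (by have := h.sum_y; norm_num; exact_mod_cast this)
  rw [zero_add] at t0 t1 t2 y0 y1 y2
  have d := h.detForm_eq_zero_of_injective hne
  have f : ∀ i, (x i * (3 * b * x i + 6 * t i + 2 * g * y i - 2 * g) +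
      b * (c + 2 * y i) : ℂ) = 0 := fun i => by exact_mod_cast h.fst i
  have s : ∀ i, (t i * (3 * b * x i + 6 * t i + 2 * g * y i + g) + (c - y i) : ℂ) = 0 :=
    fun i => by exact_mod_cast h.snd i
  have r : ∀ i, (3 * x i ^ 2 + 6 * t i ^ 2 + 2 * y i ^ 2 : ℂ) = 1 - 2 * c :=
    fun i => by exact_mod_cast h.radius i
  have d' : ∀ i, detForm (b : ℂ) g (x i) (t i) (y i) = 0 := fun i => by
    have := d i
    rw [detForm] at this ⊢
    exact_mod_cast this
  have f0 := f 0
  have f1 := f 1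
  have f2 := f 2
  have s0 := s 0
  have s1 := s 1
  have s2 := s 2
  have r0 := r 0
  have r1 := r 1
  have r2 := r 2
  have d0 := d' 0
  have d1 := d' 1
  have d2 := d' 2
  rw [x0, t0, y0] at f0 s0 r0 d0
  rw [x1, t1, y1] at f1 s1 r1 d1
  rw [x2, t2, y2] at f2 s2 r2 d2
  obtain ⟨a1, a2, a3⟩ := eq_zero_of_modes hζ (modes_fst h13 f0) (modes_fst hζ3 f1)
    (modes_fst hζ3' f2)
  obtain ⟨b1, b2, b3⟩ := eq_zero_of_modes hζ (modes_snd h13 s0) (modes_snd hζ3 s1)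
    (modes_snd hζ3' s2)
  obtain ⟨c1, c2, c3⟩ := eq_zero_of_modes hζ (modes_radius h13 r0) (modes_radius hζ3 r1)
    (modes_radius hζ3' r2)
  obtain ⟨d1, d2, d3⟩ := eq_zero_of_modes hζ (modes_det h13 d0) (modes_det hζ3 d1)
    (modes_det hζ3' d2)
  exact ⟨X, X', T, T', Y, Y', a1, a2, a3, b1, b2, b3, c1, c2, c3, d1, d2, d3⟩

/-- The possible parameters for three different points. -/
lemma parameters (h : IsScaledSystem b g c x t y)
    (hne : ∀ i j, x i = x j → t i = t j → y i = y j → i = j) :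
    (c = -1 ∧ 4 * b * g + 3 = 0 ∧ 6 * b ^ 2 - 2 * g ^ 2 + 3 = 0) ∨
      (c = -1 / 2 ∧ b = -2 * g ∧ 3 * g ^ 2 = 1) := by
  obtain ⟨X, X', T, T', Y, Y', hM⟩ := h.exists_isModeSystem hne
  have hc : (2 * c + 1) * (c + 1) * (c - 1) = 0 := by exact_mod_cast hM.parameter_cubic
  have hc1 := h.lt_one
  rcases mul_eq_zero.1 hc with hc | hc
  swap
  · linarith
  rcases mul_eq_zero.1 hc with hc | hc
  · right
    have hc' : c = -1 / 2 := by linarith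
    subst hc'
    push_cast at hM
    have e1 : b + 2 * g = 0 := by exact_mod_cast hM.linear_of_neg_half
    have e2 : b = -2 * g := by linarith
    subst e2
    push_cast at hM
    have e3 : 3 * g ^ 2 - 1 = 0 := by exact_mod_cast hM.sq_of_neg_half
    exact ⟨rfl, rfl, by linarith⟩
  · left
    have hc' : c = -1 := by linarith
    subst hc'
    push_cast at hM
    exact ⟨rfl, by exact_mod_cast hM.mul_of_neg_one, by exact_mod_cast hM.sq_of_neg_one⟩

end IsScaledSystem

lemma exists_perm_apply_one_two :
    ∀ i j : Fin 3, i ≠ j → ∃ σ : Equiv.Perm (Fin 3), σ 1 = i ∧ σ 2 = j := by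
  decide

namespace IsScaledSystem

variable {b g c : ℝ} {x t y : Fin 3 → ℝ}

/-- The reflection `t ↦ -t` exchanges the two parameter choices `β = ±1/2` at `c = -1`, so that only
one of them has to be solved. -/
lemma neg (h : IsScaledSystem b g c x t y) : IsScaledSystem (-b) (-g) c x (fun j => -t j) y := by
  refine ⟨fun j => ?_, fun j => ?_, fun j => ?_, h.sum_x, ?_, h.sum_y, h.lt_one⟩
  · linear_combination -h.fst j
  · linear_combination h.snd j
  · linear_combination h.radius j
  · linear_combination -h.sum_t

/-- At these parameters each single point, together with its determinant equation, already has `x`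
among the three roots of a cubic and `y`, `t` determined by `x` (`key`, by elimination
certificates). Distinct points then have distinct `x` and exhaust the roots. -/
lemma isReordering_of_five (h : IsScaledSystem (1 / 2) (-3 / 2) (-1) x t y)
    (hne : ∀ i j, x i = x j → t i = t j → y i = y j → i = j) {f : ℝ} (hf : f ^ 2 = 5) :
    IsReordering x t y ![1 / 3, 1 / 3 + 2 * f / 15, 1 / 3 - 2 * f / 15]
      ![-1 / 3, 1 / 6 - 7 * f / 30, 1 / 6 + 7 * f / 30] ![-1, 1 / 2 + f / 10, 1 / 2 - f / 10] := by
  have key : ∀ j, (x j - 1 / 3) * ((x j - 1 / 3) ^ 2 - 4 / 45) = 0 ∧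
      y j + 1 - 135 / 8 * (x j - 1 / 3) ^ 2 - 3 / 4 * (x j - 1 / 3) = 0 ∧
      x j + t j / 2 - y j / 6 - 1 / 3 = 0 := by
    intro j
    have hf := h.fst j
    have hs := h.snd j
    have hr := h.radius j
    have hd := h.detForm_eq_zero_of_injective hne j
    rw [detForm] at hd
    generalize x j = x, t j = t, y j = y at *
    refine ⟨?_, ?_, ?_⟩
    · linear_combination (52/405*y^2 - 208/405*t*y + 32/45*t^2 - 52/405*x*y - 8/135*x*t - 26/135*x^2 + 16/27*y - 64/81*t +
    106/405*x + 64/405) * hf + (16/405*y^2 - 64/405*t*y - 16/135*t^2 - 16/405*x*y - 148/135*x*t +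
    8/45*y + 20/81*t + 328/405*x - 56/405) * hs + (8/135*t + 26/135*x - 2/45) * hr + (- 8/1215*t -
    26/1215*x + 2/405) * hd
    · linear_combination (7/4*y^2 + t*y + 15/4*t^2 - 7/4*x*y + 3/8*x*t - 21/8*x^2 + 31/4*y - 77/8*t + 13/4*x + 15/8) * hf +
    (- 1/4*y^2 + t*y + 3/4*t^2 - 31/4*x*y - 9*x*t + 5/4*y + 2*t + 35/2*x - 1/2) * hs + (- 1/4*y -
    15/8*t - 27/16*x - 17/16) * hr + (1/24*t - 7/24*x + 1/12) * hd
    · linear_combination (1/12*y^2 - 2/3*t*y + 5/4*t^2 - 1/12*x*y - 1/4*x*t - 1/8*x^2 + 1/6*y - 1/12*t + 1/12*x + 1/24) *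
    hf + (1/6*y^2 - 2/3*t*y - 1/2*t^2 + 1/6*x*y - 3/2*x*t + 1/2*y + 2/3*t - 1/6*x - 1/2) * hs +
    (1/24*y + 1/4*t - 1/16*x + 13/48) * hr + (- 1/36*t - 1/72*x) * hd
  have hy : ∀ j, y j = -1 + 135 / 8 * (x j - 1 / 3) ^ 2 + 3 / 4 * (x j - 1 / 3) := fun j => by
    linarith [(key j).2.1]
  have ht : ∀ j, t j = 2 / 3 - 2 * x j + y j / 3 := fun j => by linarith [(key j).2.2]
  have hx : Function.Injective x := by
    intro i j hij
    have h1 : y i = y j := by rw [hy, hy, hij]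
    exact hne i j hij (by rw [ht, ht, hij, h1]) h1
  obtain ⟨σ, hσ⟩ := exists_perm_of_injective (r := ![1 / 3, 1 / 3 + 2 * f / 15, 1 / 3 - 2 * f / 15])
    hx (by
      intro j
      rcases mul_eq_zero.1 (key j).1 with h0 | h0
      · exact ⟨0, by simp; linarith⟩
      · have : (x j - 1 / 3 - 2 * f / 15) * (x j - 1 / 3 + 2 * f / 15) = 0 := by
          linear_combination h0 - 4 / 225 * hf
        rcases mul_eq_zero.1 this with h0 | h0
        · exact ⟨1, by simp; linarith⟩
        · exact ⟨2, by simp; linarith⟩)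
  refine ⟨σ, fun j => ⟨hσ j, ?_, ?_⟩⟩
  · rw [ht, hy, hσ]
    fin_cases j
    · norm_num
    · simp; linear_combination 1 / 10 * hf
    · simp; linear_combination 1 / 10 * hf
  · rw [hy, hσ]
    fin_cases j
    · norm_num
    · simp; linear_combination 3 / 10 * hf
    · simp; linear_combination 3 / 10 * hf

/-- The same elimination at `c = -1/2`, with the irrational parameter `g` kept as a symbol subject
to `3 g² = 1`. -/
lemma isReordering_of_two (h : IsScaledSystem b g (-1 / 2) x t y) (hb : b = -2 * g)
    (hne : ∀ i j, x i = x j → t i = t j → y i = y j → i = j) {h' k : ℝ} (hh : h' ^ 2 = 2)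
    (hk : k ^ 2 = 3) (hg : g = k / 3) :
    IsReordering x t y ![1 / 2, (1 + h') / 4, (1 - h') / 4]
      ![k / 4, k * (-1 + h') / 8, k * (-1 - h') / 8]
      ![1 / 4, -1 / 8 - 3 * h' / 8, -1 / 8 + 3 * h' / 8] := by
  have hg2 : 3 * g ^ 2 - 1 = 0 := by rw [hg]; linear_combination hk / 3
  have key : ∀ j, (x j - 1 / 2) * (x j ^ 2 - x j / 2 - 1 / 16) = 0 ∧
      x j ^ 2 - 3 * x j / 8 + y j / 12 - 1 / 12 = 0 ∧ g * t j - x j - y j / 3 + 1 / 3 = 0 := by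
    intro j
    have hf := h.fst j
    have hs := h.snd j
    have hr := h.radius j
    have hd := h.detForm_eq_zero_of_injective hne j
    rw [detForm] at hd
    rw [hb] at hf hs hd
    clear hg hk
    generalize x j = x, t j = t, y j = y at *
    refine ⟨?_, ?_, ?_⟩
    · linear_combination (17317/247488*y^2*g + 1943/82496*t^2*g + 887/10312*x*y*g + 1943/164992*x^2*g - 120017/247488*y*g -
    23837/371232*t*y - 557/41248*x*g - 61237/123744*x*t - 138049/494976*g - 413159/742464*t) * hf +
    (1605/20624*t*y*g - 1605/20624*y^2 + 21415/41248*t*g + 3175/185616*x*y + 61237/123744*x^2 +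
    83519/371232*y + 188311/371232*x + 2651/742464) * hs + (- 535/41248*y^2*g^2 + 1605/41248*x*y*g^2 -
    113729/247488*y*g^2 - 1605/41248*t*y*g + 255/10312*x*g^2 - 182291/494976*g^2 - 49041/82496*t*g +
    5849/46404*y + 76667/247488*x - 47689/371232) * hr + (- 535/164992*y - 1943/989952*x +
    6211/989952) * hd + (61237/185616*y^3 + 19989/20624*t^2*y + 223651/371232*x*y^2 +
    58659/41248*x*t^2 - 41113/92808*y^2 - 3069/10312*t^2 - 69539/92808*x*y - 46667/185616*y -
    199835/371232*x - 979/494976) * hg2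
    · linear_combination (- 103/15468*y^2*g - 263/5156*t^2*g - 587/5156*x*y*g - 263/10312*x^2*g + 1405/5156*y*g -
    263/23202*t*y - 2159/10312*x*g + 263/7734*x*t + 3149/30936*g + 3293/23202*t) * hf + (-
    61/2578*t*y*g + 61/2578*y^2 - 581/5156*t*g + 1315/11601*x*y - 263/7734*x^2 - 4607/46404*y -
    12109/46404*x - 607/11601) * hs + (61/15468*y^2*g^2 - 61/5156*x*y*g^2 + 529/10312*y*g^2 +
    61/5156*t*y*g - 4065/10312*x*g^2 - 5687/30936*g^2 + 1435/10312*t*g + 23/46404*y + 263/5156*x +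
    18485/92808) * hr + (61/61872*y + 263/61872*x - 91/41248) * hd + (- 263/11601*y^3 - 263/1289*t^2*y
    - 263/23202*x*y^2 - 263/2578*x*t^2 + 22543/46404*y^2 + 931/1289*t^2 + 12773/46404*x*y -
    1657/92808*y + 2125/23202*x - 6479/30936) * hg2
    · linear_combination (77/23202*y^2*g - 329/7734*t^2*g - 350/3867*x*y*g - 329/15468*x^2*g + 893/2578*y*g - 329/34803*t*y
    - 701/7734*x*g + 329/11601*x*t + 24377/46404*g + 36337/69606*t) * hf + (- 14/1289*t*y*g +
    14/1289*y^2 + 286/3867*t*g + 3290/34803*x*y - 329/11601*x^2 - 6256/34803*y - 21623/34803*x +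
    9887/69606) * hs + (7/3867*y^2*g^2 - 7/1289*x*y*g^2 + 326/11601*y*g^2 + 7/1289*t*y*g -
    551/2578*x*g^2 + 33085/46404*g^2 + 4/3867*t*g - 140/34803*y + 329/7734*x - 11471/69606) * hr +
    (7/15468*y + 329/92808*x - 145/23202) * hd + (- 658/34803*y^3 - 658/3867*t^2*y - 329/34803*x*y^2 -
    329/3867*x*t^2 - 5404/34803*y^2 - 756/1289*t^2 + 21112/34803*x*y + 18997/69606*y + 22552/34803*x +
    6971/46404) * hg2
  have hy : ∀ j, y j = 1 - 12 * x j ^ 2 + 9 / 2 * x j := fun j => by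
    linarith [(key j).2.1]
  have ht : ∀ j, t j = k * (x j + y j / 3 - 1 / 3) := fun j => by
    have := (key j).2.2
    rw [hg] at this
    linear_combination k * this - t j / 3 * hk
  have hx : Function.Injective x := by
    intro i j hij
    have h1 : y i = y j := by rw [hy, hy, hij]
    exact hne i j hij (by rw [ht, ht, hij, h1]) h1
  obtain ⟨σ, hσ⟩ := exists_perm_of_injective (r := ![1 / 2, (1 + h') / 4, (1 - h') / 4])
    hx (by
      intro j
      rcases mul_eq_zero.1 (key j).1 with h0 | h0
      · exact ⟨0, by simp; linarith⟩
      · have : (x j - (1 + h') / 4) * (x j - (1 - h') / 4) = 0 := by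
          linear_combination h0 - 1 / 16 * hh
        rcases mul_eq_zero.1 this with h0 | h0
        · exact ⟨1, by simp; linarith⟩
        · exact ⟨2, by simp; linarith⟩)
  refine ⟨σ, fun j => ⟨hσ j, ?_, ?_⟩⟩
  · rw [ht, hy, hσ]
    fin_cases j
    · norm_num; ring
    · simp; linear_combination -k / 4 * hh
    · simp; linear_combination -k / 4 * hh
  · rw [hy, hσ]
    fin_cases j
    · norm_num
    · simp; linear_combination -3 / 4 * hh
    · simp; linear_combination -3 / 4 * hh

/-- Two of the three points coincide. -/
lemma eq_of_equal (h : IsScaledSystem b g c x t y) (hx : x 1 = x 2) (ht : t 1 = t 2)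
    (hy : y 1 = y 2) : ∃ e : ℝ, e ^ 2 = 1 ∧ b = -3 * e / 4 ∧ g = e / 4 ∧ c = -1 / 5 ∧
      IsReordering x t y ![-1 / 5, 3 / 5, 3 / 5] ![-2 * e / 5, e / 5, e / 5]
        ![2 / 5, -1 / 5, -1 / 5] := by
  have hx0 : x 0 = 1 - 2 * x 1 := by linarith [h.sum_x]
  have ht0 : t 0 = -2 * t 1 := by linarith [h.sum_t]
  have hy0 : y 0 = -2 * y 1 := by linarith [h.sum_y]
  have f0 := h.fst 0
  have s0 := h.snd 0
  have r0 := h.radius 0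
  have f1 := h.fst 1
  have s1 := h.snd 1
  have r1 := h.radius 1
  have hc1 := h.lt_one
  rw [hx0, ht0, hy0] at f0 s0 r0
  have hc : c = 1 - 2 * x 1 := by linarith
  rw [hc] at f0 s0 f1 s1 r1
  -- `B1` to `B5` are elimination certificates for a double point: a cubic for `x 1`, then equations
  -- determining `y 1`, `t 1 ^ 2`, `g * t 1` and `b * t 1`. The root 0 contradicts `c < 1`, and the
  -- root `1/3` would make `t 1 ^ 2` negative.
  have B1 : x 1 * ((x 1 - 1 / 3) * (x 1 - 3 / 5)) = 0 := by
    clear hx0 ht0 hy0 r0 hc hx ht hy hc1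
    generalize x 1 = x, t 1 = t, y 1 = y at *
    linear_combination (14/45*t*x^2 - 2/15*t*x) * f1 + (- 86/45*x^3 - 16/27*y*x^2 - 112/135*y^2*x + 386/135*x^2 +
    104/135*y*x + 16/45*y^2 - 38/27*x - 8/45*y + 2/9) * s1 + (5/9*t*x^2 - 14/45*t*y*x - 16/45*t*x +
    2/15*t*y + 1/15*t) * f0 + (- 7/45*x^3 + 62/135*y*x^2 + 28/135*y^2*x + 8/27*x^2 - 44/135*y*x -
    4/45*y^2 - 29/135*x + 2/45*y + 2/45) * s0 + (- 62/45*x^2 - 28/45*y*x + 58/45*x + 4/15*y - 4/15) *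
    r1
  have B2 : y 1 * (x 1 - 4 / 15) + x 1 / 3 - 2 / 15 = 0 := by
    clear hx0 ht0 hy0 r0 hc hx ht hy hc1 B1
    generalize x 1 = x, t 1 = t, y 1 = y at *
    linear_combination (- 28/45*t*x + 4/15*t) * f1 + (- 98/45*x^2 - 4/27*y*x - 136/135*y^2 + 299/135*x + 4/27*y - 73/135)
    * s1 + (7/18*t*x - 17/45*t*y - 17/90*t) * f0 + (14/45*x^2 + 56/135*y*x + 34/135*y^2 + 2/27*x -
    1/27*y - 11/135) * s0 + (- 56/45*x - 34/45*y + 22/45) * r1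
  have B3 : t 1 ^ 2 - 7 / 90 * y 1 - 4 / 9 * x 1 + 19 / 90 = 0 := by
    clear hx0 ht0 hy0 r0 hc hx ht hy hc1 B1 B2
    generalize x 1 = x, t 1 = t, y 1 = y at *
    linear_combination (13/135*t*x + 1/3*t*y - 4/45*t) * f1 + (248/135*x^2 + 25/81*y*x + 256/405*y^2 - 1753/810*x -
    25/81*y + 521/810) * s1 + (- 47/108*t*x + 109/270*t*y + 109/540*t) * f0 + (- 13/270*x^2 -
    457/810*y*x - 64/405*y^2 - 25/162*x + 13/81*y + 97/810) * s0 + (161/135*x + 64/135*y - 149/270) *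
    r1
  have B4 : g * t 1 - 5 / 12 * y 1 - 17 / 24 * x 1 + 7 / 24 = 0 := by
    clear hx0 ht0 hy0 r0 hc hx ht hy hc1 B1 B2 B3
    generalize x 1 = x, t 1 = t, y 1 = y at *
    linear_combination (- 7/12*t) * f1 + (1/12*x + 1/3*y + 1/4) * s1 + (- 1/6*t) * f0 + (7/24*x - 1/12*y - 5/24) * s0 +
    (1/4) * r1
  have B5 : b * t 1 - 7 / 12 * y 1 - 7 / 24 * x 1 + 5 / 24 = 0 := by
    clear hx0 ht0 hy0 r0 hc hx ht hy hc1 B1 B2 B3 B4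
    generalize x 1 = x, t 1 = t, y 1 = y at *
    linear_combination (7/12*t) * f1 + (- 1/12*x - 1/3*y + 5/12) * s1 + (1/6*t) * f0 + (- 7/24*x + 1/12*y + 1/24) * s0 +
    (- 1/4) * r1
  have B1' := (mul_eq_zero.1 B1).resolve_left (by linarith)
  rcases mul_eq_zero.1 B1' with hx1 | hx1
  · have hx1 : x 1 = 1 / 3 := by linarith
    rw [hx1] at B2 B3
    nlinarith [sq_nonneg (t 1)]
  have hx1 : x 1 = 3 / 5 := by linarith
  rw [hx1] at B2 B3 B4 B5 hc
  have hy1 : y 1 = -1 / 5 := by linarith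
  rw [hy1] at B3 B4 B5
  have ht1 : t 1 ^ 2 = 1 / 25 := by linarith
  refine ⟨5 * t 1, by linear_combination 25 * ht1, ?_, ?_, by linarith, Equiv.refl _, fun j => ?_⟩
  · linear_combination 25 * t 1 * B5 - 25 * b * ht1
  · linear_combination 25 * t 1 * B4 - 25 * g * ht1
  · fin_cases j
    · refine ⟨?_, ?_, ?_⟩ <;> simp <;> linarith
    · refine ⟨?_, ?_, ?_⟩ <;> simp <;> linarith
    · refine ⟨?_, ?_, ?_⟩ <;> simp <;> linarith

end IsScaledSystem

/-- Solutions with `s ≠ 0`. -/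
lemma IsBlochSystem.skew {b s g c : ℝ} {x t y : Fin 3 → ℝ} (h : IsBlochSystem b s g c x t y)
    (hs : s ≠ 0) :
    (∃ e f : ℝ, e ^ 2 = 1 ∧ f ^ 2 = 5 ∧ b = e * f / 15 ∧ s = 2 * f / 15 ∧ g = -e * f / 5 ∧ c = -1 ∧
      IsReordering x t y ![1 / 3, 1 / 3 + 2 * f / 15, 1 / 3 - 2 * f / 15]
        ![-e / 3, e * (1 / 6 - 7 * f / 30), e * (1 / 6 + 7 * f / 30)]
        ![-1, 1 / 2 + f / 10, 1 / 2 - f / 10]) ∨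
    (∃ h k : ℝ, h ^ 2 = 2 ∧ k ^ 2 = 3 ∧ b = -h / 4 ∧ s = h * k / 8 ∧ g = h / 8 ∧ c = -1 / 2 ∧
      IsReordering x t y ![1 / 2, (1 + h) / 4, (1 - h) / 4]
        ![k / 4, k * (-1 + h) / 8, k * (-1 - h) / 8]
        ![1 / 4, -1 / 8 - 3 * h / 8, -1 / 8 + 3 * h / 8]) ∨
    (∃ e f : ℝ, e ^ 2 = 1 ∧ f ^ 2 = 5 ∧ b = -3 * e * f / 25 ∧ s = 4 * f / 25 ∧ g = e * f / 25 ∧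
      c = -1 / 5 ∧ IsReordering x t y ![-1 / 5, 3 / 5, 3 / 5] ![-2 * e / 5, e / 5, e / 5]
        ![2 / 5, -1 / 5, -1 / 5]) := by
  have hsph := h.sphere
  have h' := h.isScaledSystem hs
  obtain ⟨β, hβ⟩ : ∃ β, β = b / s := ⟨_, rfl⟩
  obtain ⟨γ, hγ⟩ : ∃ γ, γ = g / s := ⟨_, rfl⟩
  rw [← hβ, ← hγ] at h'
  rw [eq_div_iff hs] at hβ hγ
  -- Different points have finitely many parameters `(β, γ, c)`; otherwise two points coincide. In
  -- each case `sphere` gives `s²`, and `h`, `k`, `e`, `f` encode the remaining signs of square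
  -- roots.
  by_cases hne : ∀ i j, x i = x j → t i = t j → y i = y j → i = j
  · rcases h'.parameters hne with ⟨hc, h1, h2⟩ | ⟨hc, h1, h2⟩
    · left
      have hβ2 : (4 * β ^ 2 - 1) * (4 * β ^ 2 + 3) = 0 := by
        linear_combination 8 / 3 * β ^ 2 * h2 + (4 / 3 * β * γ - 1) * h1
      have hβ3 : 4 * β ^ 2 = 1 := by
        rcases mul_eq_zero.1 hβ2 with h0 | h0
        · linarith
        · nlinarith [sq_nonneg β]
      have hγβ : γ = -3 * β := by linear_combination β * h1 - γ * hβ3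
      have hs2 : 45 * s ^ 2 = 4 := by
        rw [← hβ, ← hγ, hγβ] at hsph
        linear_combination 4 * hsph - 21 * s ^ 2 * hβ3
      have hf : (15 * s / 2) ^ 2 = 5 := by linear_combination 5 / 4 * hs2
      refine ⟨2 * β, 15 * s / 2, by linear_combination hβ3, hf, by rw [← hβ]; ring, by ring,
        by rw [← hγ, hγβ]; ring, hc, ?_⟩
      have hβ4 : (2 * β - 1) * (2 * β + 1) = 0 := by linear_combination hβ3
      rw [hγβ, hc] at h'
      rcases mul_eq_zero.1 hβ4 with h0 | h0
      · have h0 : β = 1 / 2 := by linarith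
        rw [h0] at h' ⊢
        norm_num at h' ⊢
        have := IsScaledSystem.isReordering_of_five (by convert h' using 1; norm_num) hne hf
        obtain ⟨σ, hσ⟩ := this
        refine ⟨σ, fun j => ?_⟩
        obtain ⟨a1, a2, a3⟩ := hσ j
        rw [a1, a2, a3]
        fin_cases j <;> norm_num
      · have h0 : β = -1 / 2 := by linarith
        have h'' := h'.neg
        rw [h0] at h'' ⊢
        norm_num at h'' ⊢
        have := IsScaledSystem.isReordering_of_five (by convert h'' using 1; norm_num)
          (fun i j a1 a2 a3 => hne i j a1 (neg_injective a2) a3) hf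
        obtain ⟨σ, hσ⟩ := this
        refine ⟨σ, fun j => ?_⟩
        obtain ⟨a1, a2, a3⟩ := hσ j
        rw [neg_eq_iff_eq_neg] at a2
        rw [a1, a2, a3]
        fin_cases j <;> norm_num
    · right; left
      have hs2 : 32 * s ^ 2 = 3 := by
        rw [← hβ, ← hγ, h1] at hsph
        linear_combination 3 * hsph - 14 * s ^ 2 * h2
      have hh : (8 * γ * s) ^ 2 = 2 := by linear_combination 2 / 3 * hs2 + 64 / 3 * s ^ 2 * h2
      have hk : (3 * γ) ^ 2 = 3 := by linear_combination 3 * h2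
      refine ⟨8 * γ * s, 3 * γ, hh, hk, by rw [← hβ, h1]; ring,
        by linear_combination -s * h2, by rw [← hγ]; ring, hc, ?_⟩
      rw [hc] at h'
      exact h'.isReordering_of_two h1 hne hh hk (by ring)
  · right; right
    push Not at hne
    obtain ⟨i, j, h1, h2, h3, hij⟩ := hne
    obtain ⟨σ, rfl, rfl⟩ := exists_perm_apply_one_two i j hij
    obtain ⟨e, he, hb, hg, hc, hr⟩ := ((h.comp_perm σ).isScaledSystem hs).eq_of_equal h1 h2 h3
    rw [div_eq_iff hs] at hb hg
    have hs2 : 125 * s ^ 2 = 16 := by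
      rw [hb, hg] at hsph
      linear_combination 16 * hsph - 29 * s ^ 2 * he
    exact ⟨e, 25 * s / 4, he, by linear_combination 5 / 16 * hs2, by rw [hb]; ring, by ring,
      by rw [hg]; ring, hc, hr.of_comp_perm⟩

/-! ### Approximation up to order and phase; vectors with vanishing block sums -/

/-- The vector `(u, v)` is, up to a permutation of the blocks and a phase, close to `(p, q)`. -/
def IsBlockClose (ε : ℝ) (u v p q : Fin 3 → ℂ) : Prop :=
  ∃ (σ : Equiv.Perm (Fin 3)) (μ : ℂ), ‖μ‖ = 1 ∧
    ∀ j, ‖u (σ j) - μ * p j‖ ≤ ε ∧ ‖v (σ j) - μ * q j‖ ≤ ε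

/-- The free phase is taken to be the entry `u (σ 0)`, which normalises the first entry of the
vector to 1. -/
lemma IsBlockClose.of_mul_conj {ε : ℝ} {u v p q : Fin 3 → ℂ} (hu : ∀ j, ‖u j‖ = 1)
    (σ : Equiv.Perm (Fin 3)) (h : ∀ j, ‖u (σ j) * conj (u (σ 0)) - p j‖ ≤ ε ∧
      ‖v (σ j) * conj (u (σ 0)) - q j‖ ≤ ε) : IsBlockClose ε u v p q := by
  refine ⟨σ, u (σ 0), hu _, fun j => ?_⟩
  have key : ∀ z w : ℂ, ‖z - u (σ 0) * w‖ = ‖z * conj (u (σ 0)) - w‖ := by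
    intro z w
    have h1 := Complex.mul_conj_of_norm_eq_one (hu (σ 0))
    have : z - u (σ 0) * w = (z * conj (u (σ 0)) - w) * u (σ 0) := by
      linear_combination -z * h1
    rw [this, norm_mul, hu, mul_one]
  rw [key, key]
  exact h j

/-- The approximate inner products of close vectors. -/
lemma norm_inner_sub_le {ε : ℝ} {a b p q μ ν : ℂ} (ha : ‖a‖ = 1) (hb : ‖b‖ = 1)
    (h₁ : ‖a - μ * p‖ ≤ ε) (h₂ : ‖b - ν * q‖ ≤ ε) :
    ‖conj a * b - conj μ * ν * (conj p * q)‖ ≤ ε * (2 + ε) := by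
  have e : conj a * b - conj μ * ν * (conj p * q) =
      conj a * (b - ν * q) + conj (a - μ * p) * (ν * q) := by
    rw [map_sub, map_mul]; ring
  have hq : ‖ν * q‖ ≤ 1 + ε := by
    calc ‖ν * q‖ = ‖b - (b - ν * q)‖ := by rw [sub_sub_cancel]
      _ ≤ ‖b‖ + ‖b - ν * q‖ := norm_sub_le _ _
      _ ≤ 1 + ε := by rw [hb]; linarith
  have hε : 0 ≤ ε := (norm_nonneg _).trans h₁
  rw [e]
  calc _ ≤ ‖conj a * (b - ν * q)‖ + ‖conj (a - μ * p) * (ν * q)‖ := norm_add_le _ _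
    _ = ‖b - ν * q‖ + ‖a - μ * p‖ * ‖ν * q‖ := by
      rw [norm_mul, norm_mul, Complex.norm_conj, Complex.norm_conj, ha, one_mul]
    _ ≤ ε + ε * (1 + ε) := by gcongr
    _ = ε * (2 + ε) := by ring

/-- The unbiased vectors with vanishing block sums. -/
lemma IsConferenceUnbiased.of_sum_eq_zero {u v : Fin 3 → ℂ} (h : IsConferenceUnbiased u v)
    (hu0 : ∑ k, u k = 0) (hv0 : ∑ k, v k = 0) :
    ∃ (σ : Equiv.Perm (Fin 3)) (k m : ℝ), k ^ 2 = 1 / 2 ∧ m ^ 2 = 3 / 4 ∧ 0 ≤ m ∧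
      u (σ 1) * conj (u (σ 0)) = -1 / 2 + Complex.I * m ∧
      u (σ 2) * conj (u (σ 0)) = -1 / 2 - Complex.I * m ∧
      ∀ j, v j = k * (1 + Complex.I) * u j := by
  have hn := fun j => Complex.mul_conj_of_norm_eq_one (h.norm_left j)
  have hu := fun j => Complex.re_sq_add_im_sq_of_norm_eq_one (h.norm_left j)
  have hv := fun j => Complex.re_sq_add_im_sq_of_norm_eq_one (h.norm_right j)
  have h1 := h.fst_sq
  rw [hu0, hv0] at h1
  simp only [Complex.zero_re, Complex.zero_im, add_zero, sub_zero] at h1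
  have hk : ∀ j, ∃ k : ℝ, k ^ 2 = 1 / 2 ∧ v j = k * (1 + Complex.I) * u j := by
    intro j
    have hR := h1 j
    have hU := hu j
    have hV := hv j
    have hne : u j * conj (u j) = 1 := hn j
    -- When the block sums vanish, `fst` says that `(1 - i) u + 2 v` has squared norm 6 = 2 + 4. So
    -- the cross term is zero, and the real and imaginary parts of `v ū` are the same number `k`.
    obtain ⟨k, hk⟩ : ∃ k, k = (u j).re * (v j).re + (u j).im * (v j).im := ⟨_, rfl⟩
    have hk' : k = (u j).re * (v j).im - (u j).im * (v j).re := by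
      rw [hk]
      linear_combination (hR - 2 * hU - 4 * hV) / 4
    have h2 : 2 * k ^ 2 = 1 := by
      have : k ^ 2 + k ^ 2 = 1 := by
        nth_rewrite 1 [hk]
        rw [hk']
        linear_combination ((v j).re ^ 2 + (v j).im ^ 2) * hU + hV
      linarith
    refine ⟨k, by linarith, ?_⟩
    have : v j * conj (u j) = k * (1 + Complex.I) := by
      apply Complex.ext
      · simp; rw [hk]; ring
      · simp; rw [hk']; ring
    linear_combination u j * this - v j * hne
  choose k hk2 hvk using hk
  have hne : ∀ j, u j ≠ 0 := fun j hj => by simpa [hj] using hn j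
  rw [Fin.sum_univ_three] at hu0 hv0
  have h1I : (1 + Complex.I : ℂ) ≠ 0 := fun h0 => by simpa using congrArg Complex.re h0
  -- The `k j` agree up to sign. A sign change between blocks would combine the two vanishing sums
  -- into `u j = 0` for some `j`.
  have hku : (k 1 - k 0 : ℂ) * u 1 + (k 2 - k 0) * u 2 = 0 := by
    rw [hvk, hvk, hvk] at hv0
    apply mul_left_cancel₀ h1I
    linear_combination hv0 - k 0 * (1 + Complex.I) * hu0
  have hpm : ∀ j, k j = k 0 ∨ k j = -k 0 := fun j => by
    have : (k j - k 0) * (k j + k 0) = 0 := by linear_combination hk2 j - hk2 0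
    rcases mul_eq_zero.1 this with h | h
    · left; linarith
    · right; linarith
  have hk0 : (k 0 : ℂ) ≠ 0 := by
    rw [Ne, Complex.ofReal_eq_zero]
    intro h0
    have := hk2 0
    rw [h0] at this
    norm_num at this
  have hkk : k 1 = k 0 ∧ k 2 = k 0 := by
    rcases hpm 1 with h1 | h1 <;> rcases hpm 2 with h2 | h2
    · exact ⟨h1, h2⟩
    · exfalso
      rw [h1, h2] at hku
      push_cast at hku
      exact mul_ne_zero hk0 (hne 2) (by linear_combination -hku / 2)
    · exfalso
      rw [h1, h2] at hku
      push_cast at hku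
      exact mul_ne_zero hk0 (hne 1) (by linear_combination -hku / 2)
    · exfalso
      rw [h1, h2] at hku
      push_cast at hku
      exact mul_ne_zero hk0 (hne 0) (by linear_combination k 0 * hu0 + hku / 2)
  have hvj : ∀ j, v j = k 0 * (1 + Complex.I) * u j := by
    intro j
    rw [hvk]
    congr 2
    fin_cases j
    · rfl
    · exact congrArg _ hkk.1
    · exact congrArg _ hkk.2
  obtain ⟨p, hp⟩ : ∃ p, p = u 1 * conj (u 0) := ⟨_, rfl⟩
  have hp2 : u 2 * conj (u 0) = -1 - p := by
    rw [hp]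
    linear_combination conj (u 0) * hu0 - hn 0
  have n1 : p.re ^ 2 + p.im ^ 2 = 1 := by
    apply Complex.re_sq_add_im_sq_of_norm_eq_one
    rw [hp, norm_mul, Complex.norm_conj, h.norm_left, h.norm_left, one_mul]
  have n2 : (-1 - p).re ^ 2 + (-1 - p).im ^ 2 = 1 := by
    apply Complex.re_sq_add_im_sq_of_norm_eq_one
    rw [← hp2, norm_mul, Complex.norm_conj, h.norm_left, h.norm_left, one_mul]
  simp at n2
  have hre : p.re = -1 / 2 := by linarith
  rw [hre] at n1
  have e1 : p = -1 / 2 + Complex.I * p.im := by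
    apply Complex.ext
    · simp [hre]
    · simp
  rcases le_total 0 p.im with hm | hm
  · refine ⟨Equiv.refl _, k 0, p.im, hk2 0, by linarith, hm, ?_, ?_, hvj⟩
    · rw [← e1, hp]; rfl
    · change u 2 * conj (u 0) = _
      rw [hp2]; linear_combination -e1
  · refine ⟨Equiv.swap 1 2, k 0, -p.im, hk2 0, by nlinarith, by linarith, ?_, ?_, hvj⟩
    · change u 2 * conj (u 0) = _
      rw [hp2]; push_cast; linear_combination -e1
    · change u 1 * conj (u 0) = _
      rw [← hp]; push_cast; linear_combination e1

/-! ### Relative entries of a solution and their error estimates -/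

/-- The entry `8 u conj u₀` of the first half of a solution, homogenised by `n`. -/
def leftEntry {K : Type*} [CommRing K] (i n D b s g x t y x₀ t₀ y₀ : K) : K :=
  D * ((n + i * (-(x + 2 * t))) * (n + i * (x₀ + 2 * t₀)) * (n + (b + 2 * s) + i * 0) -
    (n + i * (-(x + 2 * t))) * (-x₀ + t₀ - y₀ + i * (-(x₀ - t₀ - y₀))) *
      (b - s - g + i * (-(-b + s - g))) -
    (-x + t - y + i * (x - t - y)) * (n + i * (x₀ + 2 * t₀)) * (b - s - g + i * (-b + s - g)) +
    (-x + t - y + i * (x - t - y)) * (-x₀ + t₀ - y₀ + i * (-(x₀ - t₀ - y₀))) *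
      (n - (b + 2 * s) + i * 0))

/-- The entry `8 v conj u₀` of the second half of a solution, homogenised by `n`. -/
def rightEntry {K : Type*} [CommRing K] (i n D b s g x t y x₀ t₀ y₀ : K) : K :=
  D * ((-x + t - y + i * (-(x - t - y))) * (n + i * (x₀ + 2 * t₀)) * (n + (b + 2 * s) + i * 0) -
    (-x + t - y + i * (-(x - t - y))) * (-x₀ + t₀ - y₀ + i * (-(x₀ - t₀ - y₀))) *
      (b - s - g + i * (-(-b + s - g))) +
    (n + i * (x + 2 * t)) * (n + i * (x₀ + 2 * t₀)) * (b - s - g + i * (-b + s - g)) -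
    (n + i * (x + 2 * t)) * (-x₀ + t₀ - y₀ + i * (-(x₀ - t₀ - y₀))) * (n - (b + 2 * s) + i * 0))

namespace IsBlochForm

variable {u v : Fin 3 → ℂ} {d₀ d₁ : ℂ} {D b s g : ℝ} {x t y : Fin 3 → ℝ}

/-- Multiplying by `conj (u k)` removes the common phase of `d`: the products are Hermitian
expressions in `d`, so they depend on `d` only through `D` and the Bloch vector. -/
lemma mul_conj_eq (h : IsBlochForm u v d₀ d₁ D b s g x t y) (j k : Fin 3) :
    8 * (u j * conj (u k)) =
        leftEntry Complex.I 1 D b s g (x j) (t j) (y j) (x k) (t k) (y k) ∧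
      8 * (v j * conj (u k)) =
        rightEntry Complex.I 1 D b s g (x j) (t j) (y j) (x k) (t k) (y k) := by
  have n0 : 2 * (d₀ * conj d₀) = D * (1 + (b + 2 * s)) := by
    apply Complex.ext
    · have := h.normSq_fst
      simp
      linear_combination this
    · simp
      ring
  have n1 : 2 * (d₁ * conj d₁) = D * (1 - (b + 2 * s)) := by
    apply Complex.ext
    · have := h.normSq_snd
      simp
      linear_combination this
    · simp
      ring
  have r1 : 2 * (d₁ * conj d₀) = D * (b - s - g + Complex.I * (-b + s - g)) := by
    apply Complex.ext
    · have := h.inner_re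
      simp
      linear_combination this
    · have := h.inner_im
      simp
      linear_combination this
  have r2 : 2 * (d₀ * conj d₁) = D * (b - s - g - Complex.I * (-b + s - g)) := by
    have := congrArg conj r1
    simp only [map_mul, map_add, map_sub, map_neg, Complex.conj_conj, Complex.conj_ofReal,
      Complex.conj_I] at this
    rw [Complex.conj_ofNat] at this
    linear_combination this
  have c : 2 * conj (u k) = (1 + Complex.I * (x k + 2 * t k)) * conj d₀ -
      (-(Complex.I * (x k - t k - y k)) + (-x k + t k - y k)) * conj d₁ := by
    have := congrArg conj (h.left k)
    simp only [map_mul, map_add, map_sub, map_neg, map_one, Complex.conj_ofReal,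
      Complex.conj_I] at this
    rw [Complex.conj_ofNat] at this
    linear_combination this
  have l := h.left j
  have r := h.right j
  rw [leftEntry, rightEntry]
  generalize conj (u k) = U, conj d₀ = e₀, conj d₁ = e₁ at *
  constructor
  · linear_combination 4 * U * l + 2 * ((1 - Complex.I * (x j + 2 * t j)) * d₀ -
      (Complex.I * (x j - t j - y j) + (-x j + t j - y j)) * d₁) * c +
      (1 - Complex.I * (x j + 2 * t j)) * (1 + Complex.I * (x k + 2 * t k)) * n0 -
      (1 - Complex.I * (x j + 2 * t j)) *
        (-(Complex.I * (x k - t k - y k)) + (-x k + t k - y k)) * r2 -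
      (Complex.I * (x j - t j - y j) + (-x j + t j - y j)) *
        (1 + Complex.I * (x k + 2 * t k)) * r1 +
      (Complex.I * (x j - t j - y j) + (-x j + t j - y j)) *
        (-(Complex.I * (x k - t k - y k)) + (-x k + t k - y k)) * n1
  · linear_combination 4 * U * r + 2 * ((-(Complex.I * (x j - t j - y j)) +
      (-x j + t j - y j)) * d₀ + (1 + Complex.I * (x j + 2 * t j)) * d₁) * c +
      (-(Complex.I * (x j - t j - y j)) + (-x j + t j - y j)) *
        (1 + Complex.I * (x k + 2 * t k)) * n0 -
      (-(Complex.I * (x j - t j - y j)) + (-x j + t j - y j)) *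
        (-(Complex.I * (x k - t k - y k)) + (-x k + t k - y k)) * r2 +
      (1 + Complex.I * (x j + 2 * t j)) * (1 + Complex.I * (x k + 2 * t k)) * r1 -
      (1 + Complex.I * (x j + 2 * t j)) *
        (-(Complex.I * (x k - t k - y k)) + (-x k + t k - y k)) * n1

end IsBlochForm

lemma norm_mul_sub_mul_le {a a' b b' : ℂ} {A B ε η : ℝ} (ha : ‖a'‖ ≤ A) (hb : ‖b‖ ≤ B)
    (h₁ : ‖a - a'‖ ≤ ε) (h₂ : ‖b - b'‖ ≤ η) : ‖a * b - a' * b'‖ ≤ ε * B + A * η := by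
  have hε : 0 ≤ ε := (norm_nonneg _).trans h₁
  have hA : 0 ≤ A := (norm_nonneg _).trans ha
  calc ‖a * b - a' * b'‖ = ‖(a - a') * b + a' * (b - b')‖ := by congr 1; ring
    _ ≤ ‖a - a'‖ * ‖b‖ + ‖a'‖ * ‖b - b'‖ := by
      rw [← norm_mul, ← norm_mul]
      exact norm_add_le _ _
    _ ≤ ε * B + A * η := by gcongr

lemma norm_re_add_im_le (p q : ℝ) : ‖(p + Complex.I * q : ℂ)‖ ≤ |p| + |q| := by
  calc _ ≤ ‖(p : ℂ)‖ + ‖Complex.I * q‖ := norm_add_le _ _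
    _ = |p| + |q| := by simp

/-- `a` and `a'` are real numbers of absolute value at most `3` and at distance at most `δ`. -/
structure IsNear (δ a a' : ℝ) : Prop where
  sub_le : |a - a'| ≤ δ
  left_le : |a| ≤ 3
  right_le : |a'| ≤ 3

/-- Complex numbers that are bounded by `18` and at distance at most `6 δ`. -/
structure IsNearFactor (δ : ℝ) (z z' : ℂ) : Prop where
  sub_le : ‖z - z'‖ ≤ 6 * δ
  left_le : ‖z‖ ≤ 18
  right_le : ‖z'‖ ≤ 18

lemma IsNearFactor.of_re_im {δ p q p' q' : ℝ} (h₁ : |p - p'| + |q - q'| ≤ 6 * δ)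
    (h₂ : |p| + |q| ≤ 18) (h₃ : |p'| + |q'| ≤ 18) :
    IsNearFactor δ (p + Complex.I * q) (p' + Complex.I * q') := by
  refine ⟨?_, (norm_re_add_im_le p q).trans h₂, (norm_re_add_im_le p' q').trans h₃⟩
  have : (p + Complex.I * q - (p' + Complex.I * q') : ℂ) =
      ((p - p' : ℝ) + Complex.I * (q - q' : ℝ)) := by push_cast; ring
  rw [this]
  exact (norm_re_add_im_le _ _).trans h₁

lemma IsNearFactor.mul_mul {δ : ℝ} {a b c a' b' c' : ℂ} (ha : IsNearFactor δ a a')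
    (hb : IsNearFactor δ b b') (hc : IsNearFactor δ c c') :
    ‖a * b * c - a' * b' * c'‖ ≤ 5832 * δ ∧ ‖a * b * c‖ ≤ 5832 := by
  have h1 := norm_mul_sub_mul_le ha.right_le hb.left_le ha.sub_le hb.sub_le
  have h2 : ‖a' * b'‖ ≤ 18 * 18 := by
    rw [norm_mul]
    exact mul_le_mul ha.right_le hb.right_le (norm_nonneg _) (by norm_num)
  have h3 := norm_mul_sub_mul_le h2 hc.left_le h1 hc.sub_le
  refine ⟨h3.trans (le_of_eq (by ring)), ?_⟩
  rw [norm_mul, norm_mul]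
  calc _ ≤ (18 * 18 * 18 : ℝ) := by
        gcongr
        · exact ha.left_le
        · exact hb.left_le
        · exact hc.left_le
    _ = 5832 := by norm_num

/-- A product of three factors has size at most `5832 = 18³` and error at most `3 · 18² · 6δ = 5832
δ`. Four of them give 23328, and `(6.1 + 1) · 23328 < 166000`. The bound `61 / 10` leaves room for
the largest scale in the table, `D = 6`. -/
lemma norm_four_le {δ D D' : ℝ} {p q r s p' q' r' s' : ℂ} (hD : |D'| ≤ 61 / 10) (hD' : |D - D'| ≤ δ)
    (hp : ‖p - p'‖ ≤ 5832 * δ ∧ ‖p‖ ≤ 5832) (hq : ‖q - q'‖ ≤ 5832 * δ ∧ ‖q‖ ≤ 5832)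
    (hr : ‖r - r'‖ ≤ 5832 * δ ∧ ‖r‖ ≤ 5832) (hs : ‖s - s'‖ ≤ 5832 * δ ∧ ‖s‖ ≤ 5832) :
    ‖(D * (p - q - r + s) - D' * (p' - q' - r' + s') : ℂ)‖ ≤ 166000 * δ := by
  have hδ : 0 ≤ δ := (abs_nonneg _).trans hD'
  have h1 : ‖p - q - r + s‖ ≤ 23328 := by
    calc _ ≤ ‖p‖ + ‖q‖ + ‖r‖ + ‖s‖ := by
          refine (norm_add_le _ _).trans ?_
          gcongr
          refine (norm_sub_le _ _).trans ?_
          gcongr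
          exact norm_sub_le _ _
      _ ≤ 23328 := by linarith [hp.2, hq.2, hr.2, hs.2]
  have h2 : ‖(p - q - r + s) - (p' - q' - r' + s')‖ ≤ 23328 * δ := by
    calc _ = ‖(p - p') - (q - q') - (r - r') + (s - s')‖ := by congr 1; ring
      _ ≤ ‖p - p'‖ + ‖q - q'‖ + ‖r - r'‖ + ‖s - s'‖ := by
          refine (norm_add_le _ _).trans ?_
          gcongr
          refine (norm_sub_le _ _).trans ?_
          gcongr
          exact norm_sub_le _ _
      _ ≤ 23328 * δ := by linarith [hp.1, hq.1, hr.1, hs.1]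
  have h3 : ‖(D - D' : ℂ)‖ ≤ δ := by
    rw [← Complex.ofReal_sub, Complex.norm_real]
    exact hD'
  have h4 : ‖(D' : ℂ)‖ ≤ 61 / 10 := by
    rw [Complex.norm_real]
    exact hD
  refine (norm_mul_sub_mul_le h4 h1 h3 h2).trans ?_
  linarith

lemma norm_entry_sub_le {δ D b s g x t y x₀ t₀ y₀ D' b' s' g' x' t' y' x₀' t₀' y₀' : ℝ}
    (hD : |D'| ≤ 61 / 10) (hD' : |D - D'| ≤ δ) (hb : IsNear δ b b') (hs : IsNear δ s s')
    (hg : IsNear δ g g') (hx : IsNear δ x x') (ht : IsNear δ t t') (hy : IsNear δ y y')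
    (hx₀ : IsNear δ x₀ x₀') (ht₀ : IsNear δ t₀ t₀') (hy₀ : IsNear δ y₀ y₀') :
    ‖leftEntry Complex.I 1 D b s g x t y x₀ t₀ y₀ -
        leftEntry Complex.I 1 D' b' s' g' x' t' y' x₀' t₀' y₀'‖ ≤ 166000 * δ ∧
      ‖rightEntry Complex.I 1 D b s g x t y x₀ t₀ y₀ -
        rightEntry Complex.I 1 D' b' s' g' x' t' y' x₀' t₀' y₀'‖ ≤ 166000 * δ := by
  have split : ∀ {a a'}, IsNear δ a a' → (-δ ≤ a - a' ∧ a - a' ≤ δ) ∧ (-3 ≤ a ∧ a ≤ 3) ∧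
      (-3 ≤ a' ∧ a' ≤ 3) := fun h => ⟨abs_le.1 h.sub_le, abs_le.1 h.left_le, abs_le.1 h.right_le⟩
  have hδ : 0 ≤ δ := (abs_nonneg _).trans hD'
  obtain ⟨⟨b1, b2⟩, ⟨b3, b4⟩, b5, b6⟩ := split hb
  obtain ⟨⟨s1, s2⟩, ⟨s3, s4⟩, s5, s6⟩ := split hs
  obtain ⟨⟨g1, g2⟩, ⟨g3, g4⟩, g5, g6⟩ := split hg
  have dir : ∀ {x t x' t'}, IsNear δ x x' → IsNear δ t t' →
      IsNearFactor δ ((1 : ℝ) + Complex.I * ((x + 2 * t : ℝ) : ℂ))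
        ((1 : ℝ) + Complex.I * ((x' + 2 * t' : ℝ) : ℂ)) ∧
      IsNearFactor δ ((1 : ℝ) + Complex.I * ((-(x + 2 * t) : ℝ) : ℂ))
        ((1 : ℝ) + Complex.I * ((-(x' + 2 * t') : ℝ) : ℂ)) := by
    intro x t x' t' hx ht
    obtain ⟨⟨x1, x2⟩, ⟨x3, x4⟩, x5, x6⟩ := split hx
    obtain ⟨⟨t1, t2⟩, ⟨t3, t4⟩, t5, t6⟩ := split ht
    have d : |x + 2 * t - (x' + 2 * t')| ≤ 3 * δ := abs_le.2 ⟨by linarith, by linarith⟩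
    have l : |x + 2 * t| ≤ 9 := abs_le.2 ⟨by linarith, by linarith⟩
    have l' : |x' + 2 * t'| ≤ 9 := abs_le.2 ⟨by linarith, by linarith⟩
    constructor
    · apply IsNearFactor.of_re_im
      · rw [sub_self, abs_zero]; linarith
      · rw [abs_one]; linarith
      · rw [abs_one]; linarith
    · apply IsNearFactor.of_re_im
      · rw [sub_self, abs_zero, neg_sub_neg, abs_sub_comm]; linarith
      · rw [abs_one, abs_neg]; linarith
      · rw [abs_one, abs_neg]; linarith
  have cross : ∀ {x t y x' t' y'}, IsNear δ x x' → IsNear δ t t' → IsNear δ y y' →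
      IsNearFactor δ ((-x + t - y : ℝ) + Complex.I * ((x - t - y : ℝ) : ℂ))
        ((-x' + t' - y' : ℝ) + Complex.I * ((x' - t' - y' : ℝ) : ℂ)) ∧
      IsNearFactor δ ((-x + t - y : ℝ) + Complex.I * ((-(x - t - y) : ℝ) : ℂ))
        ((-x' + t' - y' : ℝ) + Complex.I * ((-(x' - t' - y') : ℝ) : ℂ)) := by
    intro x t y x' t' y' hx ht hy
    obtain ⟨⟨x1, x2⟩, ⟨x3, x4⟩, x5, x6⟩ := split hx
    obtain ⟨⟨t1, t2⟩, ⟨t3, t4⟩, t5, t6⟩ := split ht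
    obtain ⟨⟨y1, y2⟩, ⟨y3, y4⟩, y5, y6⟩ := split hy
    have d : |-x + t - y - (-x' + t' - y')| ≤ 3 * δ := abs_le.2 ⟨by linarith, by linarith⟩
    have l : |-x + t - y| ≤ 9 := abs_le.2 ⟨by linarith, by linarith⟩
    have l' : |-x' + t' - y'| ≤ 9 := abs_le.2 ⟨by linarith, by linarith⟩
    have e : |x - t - y - (x' - t' - y')| ≤ 3 * δ := abs_le.2 ⟨by linarith, by linarith⟩
    have m : |x - t - y| ≤ 9 := abs_le.2 ⟨by linarith, by linarith⟩
    have m' : |x' - t' - y'| ≤ 9 := abs_le.2 ⟨by linarith, by linarith⟩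
    constructor
    · apply IsNearFactor.of_re_im <;> linarith
    · apply IsNearFactor.of_re_im
      · rw [neg_sub_neg, abs_sub_comm (x' - t' - y')]; linarith
      · rw [abs_neg]; linarith
      · rw [abs_neg]; linarith
  obtain ⟨R, R'⟩ := cross (x := s) (x' := s') (t := b) (t' := b') hs hb hg
  have R : IsNearFactor δ ((b - s - g : ℝ) + Complex.I * ((-b + s - g : ℝ) : ℂ))
      ((b' - s' - g' : ℝ) + Complex.I * ((-b' + s' - g' : ℝ) : ℂ)) := by
    convert R using 4 <;> ring
  have R' : IsNearFactor δ ((b - s - g : ℝ) + Complex.I * ((-(-b + s - g) : ℝ) : ℂ))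
      ((b' - s' - g' : ℝ) + Complex.I * ((-(-b' + s' - g') : ℝ) : ℂ)) := by
    convert R' using 4 <;> ring
  have d : |b + 2 * s - (b' + 2 * s')| ≤ 3 * δ := abs_le.2 ⟨by linarith, by linarith⟩
  have P : IsNearFactor δ ((1 + (b + 2 * s) : ℝ) + Complex.I * ((0 : ℝ) : ℂ))
      ((1 + (b' + 2 * s') : ℝ) + Complex.I * ((0 : ℝ) : ℂ)) := by
    apply IsNearFactor.of_re_im
    · rw [sub_self, abs_zero, add_sub_add_left_eq_sub]; linarith
    · rw [abs_zero, add_zero]; exact abs_le.2 ⟨by linarith, by linarith⟩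
    · rw [abs_zero, add_zero]; exact abs_le.2 ⟨by linarith, by linarith⟩
  have Q : IsNearFactor δ ((1 - (b + 2 * s) : ℝ) + Complex.I * ((0 : ℝ) : ℂ))
      ((1 - (b' + 2 * s') : ℝ) + Complex.I * ((0 : ℝ) : ℂ)) := by
    apply IsNearFactor.of_re_im
    · rw [sub_self, abs_zero, sub_sub_sub_cancel_left, abs_sub_comm]; linarith
    · rw [abs_zero, add_zero]; exact abs_le.2 ⟨by linarith, by linarith⟩
    · rw [abs_zero, add_zero]; exact abs_le.2 ⟨by linarith, by linarith⟩
  obtain ⟨α', α⟩ := dir hx ht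
  obtain ⟨α₀', -⟩ := dir hx₀ ht₀
  obtain ⟨β, β'⟩ := cross hx ht hy
  obtain ⟨-, β₀'⟩ := cross hx₀ ht₀ hy₀
  constructor
  · have := norm_four_le hD hD' (α.mul_mul α₀' P) (α.mul_mul β₀' R') (β.mul_mul α₀' R)
      (β.mul_mul β₀' Q)
    rw [leftEntry, leftEntry]
    push_cast at this
    exact this
  · have := norm_four_le hD hD' (β'.mul_mul α₀' P) (β'.mul_mul β₀' R') (α'.mul_mul β₀' Q)
      (α'.mul_mul α₀' R)
    rw [rightEntry, rightEntry]
    push_cast at this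
    convert this using 2
    ring

/-! ### Decimal tables -/

/-- Decimal approximations, in units of `10⁻⁷`, of a solution of the polynomial system. -/
structure BlochRow where
  D : ℤ
  b : ℤ
  s : ℤ
  g : ℤ
  x : Fin 3 → ℤ
  t : Fin 3 → ℤ
  y : Fin 3 → ℤ

/-- The solutions of the polynomial system. -/
def blochTable : Fin 24 → BlochRow := ![
  ⟨6666667, 4472136, 0, 4472136, ![-10000000, 18944272, 1055728],
    ![0, 0, 0], ![-20000000, -3416408, 23416408]⟩,
  ⟨6666667, -4472136, 0, -4472136, ![-10000000, 1055728, 18944272],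
    ![0, 0, 0], ![-20000000, 23416408, -3416408]⟩,
  ⟨13333333, 0, 0, 7071068, ![10000000, 0, 0],
    ![0, 8660254, -8660254], ![10000000, -5000000, -5000000]⟩,
  ⟨13333333, 0, 0, -7071068, ![10000000, 0, 0],
    ![0, 8660254, -8660254], ![10000000, -5000000, -5000000]⟩,
  ⟨22277605, 5669153, 0, -1338305, ![7323389, 1338305, 1338305],
    ![0, 6180340, -6180340], ![-7007458, 3503729, 3503729]⟩,
  ⟨22277605, -5669153, 0, 1338305, ![7323389, 1338305, 1338305],
    ![0, 6180340, -6180340], ![-7007458, 3503729, 3503729]⟩,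
  ⟨4389061, 1603575, 0, 6792851, ![23585702, -6792851, -6792851],
    ![0, -16180340, 16180340], ![5189276, -2594638, -2594638]⟩,
  ⟨4389061, -1603575, 0, -6792851, ![23585702, -6792851, -6792851],
    ![0, -16180340, 16180340], ![5189276, -2594638, -2594638]⟩,
  ⟨33333333, 2683282, 0, 6260990, ![-2000000, 6000000, 6000000],
    ![0, 0, 0], ![-8000000, 4000000, 4000000]⟩,
  ⟨33333333, -2683282, 0, -6260990, ![-2000000, 6000000, 6000000],
    ![0, 0, 0], ![-8000000, 4000000, 4000000]⟩,
  ⟨60000000, 4472136, 0, 4472136, ![3333333, 3333333, 3333333],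
    ![0, 0, 0], ![0, 0, 0]⟩,
  ⟨60000000, -4472136, 0, -4472136, ![3333333, 3333333, 3333333],
    ![0, 0, 0], ![0, 0, 0]⟩,
  ⟨20000000, 1490712, 2981424, -4472136, ![3333333, 6314757, 351909],
    ![-3333333, -3550825, 6884159], ![-10000000, 7236068, 2763932]⟩,
  ⟨20000000, -1490712, -2981424, 4472136, ![3333333, 351909, 6314757],
    ![-3333333, 6884159, -3550825], ![-10000000, 2763932, 7236068]⟩,
  ⟨20000000, -1490712, 2981424, 4472136, ![3333333, 6314757, 351909],
    ![3333333, 3550825, -6884159], ![-10000000, 7236068, 2763932]⟩,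
  ⟨20000000, 1490712, -2981424, -4472136, ![3333333, 351909, 6314757],
    ![3333333, -6884159, 3550825], ![-10000000, 2763932, 7236068]⟩,
  ⟨26666667, -3535534, 3061862, 1767767, ![5000000, 6035534, -1035534],
    ![4330127, 896799, -5226926], ![2500000, -6553301, 4053301]⟩,
  ⟨26666667, -3535534, -3061862, 1767767, ![5000000, 6035534, -1035534],
    ![-4330127, -896799, 5226926], ![2500000, -6553301, 4053301]⟩,
  ⟨26666667, 3535534, -3061862, -1767767, ![5000000, -1035534, 6035534],
    ![4330127, -5226926, 896799], ![2500000, 4053301, -6553301]⟩,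
  ⟨26666667, 3535534, 3061862, -1767767, ![5000000, -1035534, 6035534],
    ![-4330127, 5226926, -896799], ![2500000, 4053301, -6553301]⟩,
  ⟨33333333, -2683282, 3577709, 894427, ![-2000000, 6000000, 6000000],
    ![-4000000, 2000000, 2000000], ![4000000, -2000000, -2000000]⟩,
  ⟨33333333, 2683282, -3577709, -894427, ![-2000000, 6000000, 6000000],
    ![-4000000, 2000000, 2000000], ![4000000, -2000000, -2000000]⟩,
  ⟨33333333, 2683282, 3577709, -894427, ![-2000000, 6000000, 6000000],
    ![4000000, -2000000, -2000000], ![4000000, -2000000, -2000000]⟩,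
  ⟨33333333, -2683282, -3577709, 894427, ![-2000000, 6000000, 6000000],
    ![4000000, -2000000, -2000000], ![4000000, -2000000, -2000000]⟩]

/-- The unbiased vectors, in units of `10⁻⁴`, up to permutation and phase. -/
def vectorTable : Fin 26 → (Fin 3 → GaussianInt) × (Fin 3 → GaussianInt) := ![
  (![⟨10000, 0⟩, ⟨-10000, 0⟩, ⟨-4472, -8944⟩],
    ![⟨-4472, -8944⟩, ⟨-10000, 0⟩, ⟨4472, 8944⟩]),
  (![⟨10000, 0⟩, ⟨-10000, 0⟩, ⟨4472, 8944⟩],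
    ![⟨4472, 8944⟩, ⟨-10000, 0⟩, ⟨-4472, -8944⟩]),
  (![⟨10000, 0⟩, ⟨2588, 9659⟩, ⟨-9659, -2588⟩],
    ![⟨7071, -7071⟩, ⟨5000, 8660⟩, ⟨5000, -8660⟩]),
  (![⟨10000, 0⟩, ⟨-2588, -9659⟩, ⟨9659, 2588⟩],
    ![⟨-7071, 7071⟩, ⟨5000, 8660⟩, ⟨5000, -8660⟩]),
  (![⟨10000, 0⟩, ⟨8944, 4472⟩, ⟨0, 10000⟩],
    ![⟨10000, 0⟩, ⟨-4472, 8944⟩, ⟨4472, -8944⟩]),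
  (![⟨10000, 0⟩, ⟨-4472, -8944⟩, ⟨4472, 8944⟩],
    ![⟨-10000, 0⟩, ⟨-8944, 4472⟩, ⟨0, 10000⟩]),
  (![⟨10000, 0⟩, ⟨-8944, -4472⟩, ⟨0, 10000⟩],
    ![⟨10000, 0⟩, ⟨4472, -8944⟩, ⟨-4472, 8944⟩]),
  (![⟨10000, 0⟩, ⟨4472, 8944⟩, ⟨-4472, -8944⟩],
    ![⟨-10000, 0⟩, ⟨8944, -4472⟩, ⟨0, 10000⟩]),
  (![⟨10000, 0⟩, ⟨-4472, -8944⟩, ⟨-4472, -8944⟩],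
    ![⟨-4472, -8944⟩, ⟨-10000, 0⟩, ⟨-10000, 0⟩]),
  (![⟨10000, 0⟩, ⟨4472, 8944⟩, ⟨4472, 8944⟩],
    ![⟨4472, 8944⟩, ⟨-10000, 0⟩, ⟨-10000, 0⟩]),
  (![⟨10000, 0⟩, ⟨10000, 0⟩, ⟨10000, 0⟩],
    ![⟨4472, -8944⟩, ⟨4472, -8944⟩, ⟨4472, -8944⟩]),
  (![⟨10000, 0⟩, ⟨10000, 0⟩, ⟨10000, 0⟩],
    ![⟨-4472, 8944⟩, ⟨-4472, 8944⟩, ⟨-4472, 8944⟩]),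
  (![⟨10000, 0⟩, ⟨8944, 4472⟩, ⟨4472, -8944⟩],
    ![⟨4472, -8944⟩, ⟨-10000, 0⟩, ⟨0, 10000⟩]),
  (![⟨10000, 0⟩, ⟨-8944, -4472⟩, ⟨-4472, 8944⟩],
    ![⟨-4472, 8944⟩, ⟨-10000, 0⟩, ⟨0, 10000⟩]),
  (![⟨10000, 0⟩, ⟨4472, -8944⟩, ⟨0, 10000⟩],
    ![⟨4472, -8944⟩, ⟨-8944, -4472⟩, ⟨-10000, 0⟩]),
  (![⟨10000, 0⟩, ⟨-4472, 8944⟩, ⟨0, 10000⟩],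
    ![⟨-4472, 8944⟩, ⟨8944, 4472⟩, ⟨-10000, 0⟩]),
  (![⟨10000, 0⟩, ⟨5000, 8660⟩, ⟨-7071, 7071⟩],
    ![⟨-2588, -9659⟩, ⟨5000, -8660⟩, ⟨-9659, -2588⟩]),
  (![⟨10000, 0⟩, ⟨5000, -8660⟩, ⟨-7071, 7071⟩],
    ![⟨9659, 2588⟩, ⟨5000, 8660⟩, ⟨2588, 9659⟩]),
  (![⟨10000, 0⟩, ⟨5000, 8660⟩, ⟨7071, -7071⟩],
    ![⟨2588, 9659⟩, ⟨5000, -8660⟩, ⟨9659, 2588⟩]),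
  (![⟨10000, 0⟩, ⟨5000, -8660⟩, ⟨7071, -7071⟩],
    ![⟨-9659, -2588⟩, ⟨5000, 8660⟩, ⟨-2588, -9659⟩]),
  (![⟨10000, 0⟩, ⟨0, -10000⟩, ⟨0, -10000⟩],
    ![⟨4472, 8944⟩, ⟨-8944, 4472⟩, ⟨-8944, 4472⟩]),
  (![⟨10000, 0⟩, ⟨0, -10000⟩, ⟨0, -10000⟩],
    ![⟨-4472, -8944⟩, ⟨8944, -4472⟩, ⟨8944, -4472⟩]),
  (![⟨10000, 0⟩, ⟨8944, 4472⟩, ⟨8944, 4472⟩],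
    ![⟨-4472, 8944⟩, ⟨0, -10000⟩, ⟨0, -10000⟩]),
  (![⟨10000, 0⟩, ⟨-8944, -4472⟩, ⟨-8944, -4472⟩],
    ![⟨4472, -8944⟩, ⟨0, -10000⟩, ⟨0, -10000⟩]),
  (![⟨10000, 0⟩, ⟨-5000, 8660⟩, ⟨-5000, -8660⟩],
    ![⟨7071, 7071⟩, ⟨-9659, 2588⟩, ⟨2588, -9659⟩]),
  (![⟨10000, 0⟩, ⟨-5000, 8660⟩, ⟨-5000, -8660⟩],
    ![⟨-7071, -7071⟩, ⟨9659, -2588⟩, ⟨-2588, 9659⟩])]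

/-- `n` is `10⁷ a` up to an error of at most one. -/
def IsDecimal (a : ℝ) (n : ℤ) : Prop := n - 1 ≤ 10000000 * a ∧ 10000000 * a ≤ n + 1

/-- A solution of the polynomial system is approximated by a row, up to a permutation. -/
structure IsBlochDecimal (D b s g : ℝ) (x t y : Fin 3 → ℝ) (σ : Equiv.Perm (Fin 3))
    (r : BlochRow) : Prop where
  D : IsDecimal D r.D
  b : IsDecimal b r.b
  s : IsDecimal s r.s
  g : IsDecimal g r.g
  x : ∀ j, IsDecimal (x (σ j)) (r.x j)
  t : ∀ j, IsDecimal (t (σ j)) (r.t j)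
  y : ∀ j, IsDecimal (y (σ j)) (r.y j)

lemma IsReordering.exists_isBlochDecimal {D b s g : ℝ} {x t y x' t' y' : Fin 3 → ℝ} (r : BlochRow)
    (hr : ∃ i, blochTable i = r) (h : IsReordering x t y x' t' y') (hD : IsDecimal D r.D)
    (hb : IsDecimal b r.b) (hs : IsDecimal s r.s) (hg : IsDecimal g r.g)
    (hx : IsDecimal (x' 0) (r.x 0) ∧ IsDecimal (x' 1) (r.x 1) ∧ IsDecimal (x' 2) (r.x 2))
    (ht : IsDecimal (t' 0) (r.t 0) ∧ IsDecimal (t' 1) (r.t 1) ∧ IsDecimal (t' 2) (r.t 2))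
    (hy : IsDecimal (y' 0) (r.y 0) ∧ IsDecimal (y' 1) (r.y 1) ∧ IsDecimal (y' 2) (r.y 2)) :
    ∃ i σ, IsBlochDecimal D b s g x t y σ (blochTable i) := by
  obtain ⟨σ, h⟩ := h
  obtain ⟨i, rfl⟩ := hr
  refine ⟨i, σ, hD, hb, hs, hg, fun j => ?_, fun j => ?_, fun j => ?_⟩
  · rw [(h j).1]
    fin_cases j
    exacts [hx.1, hx.2.1, hx.2.2]
  · rw [(h j).2.1]
    fin_cases j
    exacts [ht.1, ht.2.1, ht.2.2]
  · rw [(h j).2.2]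
    fin_cases j
    exacts [hy.1, hy.2.1, hy.2.2]

lemma bounds_of_sq_eq {z a b m : ℝ} (h : z ^ 2 = m) (ha : a ^ 2 ≤ m) (hb : m ≤ b ^ 2)
    (hb0 : 0 ≤ b) : (a ≤ z ∧ z ≤ b) ∨ (-b ≤ z ∧ z ≤ -a) := by
  have hb' := abs_le.1 (abs_le_of_sq_le_sq (h.trans_le hb) hb0)
  have ha' : a ≤ |z| := le_of_not_gt fun hlt => by
    have := sq_abs z
    nlinarith [abs_nonneg z]
  rcases le_total 0 z with hz | hz
  · rw [abs_of_nonneg hz] at ha'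
    exact Or.inl ⟨ha', hb'.2⟩
  · rw [abs_of_nonpos hz] at ha'
    exact Or.inr ⟨hb'.1, by linarith⟩

/-- Nine decimals of each square root suffice to place the linear expressions in the solutions
within one unit of `10⁻⁷`. -/
lemma bounds_of_sq_eq_five {f : ℝ} (h : f ^ 2 = 5) :
    (2236067977 ≤ 1000000000 * f ∧ 1000000000 * f ≤ 2236067978) ∨
      (-2236067978 ≤ 1000000000 * f ∧ 1000000000 * f ≤ -2236067977) :=
  bounds_of_sq_eq (by rw [mul_pow, h]) (by norm_num) (by norm_num) (by norm_num)

lemma bounds_of_sq_eq_two {f : ℝ} (h : f ^ 2 = 2) :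
    (1414213562 ≤ 1000000000 * f ∧ 1000000000 * f ≤ 1414213563) ∨
      (-1414213563 ≤ 1000000000 * f ∧ 1000000000 * f ≤ -1414213562) :=
  bounds_of_sq_eq (by rw [mul_pow, h]) (by norm_num) (by norm_num) (by norm_num)

lemma bounds_of_sq_eq_three {f : ℝ} (h : f ^ 2 = 3) :
    (1732050807 ≤ 1000000000 * f ∧ 1000000000 * f ≤ 1732050808) ∨
      (-1732050808 ≤ 1000000000 * f ∧ 1000000000 * f ≤ -1732050807) :=
  bounds_of_sq_eq (by rw [mul_pow, h]) (by norm_num) (by norm_num) (by norm_num)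

lemma bounds_of_sq_eq_six {f : ℝ} (h : f ^ 2 = 6) :
    (2449489742 ≤ 1000000000 * f ∧ 1000000000 * f ≤ 2449489743) ∨
      (-2449489743 ≤ 1000000000 * f ∧ 1000000000 * f ≤ -2449489742) :=
  bounds_of_sq_eq (by rw [mul_pow, h]) (by norm_num) (by norm_num) (by norm_num)

lemma exists_perm_apply_zero_one :
    ∀ i j : Fin 3, i ≠ j → ∃ σ : Equiv.Perm (Fin 3), σ 0 = i ∧ σ 1 = j := by
  decide

/-! ### Every solution of the system appears in the table -/

namespace IsBlochSystem

variable {D b s g c : ℝ} {x t y : Fin 3 → ℝ}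

lemma exists_isBlochDecimal_of_planar_distinct (hD : D * (1 - c) = 4)
    (h : ∃ f : ℝ, f ^ 2 = 5 ∧ b = f / 5 ∧ g = f / 5 ∧ c = -5 ∧ IsReordering x t y
      ![-1, 1 + 2 * f / 5, 1 - 2 * f / 5] ![0, 0, 0] ![-2, 1 - 3 * f / 5, 1 + 3 * f / 5]) :
    ∃ i σ, IsBlochDecimal D b 0 g x t y σ (blochTable i) := by
  obtain ⟨f, hf, rfl, rfl, rfl, hr⟩ := h
  rcases bounds_of_sq_eq_five hf with ⟨f1, f2⟩ | ⟨f1, f2⟩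
  · refine IsReordering.exists_isBlochDecimal ⟨6666667, 4472136, 0, 4472136, ![-10000000, 18944272, 1055728], ![0, 0, 0], ![-20000000, -3416408, 23416408]⟩ ⟨0, rfl⟩ hr ?_ ?_ ?_ ?_ ?_ ?_ ?_ <;>
    simp only [IsDecimal, Matrix.cons_val, Int.cast_neg, Int.cast_ofNat, Int.cast_zero] <;>
    refine ⟨?_, ?_⟩ <;> (try refine ⟨?_, ?_⟩) <;> (try refine ⟨?_, ?_⟩) <;>
    linarith only [hD, f1, f2]
  · refine IsReordering.exists_isBlochDecimal ⟨6666667, -4472136, 0, -4472136, ![-10000000, 1055728, 18944272], ![0, 0, 0], ![-20000000, 23416408, -3416408]⟩ ⟨1, rfl⟩ hr ?_ ?_ ?_ ?_ ?_ ?_ ?_ <;>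
    simp only [IsDecimal, Matrix.cons_val, Int.cast_neg, Int.cast_ofNat, Int.cast_zero] <;>
    refine ⟨?_, ?_⟩ <;> (try refine ⟨?_, ?_⟩) <;> (try refine ⟨?_, ?_⟩) <;>
    linarith only [hD, f1, f2]

lemma exists_isBlochDecimal_of_planar_equal (h : IsBlochSystem b 0 g c x t y)
    (hD : D * (1 - c) = 4) (ht : ∀ j, t j = 0) (hx : x 1 = x 2) (hy : y 1 = y 2) :
    ∃ i σ, IsBlochDecimal D b 0 g x t y σ (blochTable i) := by
  obtain ⟨hx0, hy0, h⟩ := h.planar_equal ht hx hy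
  have hr : IsReordering x t y ![1 - 2 * x 1, x 1, x 1] ![0, 0, 0] ![-2 * y 1, y 1, y 1] := by
    refine ⟨Equiv.refl _, fun j => ?_⟩
    fin_cases j
    exacts [⟨hx0, ht 0, hy0⟩, ⟨rfl, ht 1, rfl⟩, ⟨hx.symm, ht 2, hy.symm⟩]
  rcases h with ⟨hx1, hy1, rfl, f, hf, rfl, rfl⟩ | ⟨hx1, hy1, rfl, f, hf, rfl, rfl⟩ <;>
    rw [hx1, hy1] at hr <;> rcases bounds_of_sq_eq_five hf with ⟨f1, f2⟩ | ⟨f1, f2⟩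
  · refine IsReordering.exists_isBlochDecimal ⟨33333333, 2683282, 0, 6260990, ![-2000000, 6000000, 6000000], ![0, 0, 0], ![-8000000, 4000000, 4000000]⟩ ⟨8, rfl⟩ hr ?_ ?_ ?_ ?_ ?_ ?_ ?_ <;>
    simp only [IsDecimal, Matrix.cons_val, Int.cast_neg, Int.cast_ofNat, Int.cast_zero] <;>
    refine ⟨?_, ?_⟩ <;> (try refine ⟨?_, ?_⟩) <;> (try refine ⟨?_, ?_⟩) <;>
    linarith only [hD, f1, f2]
  · refine IsReordering.exists_isBlochDecimal ⟨33333333, -2683282, 0, -6260990, ![-2000000, 6000000, 6000000], ![0, 0, 0], ![-8000000, 4000000, 4000000]⟩ ⟨9, rfl⟩ hr ?_ ?_ ?_ ?_ ?_ ?_ ?_ <;>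
    simp only [IsDecimal, Matrix.cons_val, Int.cast_neg, Int.cast_ofNat, Int.cast_zero] <;>
    refine ⟨?_, ?_⟩ <;> (try refine ⟨?_, ?_⟩) <;> (try refine ⟨?_, ?_⟩) <;>
    linarith only [hD, f1, f2]
  · refine IsReordering.exists_isBlochDecimal ⟨60000000, 4472136, 0, 4472136, ![3333333, 3333333, 3333333], ![0, 0, 0], ![0, 0, 0]⟩ ⟨10, rfl⟩ hr ?_ ?_ ?_ ?_ ?_ ?_ ?_ <;>
    simp only [IsDecimal, Matrix.cons_val, Int.cast_ofNat, Int.cast_zero] <;>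
    refine ⟨?_, ?_⟩ <;> (try refine ⟨?_, ?_⟩) <;> (try refine ⟨?_, ?_⟩) <;>
    linarith only [hD, f1, f2]
  · refine IsReordering.exists_isBlochDecimal ⟨60000000, -4472136, 0, -4472136, ![3333333, 3333333, 3333333], ![0, 0, 0], ![0, 0, 0]⟩ ⟨11, rfl⟩ hr ?_ ?_ ?_ ?_ ?_ ?_ ?_ <;>
    simp only [IsDecimal, Matrix.cons_val, Int.cast_neg, Int.cast_ofNat, Int.cast_zero] <;>
    refine ⟨?_, ?_⟩ <;> (try refine ⟨?_, ?_⟩) <;> (try refine ⟨?_, ?_⟩) <;>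
    linarith only [hD, f1, f2]

lemma exists_isBlochDecimal_of_one_zero (h : IsBlochSystem b 0 g c x t y)
    (hD : D * (1 - c) = 4) (h0 : t 0 = 0) (h1 : t 1 ≠ 0) :
    ∃ i σ, IsBlochDecimal D b 0 g x t y σ (blochTable i) := by
  obtain ⟨hx2, hy2, ht2, hx0, hy0, h⟩ := h.one_zero h0 h1
  have hr : ∀ τ, t 1 = τ ∨ t 1 = -τ →
      IsReordering x t y ![1 - 2 * x 1, x 1, x 1] ![0, τ, -τ] ![-2 * y 1, y 1, y 1] := by
    rintro τ (hτ | hτ)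
    · refine ⟨Equiv.refl _, fun j => ?_⟩
      fin_cases j
      exacts [⟨hx0, h0, hy0⟩, ⟨rfl, hτ, rfl⟩, ⟨hx2, by rw [← hτ]; exact ht2, hy2⟩]
    · refine ⟨Equiv.swap 1 2, fun j => ?_⟩
      fin_cases j
      exacts [⟨hx0, h0, hy0⟩, ⟨hx2, ht2.trans (by rw [hτ]; exact neg_neg τ), hy2⟩, ⟨rfl, hτ, rfl⟩]
  rcases h with ⟨rfl, hg, rfl, ht, hx1, hy1⟩ | ⟨f, ε, hf, hε, rfl, rfl, rfl, ht, hx1, hy1⟩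
  · obtain ⟨k, hk, hk'⟩ : ∃ k, k = 2 * |t 1| ∧ k ^ 2 = 3 :=
      ⟨_, rfl, by rw [mul_pow, sq_abs, ht]; norm_num⟩
    have hr := hr (k / 2) (by
      rw [hk, mul_div_cancel_left₀ _ two_ne_zero]
      rcases abs_choice (t 1) with h | h <;> rw [h]
      · exact Or.inl rfl
      · exact Or.inr (neg_neg _).symm)
    rw [hx1, hy1] at hr
    have hk0 : 0 ≤ k := by rw [hk]; positivity
    obtain ⟨k1, k2⟩ := (bounds_of_sq_eq_three hk').resolve_right fun hh => by linarith
    rcases bounds_of_sq_eq_two (f := 2 * g) (by linarith) with ⟨f1, f2⟩ | ⟨f1, f2⟩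
    · refine IsReordering.exists_isBlochDecimal ⟨13333333, 0, 0, 7071068, ![10000000, 0, 0], ![0, 8660254, -8660254], ![10000000, -5000000, -5000000]⟩ ⟨2, rfl⟩ hr ?_ ?_ ?_ ?_ ?_ ?_ ?_ <;>
    simp only [IsDecimal, Matrix.cons_val, Int.cast_neg, Int.cast_ofNat, Int.cast_zero] <;>
    refine ⟨?_, ?_⟩ <;> (try refine ⟨?_, ?_⟩) <;> (try refine ⟨?_, ?_⟩) <;>
    linarith only [hD, f1, f2, k1, k2]
    · refine IsReordering.exists_isBlochDecimal ⟨13333333, 0, 0, -7071068, ![10000000, 0, 0], ![0, 8660254, -8660254], ![10000000, -5000000, -5000000]⟩ ⟨3, rfl⟩ hr ?_ ?_ ?_ ?_ ?_ ?_ ?_ <;>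
    simp only [IsDecimal, Matrix.cons_val, Int.cast_neg, Int.cast_ofNat, Int.cast_zero] <;>
    refine ⟨?_, ?_⟩ <;> (try refine ⟨?_, ?_⟩) <;> (try refine ⟨?_, ?_⟩) <;>
    linarith only [hD, f1, f2, k1, k2]
  · have hr := hr _ (sq_eq_sq_iff_eq_or_eq_neg.1 ht)
    rw [hx1, hy1] at hr
    -- Rationalisation of `D = 44 / (60 - 18 f)`, making `D` linear in `f`.
    have hD : D = (20 + 6 * f) / 15 := by
      linear_combination (60 + 18 * f) / 180 * hD + 9 * D / 55 * hf
    rcases sq_eq_one_iff.1 hε with rfl | rfl <;>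
      rcases bounds_of_sq_eq_five hf with ⟨f1, f2⟩ | ⟨f1, f2⟩
    · refine IsReordering.exists_isBlochDecimal ⟨22277605, 5669153, 0, -1338305, ![7323389, 1338305, 1338305], ![0, 6180340, -6180340], ![-7007458, 3503729, 3503729]⟩ ⟨4, rfl⟩ hr ?_ ?_ ?_ ?_ ?_ ?_ ?_ <;>
    simp only [IsDecimal, Matrix.cons_val, Int.cast_neg, Int.cast_ofNat, Int.cast_zero] <;>
    refine ⟨?_, ?_⟩ <;> (try refine ⟨?_, ?_⟩) <;> (try refine ⟨?_, ?_⟩) <;>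
    linarith only [hD, f1, f2]
    · refine IsReordering.exists_isBlochDecimal ⟨4389061, 1603575, 0, 6792851, ![23585702, -6792851, -6792851], ![0, -16180340, 16180340], ![5189276, -2594638, -2594638]⟩ ⟨6, rfl⟩ hr ?_ ?_ ?_ ?_ ?_ ?_ ?_ <;>
    simp only [IsDecimal, Matrix.cons_val, Int.cast_neg, Int.cast_ofNat, Int.cast_zero] <;>
    refine ⟨?_, ?_⟩ <;> (try refine ⟨?_, ?_⟩) <;> (try refine ⟨?_, ?_⟩) <;>
    linarith only [hD, f1, f2]
    · refine IsReordering.exists_isBlochDecimal ⟨22277605, -5669153, 0, 1338305, ![7323389, 1338305, 1338305], ![0, 6180340, -6180340], ![-7007458, 3503729, 3503729]⟩ ⟨5, rfl⟩ hr ?_ ?_ ?_ ?_ ?_ ?_ ?_ <;>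
    simp only [IsDecimal, Matrix.cons_val, Int.cast_neg, Int.cast_ofNat, Int.cast_zero] <;>
    refine ⟨?_, ?_⟩ <;> (try refine ⟨?_, ?_⟩) <;> (try refine ⟨?_, ?_⟩) <;>
    linarith only [hD, f1, f2]
    · refine IsReordering.exists_isBlochDecimal ⟨4389061, -1603575, 0, -6792851, ![23585702, -6792851, -6792851], ![0, -16180340, 16180340], ![5189276, -2594638, -2594638]⟩ ⟨7, rfl⟩ hr ?_ ?_ ?_ ?_ ?_ ?_ ?_ <;>
    simp only [IsDecimal, Matrix.cons_val, Int.cast_neg, Int.cast_ofNat, Int.cast_zero] <;>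
    refine ⟨?_, ?_⟩ <;> (try refine ⟨?_, ?_⟩) <;> (try refine ⟨?_, ?_⟩) <;>
    linarith only [hD, f1, f2]

lemma exists_isBlochDecimal_of_five {e f : ℝ} (he : e ^ 2 = 1) (hf : f ^ 2 = 5)
    (hD : D * (1 - -1) = 4) (hr : IsReordering x t y ![1 / 3, 1 / 3 + 2 * f / 15, 1 / 3 - 2 * f / 15]
      ![-e / 3, e * (1 / 6 - 7 * f / 30), e * (1 / 6 + 7 * f / 30)]
      ![-1, 1 / 2 + f / 10, 1 / 2 - f / 10]) :
    ∃ i σ, IsBlochDecimal D (e * f / 15) (2 * f / 15) (-e * f / 5) x t y σ (blochTable i) := by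
  rcases sq_eq_one_iff.1 he with rfl | rfl <;>
    rcases bounds_of_sq_eq_five hf with ⟨f1, f2⟩ | ⟨f1, f2⟩
  · refine IsReordering.exists_isBlochDecimal ⟨20000000, 1490712, 2981424, -4472136, ![3333333, 6314757, 351909], ![-3333333, -3550825, 6884159], ![-10000000, 7236068, 2763932]⟩ ⟨12, rfl⟩ hr ?_ ?_ ?_ ?_ ?_ ?_ ?_ <;>
    simp only [IsDecimal, Matrix.cons_val, Int.cast_neg, Int.cast_ofNat] <;>
    refine ⟨?_, ?_⟩ <;> (try refine ⟨?_, ?_⟩) <;> (try refine ⟨?_, ?_⟩) <;>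
    linarith only [hD, f1, f2]
  · refine IsReordering.exists_isBlochDecimal ⟨20000000, -1490712, -2981424, 4472136, ![3333333, 351909, 6314757], ![-3333333, 6884159, -3550825], ![-10000000, 2763932, 7236068]⟩ ⟨13, rfl⟩ hr ?_ ?_ ?_ ?_ ?_ ?_ ?_ <;>
    simp only [IsDecimal, Matrix.cons_val, Int.cast_neg, Int.cast_ofNat] <;>
    refine ⟨?_, ?_⟩ <;> (try refine ⟨?_, ?_⟩) <;> (try refine ⟨?_, ?_⟩) <;>
    linarith only [hD, f1, f2]
  · refine IsReordering.exists_isBlochDecimal ⟨20000000, -1490712, 2981424, 4472136, ![3333333, 6314757, 351909], ![3333333, 3550825, -6884159], ![-10000000, 7236068, 2763932]⟩ ⟨14, rfl⟩ hr ?_ ?_ ?_ ?_ ?_ ?_ ?_ <;>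
    simp only [IsDecimal, Matrix.cons_val, Int.cast_neg, Int.cast_ofNat] <;>
    refine ⟨?_, ?_⟩ <;> (try refine ⟨?_, ?_⟩) <;> (try refine ⟨?_, ?_⟩) <;>
    linarith only [hD, f1, f2]
  · refine IsReordering.exists_isBlochDecimal ⟨20000000, 1490712, -2981424, -4472136, ![3333333, 351909, 6314757], ![3333333, -6884159, 3550825], ![-10000000, 2763932, 7236068]⟩ ⟨15, rfl⟩ hr ?_ ?_ ?_ ?_ ?_ ?_ ?_ <;>
    simp only [IsDecimal, Matrix.cons_val, Int.cast_neg, Int.cast_ofNat] <;>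
    refine ⟨?_, ?_⟩ <;> (try refine ⟨?_, ?_⟩) <;> (try refine ⟨?_, ?_⟩) <;>
    linarith only [hD, f1, f2]

lemma exists_isBlochDecimal_of_two {m k : ℝ} (hh : m ^ 2 = 2) (hk : k ^ 2 = 3)
    (hD : D * (1 - -1 / 2) = 4) (hr : IsReordering x t y ![1 / 2, (1 + m) / 4, (1 - m) / 4]
      ![k / 4, k * (-1 + m) / 8, k * (-1 - m) / 8]
      ![1 / 4, -1 / 8 - 3 * m / 8, -1 / 8 + 3 * m / 8]) :
    ∃ i σ, IsBlochDecimal D (-m / 4) (m * k / 8) (m / 8) x t y σ (blochTable i) := by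
  -- Some coordinates contain the product `m k`, which is bounded as a square root of 6 with the
  -- sign read off from `m` and `k`.
  have hhk : (m * k) ^ 2 = 6 := by rw [mul_pow, hh, hk]; norm_num
  rcases bounds_of_sq_eq_two hh with ⟨f1, f2⟩ | ⟨f1, f2⟩ <;>
    rcases bounds_of_sq_eq_three hk with ⟨k1, k2⟩ | ⟨k1, k2⟩
  · obtain ⟨p1, p2⟩ := (bounds_of_sq_eq_six hhk).resolve_right fun hh => by
      linarith [mul_pos (show 0 < m by linarith) (show 0 < k by linarith)]
    refine IsReordering.exists_isBlochDecimal ⟨26666667, -3535534, 3061862, 1767767, ![5000000, 6035534, -1035534], ![4330127, 896799, -5226926], ![2500000, -6553301, 4053301]⟩ ⟨16, rfl⟩ hr ?_ ?_ ?_ ?_ ?_ ?_ ?_ <;>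
    simp only [IsDecimal, Matrix.cons_val, Int.cast_neg, Int.cast_ofNat] <;>
    refine ⟨?_, ?_⟩ <;> (try refine ⟨?_, ?_⟩) <;> (try refine ⟨?_, ?_⟩) <;>
    linarith only [hD, f1, f2, k1, k2, p1, p2]
  · obtain ⟨p1, p2⟩ := (bounds_of_sq_eq_six hhk).resolve_left fun hh => by
      linarith [mul_neg_of_pos_of_neg (show 0 < m by linarith) (show k < 0 by linarith)]
    refine IsReordering.exists_isBlochDecimal ⟨26666667, -3535534, -3061862, 1767767, ![5000000, 6035534, -1035534], ![-4330127, -896799, 5226926], ![2500000, -6553301, 4053301]⟩ ⟨17, rfl⟩ hr ?_ ?_ ?_ ?_ ?_ ?_ ?_ <;>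
    simp only [IsDecimal, Matrix.cons_val, Int.cast_neg, Int.cast_ofNat] <;>
    refine ⟨?_, ?_⟩ <;> (try refine ⟨?_, ?_⟩) <;> (try refine ⟨?_, ?_⟩) <;>
    linarith only [hD, f1, f2, k1, k2, p1, p2]
  · obtain ⟨p1, p2⟩ := (bounds_of_sq_eq_six hhk).resolve_left fun hh => by
      linarith [mul_neg_of_neg_of_pos (show m < 0 by linarith) (show 0 < k by linarith)]
    refine IsReordering.exists_isBlochDecimal ⟨26666667, 3535534, -3061862, -1767767, ![5000000, -1035534, 6035534], ![4330127, -5226926, 896799], ![2500000, 4053301, -6553301]⟩ ⟨18, rfl⟩ hr ?_ ?_ ?_ ?_ ?_ ?_ ?_ <;>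
    simp only [IsDecimal, Matrix.cons_val, Int.cast_neg, Int.cast_ofNat] <;>
    refine ⟨?_, ?_⟩ <;> (try refine ⟨?_, ?_⟩) <;> (try refine ⟨?_, ?_⟩) <;>
    linarith only [hD, f1, f2, k1, k2, p1, p2]
  · obtain ⟨p1, p2⟩ := (bounds_of_sq_eq_six hhk).resolve_right fun hh => by
      linarith [mul_pos_of_neg_of_neg (show m < 0 by linarith) (show k < 0 by linarith)]
    refine IsReordering.exists_isBlochDecimal ⟨26666667, 3535534, 3061862, -1767767, ![5000000, -1035534, 6035534], ![-4330127, 5226926, -896799], ![2500000, 4053301, -6553301]⟩ ⟨19, rfl⟩ hr ?_ ?_ ?_ ?_ ?_ ?_ ?_ <;>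
    simp only [IsDecimal, Matrix.cons_val, Int.cast_neg, Int.cast_ofNat] <;>
    refine ⟨?_, ?_⟩ <;> (try refine ⟨?_, ?_⟩) <;> (try refine ⟨?_, ?_⟩) <;>
    linarith only [hD, f1, f2, k1, k2, p1, p2]

lemma exists_isBlochDecimal_of_equal {e f : ℝ} (he : e ^ 2 = 1) (hf : f ^ 2 = 5)
    (hD : D * (1 - -1 / 5) = 4) (hr : IsReordering x t y ![-1 / 5, 3 / 5, 3 / 5]
      ![-2 * e / 5, e / 5, e / 5] ![2 / 5, -1 / 5, -1 / 5]) :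
    ∃ i σ, IsBlochDecimal D (-3 * e * f / 25) (4 * f / 25) (e * f / 25) x t y σ (blochTable i) := by
  rcases sq_eq_one_iff.1 he with rfl | rfl <;>
    rcases bounds_of_sq_eq_five hf with ⟨f1, f2⟩ | ⟨f1, f2⟩
  · refine IsReordering.exists_isBlochDecimal ⟨33333333, -2683282, 3577709, 894427, ![-2000000, 6000000, 6000000], ![-4000000, 2000000, 2000000], ![4000000, -2000000, -2000000]⟩ ⟨20, rfl⟩ hr ?_ ?_ ?_ ?_ ?_ ?_ ?_ <;>
    simp only [IsDecimal, Matrix.cons_val, Int.cast_neg, Int.cast_ofNat] <;>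
    refine ⟨?_, ?_⟩ <;> (try refine ⟨?_, ?_⟩) <;> (try refine ⟨?_, ?_⟩) <;>
    linarith only [hD, f1, f2]
  · refine IsReordering.exists_isBlochDecimal ⟨33333333, 2683282, -3577709, -894427, ![-2000000, 6000000, 6000000], ![-4000000, 2000000, 2000000], ![4000000, -2000000, -2000000]⟩ ⟨21, rfl⟩ hr ?_ ?_ ?_ ?_ ?_ ?_ ?_ <;>
    simp only [IsDecimal, Matrix.cons_val, Int.cast_neg, Int.cast_ofNat] <;>
    refine ⟨?_, ?_⟩ <;> (try refine ⟨?_, ?_⟩) <;> (try refine ⟨?_, ?_⟩) <;>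
    linarith only [hD, f1, f2]
  · refine IsReordering.exists_isBlochDecimal ⟨33333333, 2683282, 3577709, -894427, ![-2000000, 6000000, 6000000], ![4000000, -2000000, -2000000], ![4000000, -2000000, -2000000]⟩ ⟨22, rfl⟩ hr ?_ ?_ ?_ ?_ ?_ ?_ ?_ <;>
    simp only [IsDecimal, Matrix.cons_val, Int.cast_neg, Int.cast_ofNat] <;>
    refine ⟨?_, ?_⟩ <;> (try refine ⟨?_, ?_⟩) <;> (try refine ⟨?_, ?_⟩) <;>
    linarith only [hD, f1, f2]
  · refine IsReordering.exists_isBlochDecimal ⟨33333333, -2683282, -3577709, 894427, ![-2000000, 6000000, 6000000], ![4000000, -2000000, -2000000], ![4000000, -2000000, -2000000]⟩ ⟨23, rfl⟩ hr ?_ ?_ ?_ ?_ ?_ ?_ ?_ <;>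
    simp only [IsDecimal, Matrix.cons_val, Int.cast_neg, Int.cast_ofNat] <;>
    refine ⟨?_, ?_⟩ <;> (try refine ⟨?_, ?_⟩) <;> (try refine ⟨?_, ?_⟩) <;>
    linarith only [hD, f1, f2]

lemma exists_isBlochDecimal_of_skew (h : IsBlochSystem b s g c x t y) (hs : s ≠ 0)
    (hD : D * (1 - c) = 4) : ∃ i σ, IsBlochDecimal D b s g x t y σ (blochTable i) := by
  rcases h.skew hs with ⟨e, f, he, hf, rfl, rfl, rfl, rfl, hr⟩ |
    ⟨m, k, hh, hk, rfl, rfl, rfl, rfl, hr⟩ | ⟨e, f, he, hf, rfl, rfl, rfl, rfl, hr⟩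
  · exact exists_isBlochDecimal_of_five he hf hD hr
  · exact exists_isBlochDecimal_of_two hh hk hD hr
  · exact exists_isBlochDecimal_of_equal he hf hD hr

/-- For `s = 0`, either all `t` vanish, and the points are distinct or two of them coincide, or some
`t` is nonzero while another is zero by `not_all_ne_zero`. A permutation moves the special indices
to the positions expected by the lemmas above. -/
theorem exists_isBlochDecimal (h : IsBlochSystem b s g c x t y) (hD : D * (1 - c) = 4) :
    ∃ i σ, IsBlochDecimal D b s g x t y σ (blochTable i) := by
  have comp : ∀ σ : Equiv.Perm (Fin 3),
      (∃ i ρ, IsBlochDecimal D b s g (x ∘ σ) (t ∘ σ) (y ∘ σ) ρ (blochTable i)) →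
      ∃ i σ, IsBlochDecimal D b s g x t y σ (blochTable i) := by
    rintro σ ⟨i, ρ, hi⟩
    exact ⟨i, ρ.trans σ, hi.D, hi.b, hi.s, hi.g, hi.x, hi.t, hi.y⟩
  by_cases hs : s = 0
  · subst hs
    by_cases ht : ∀ j, t j = 0
    · by_cases hne : ∀ i j, x i = x j → y i = y j → i = j
      · exact exists_isBlochDecimal_of_planar_distinct hD (h.planar_distinct ht hne)
      · push Not at hne
        obtain ⟨i, j, h1, h2, hij⟩ := hne
        obtain ⟨σ, rfl, rfl⟩ := exists_perm_apply_one_two i j hij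
        exact comp σ ((h.comp_perm σ).exists_isBlochDecimal_of_planar_equal hD
          (fun j => ht _) h1 h2)
    · have hz := h.not_all_ne_zero
      push Not at ht hz
      obtain ⟨j, hj⟩ := ht
      obtain ⟨i, hi⟩ := hz
      obtain ⟨σ, rfl, rfl⟩ := exists_perm_apply_zero_one i j fun hij => hj (hij ▸ hi)
      exact comp σ ((h.comp_perm σ).exists_isBlochDecimal_of_one_zero hD hi hj)
  · exact h.exists_isBlochDecimal_of_skew hs hD

end IsBlochSystem

/-! ### Finite verification with Gaussian integers -/

/-- The entries computed from the rows of `blochTable` agree with those of `vectorTable`. -/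
lemma blochTable_entries : ∀ (i : Fin 24) (j : Fin 3),
    let r := blochTable i
    let L : GaussianInt := leftEntry ⟨0, 1⟩ 10000000 (r.D : GaussianInt) r.b r.s r.g
      (r.x j) (r.t j) (r.y j) (r.x 0) (r.t 0) (r.y 0)
    let R : GaussianInt := rightEntry ⟨0, 1⟩ 10000000 (r.D : GaussianInt) r.b r.s r.g
      (r.x j) (r.t j) (r.y j) (r.x 0) (r.t 0) (r.y 0)
    let A := (vectorTable (i.castLE (by norm_num))).1 j
    let B := (vectorTable (i.castLE (by norm_num))).2 j
    (|L.re - 8 * 10 ^ 24 * A.re| ≤ 8 * 10 ^ 24 ∧ |L.im - 8 * 10 ^ 24 * A.im| ≤ 8 * 10 ^ 24) ∧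
      |R.re - 8 * 10 ^ 24 * B.re| ≤ 8 * 10 ^ 24 ∧ |R.im - 8 * 10 ^ 24 * B.im| ≤ 8 * 10 ^ 24 := by
  decide +kernel

lemma blochTable_bounds : ∀ i : Fin 24, |(blochTable i).D| ≤ 61000000 ∧
    |(blochTable i).b| ≤ 29000000 ∧ |(blochTable i).s| ≤ 29000000 ∧ |(blochTable i).g| ≤ 29000000 ∧
    ∀ j, |(blochTable i).x j| ≤ 29000000 ∧ |(blochTable i).t j| ≤ 29000000 ∧
      |(blochTable i).y j| ≤ 29000000 := by
  decide +kernel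

/-- No two vectors of the table are unbiased. -/
lemma vectorTable_norm : ∀ (σ : Equiv.Perm (Fin 3)) (k l : Fin 26),
    let n := Zsqrtd.norm (star ((vectorTable k).1 0) * (vectorTable l).1 (σ 0) +
        star ((vectorTable k).2 0) * (vectorTable l).2 (σ 0) +
      (star ((vectorTable k).1 1) * (vectorTable l).1 (σ 1) +
        star ((vectorTable k).2 1) * (vectorTable l).2 (σ 1)) +
      (star ((vectorTable k).1 2) * (vectorTable l).1 (σ 2) +
        star ((vectorTable k).2 2) * (vectorTable l).2 (σ 2)))
    n ≤ 56 * 10 ^ 15 ∨ 64 * 10 ^ 15 ≤ n := by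
  decide +kernel

lemma IsDecimal.isNear {a : ℝ} {n : ℤ} (h : IsDecimal a n) (hn : |n| ≤ 29000000) :
    IsNear (1 / 10 ^ 7) a (n / 10 ^ 7) := by
  have hn : |(n : ℝ)| ≤ 29000000 := by exact_mod_cast hn
  obtain ⟨h1, h2⟩ := h
  obtain ⟨h3, h4⟩ := abs_le.1 hn
  exact ⟨abs_le.2 ⟨by linarith, by linarith⟩, abs_le.2 ⟨by linarith, by linarith⟩,
    abs_le.2 ⟨by linarith, by linarith⟩⟩

/-- With `n` included, the entries are homogeneous of degree four. Scaling all arguments by `10⁷`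
therefore multiplies them by `10²⁸`, which permits exact integer arithmetic. -/
lemma toComplex_entry (D b s g x t y x₀ t₀ y₀ : ℤ) :
    GaussianInt.toComplex (leftEntry ⟨0, 1⟩ 10000000 (D : GaussianInt) b s g x t y x₀ t₀ y₀) =
      10 ^ 28 * leftEntry Complex.I 1 ((D / 10 ^ 7 : ℝ) : ℂ) ((b / 10 ^ 7 : ℝ) : ℂ)
        ((s / 10 ^ 7 : ℝ) : ℂ) ((g / 10 ^ 7 : ℝ) : ℂ) ((x / 10 ^ 7 : ℝ) : ℂ)
        ((t / 10 ^ 7 : ℝ) : ℂ) ((y / 10 ^ 7 : ℝ) : ℂ) ((x₀ / 10 ^ 7 : ℝ) : ℂ)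
        ((t₀ / 10 ^ 7 : ℝ) : ℂ) ((y₀ / 10 ^ 7 : ℝ) : ℂ) ∧
    GaussianInt.toComplex (rightEntry ⟨0, 1⟩ 10000000 (D : GaussianInt) b s g x t y x₀ t₀ y₀) =
      10 ^ 28 * rightEntry Complex.I 1 ((D / 10 ^ 7 : ℝ) : ℂ) ((b / 10 ^ 7 : ℝ) : ℂ)
        ((s / 10 ^ 7 : ℝ) : ℂ) ((g / 10 ^ 7 : ℝ) : ℂ) ((x / 10 ^ 7 : ℝ) : ℂ)
        ((t / 10 ^ 7 : ℝ) : ℂ) ((y / 10 ^ 7 : ℝ) : ℂ) ((x₀ / 10 ^ 7 : ℝ) : ℂ)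
        ((t₀ / 10 ^ 7 : ℝ) : ℂ) ((y₀ / 10 ^ 7 : ℝ) : ℂ) := by
  have hI : GaussianInt.toComplex ⟨0, 1⟩ = Complex.I := by simp [GaussianInt.toComplex_def']
  constructor <;>
    simp only [leftEntry, rightEntry, map_mul, map_add, map_sub, map_neg, map_intCast, map_ofNat,
      map_zero, hI, Complex.ofReal_div, Complex.ofReal_pow, Complex.ofReal_intCast,
      Complex.ofReal_ofNat] <;>
    ring

/-- Error budget: `166000 / 10⁷` from rounding the solution and `16 / 10⁴` from rounding the real
and imaginary parts of the table entry, both divided by 8. The total is below `25 / 10⁴`. -/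
lemma norm_sub_le_of_entry {z L : ℂ} {G A : GaussianInt} (h : ‖8 * z - L‖ ≤ 166000 / 10 ^ 7)
    (hL : GaussianInt.toComplex G = 10 ^ 28 * L) (hre : |G.re - 8 * 10 ^ 24 * A.re| ≤ 8 * 10 ^ 24)
    (him : |G.im - 8 * 10 ^ 24 * A.im| ≤ 8 * 10 ^ 24) :
    ‖z - GaussianInt.toComplex A / 10 ^ 4‖ ≤ 25 / 10 ^ 4 := by
  have hre' : |(G.re - 8 * 10 ^ 24 * A.re : ℝ)| ≤ 8 * 10 ^ 24 := by exact_mod_cast hre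
  have him' : |(G.im - 8 * 10 ^ 24 * A.im : ℝ)| ≤ 8 * 10 ^ 24 := by exact_mod_cast him
  have h2 : ‖GaussianInt.toComplex G - 8 * 10 ^ 24 * GaussianInt.toComplex A‖ ≤ 16 * 10 ^ 24 := by
    rw [GaussianInt.toComplex_def, GaussianInt.toComplex_def]
    have e : ((G.re : ℂ) + G.im * Complex.I - 8 * 10 ^ 24 * (A.re + A.im * Complex.I)) =
        ((G.re - 8 * 10 ^ 24 * A.re : ℝ) : ℂ) +
          Complex.I * ((G.im - 8 * 10 ^ 24 * A.im : ℝ) : ℂ) := by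
      push_cast; ring
    rw [e]
    exact (norm_re_add_im_le _ _).trans (by linarith)
  have e : (8 * 10 ^ 28 : ℂ) * (z - GaussianInt.toComplex A / 10 ^ 4) =
      10 ^ 28 * (8 * z - L) +
        (GaussianInt.toComplex G - 8 * 10 ^ 24 * GaussianInt.toComplex A) := by
    rw [hL]; ring
  have h3 := congrArg norm e
  rw [norm_mul] at h3
  have h4 : ‖(8 * 10 ^ 28 : ℂ)‖ = 8 * 10 ^ 28 := by norm_num
  have h5 : ‖(10 ^ 28 : ℂ) * (8 * z - L)‖ ≤ 10 ^ 28 * (166000 / 10 ^ 7) := by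
    rw [norm_mul, norm_pow, Complex.norm_ofNat]
    gcongr
  have h6 := norm_add_le ((10 ^ 28 : ℂ) * (8 * z - L))
    (GaussianInt.toComplex G - 8 * 10 ^ 24 * GaussianInt.toComplex A)
  rw [← h3, h4] at h6
  exact le_of_mul_le_mul_left (h6.trans ((add_le_add h5 h2).trans (by norm_num))) (by norm_num)

/-- The vector `(u, v)` is, up to permutation and phase, close to a vector of the table. -/
def IsTableClose (u v : Fin 3 → ℂ) (k : Fin 26) : Prop :=
  IsBlockClose (25 / 10 ^ 4) u v (fun j => GaussianInt.toComplex ((vectorTable k).1 j) / 10 ^ 4)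
    fun j => GaussianInt.toComplex ((vectorTable k).2 j) / 10 ^ 4

lemma IsBlochDecimal.isTableClose {u v : Fin 3 → ℂ} {d₀ d₁ : ℂ} {D b s g : ℝ} {x t y : Fin 3 → ℝ}
    {σ : Equiv.Perm (Fin 3)} {i : Fin 24} (h : IsBlochDecimal D b s g x t y σ (blochTable i))
    (hu : ∀ j, ‖u j‖ = 1) (hF : IsBlochForm u v d₀ d₁ D b s g x t y) :
    IsTableClose u v (i.castLE (by norm_num)) := by
  refine IsBlockClose.of_mul_conj hu σ fun j => ?_
  obtain ⟨hD, hb, hs, hg, hq⟩ := blochTable_bounds i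
  obtain ⟨⟨e1, e2⟩, e3, e4⟩ := blochTable_entries i j
  have hD' : |((blochTable i).D : ℝ)| ≤ 61000000 := by exact_mod_cast hD
  obtain ⟨l, r⟩ := toComplex_entry (blochTable i).D (blochTable i).b (blochTable i).s
    (blochTable i).g ((blochTable i).x j) ((blochTable i).t j) ((blochTable i).y j)
    ((blochTable i).x 0) ((blochTable i).t 0) ((blochTable i).y 0)
  obtain ⟨m, n⟩ := norm_entry_sub_le (δ := 1 / 10 ^ 7) (D := D) (D' := (blochTable i).D / 10 ^ 7)
    (abs_le.2 ⟨by linarith [(abs_le.1 hD').1], by linarith [(abs_le.1 hD').2]⟩)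
    (abs_le.2 ⟨by linarith [h.D.1], by linarith [h.D.2]⟩) (h.b.isNear hb) (h.s.isNear hs)
    (h.g.isNear hg) ((h.x j).isNear (hq j).1) ((h.t j).isNear (hq j).2.1)
    ((h.y j).isNear (hq j).2.2) ((h.x 0).isNear (hq 0).1) ((h.t 0).isNear (hq 0).2.1)
    ((h.y 0).isNear (hq 0).2.2)
  obtain ⟨p, q⟩ := hF.mul_conj_eq (σ j) (σ 0)
  rw [← p] at m
  rw [← q] at n
  exact ⟨norm_sub_le_of_entry (m.trans (by norm_num)) l e1 e2,
    norm_sub_le_of_entry (n.trans (by norm_num)) r e3 e4⟩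

lemma norm_re_im_sub_div_le {p q : ℝ} {A : GaussianInt} (h₁ : |10 ^ 4 * p - A.re| ≤ 1)
    (h₂ : |10 ^ 4 * q - A.im| ≤ 1) :
    ‖(p + Complex.I * q : ℂ) - GaussianInt.toComplex A / 10 ^ 4‖ ≤ 25 / 10 ^ 4 := by
  have e : (p + Complex.I * q : ℂ) - GaussianInt.toComplex A / 10 ^ 4 =
      ((p - A.re / 10 ^ 4 : ℝ) : ℂ) + Complex.I * ((q - A.im / 10 ^ 4 : ℝ) : ℂ) := by
    rw [GaussianInt.toComplex_def]; push_cast; ring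
  rw [e]
  obtain ⟨a, b⟩ := abs_le.1 h₁
  obtain ⟨c, d⟩ := abs_le.1 h₂
  have h1 : |p - A.re / 10 ^ 4| ≤ 1 / 10 ^ 4 := abs_le.2 ⟨by linarith, by linarith⟩
  have h2 : |q - A.im / 10 ^ 4| ≤ 1 / 10 ^ 4 := abs_le.2 ⟨by linarith, by linarith⟩
  exact (norm_re_add_im_le _ _).trans (by linarith)

lemma IsConferenceUnbiased.isTableClose_of_sum_eq_zero {u v : Fin 3 → ℂ}
    (h : IsConferenceUnbiased u v) (hu0 : ∑ k, u k = 0) (hv0 : ∑ k, v k = 0) :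
    ∃ k, IsTableClose u v k := by
  obtain ⟨σ, k, m, hk, hm, hm0, h1, h2, hv⟩ := h.of_sum_eq_zero hu0 hv0
  have h0 := Complex.mul_conj_of_norm_eq_one (h.norm_left (σ 0))
  obtain ⟨m1, m2⟩ := (bounds_of_sq_eq_three (f := 2 * m) (by linarith)).resolve_right fun hh => by
    linarith
  have p6 : (4 * (k * m)) ^ 2 = 6 := by
    rw [mul_pow, mul_pow, hk, hm]; norm_num
  have V : ∀ j, v j * conj (u (σ 0)) = k * (1 + Complex.I) * (u j * conj (u (σ 0))) := fun j => by
    rw [hv]; ring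
  have e0 : u (σ 0) * conj (u (σ 0)) = (1 : ℝ) + Complex.I * (0 : ℝ) := by
    rw [h0]; push_cast; ring
  have e1 : u (σ 1) * conj (u (σ 0)) = (-1 / 2 : ℝ) + Complex.I * (m : ℝ) := by
    rw [h1]; push_cast; ring
  have e2 : u (σ 2) * conj (u (σ 0)) = (-1 / 2 : ℝ) + Complex.I * (-m : ℝ) := by
    rw [h2]; push_cast; ring
  have f0 : v (σ 0) * conj (u (σ 0)) = (k : ℝ) + Complex.I * (k : ℝ) := by
    rw [V, h0]; ring
  have f1 : v (σ 1) * conj (u (σ 0)) = (-k / 2 - k * m : ℝ) + Complex.I * (-k / 2 + k * m : ℝ) := by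
    rw [V, h1]; push_cast; linear_combination k * m * Complex.I_sq
  have f2 : v (σ 2) * conj (u (σ 0)) = (-k / 2 + k * m : ℝ) + Complex.I * (-k / 2 - k * m : ℝ) := by
    rw [V, h2]; push_cast; linear_combination -k * m * Complex.I_sq
  have a1 : |(10 ^ 4 * m - (8660 : ℤ) : ℝ)| ≤ 1 := by
    push_cast
    exact abs_le.2 ⟨by linarith, by linarith⟩
  have a2 : |(10 ^ 4 * -m - (-8660 : ℤ) : ℝ)| ≤ 1 := by
    push_cast
    exact abs_le.2 ⟨by linarith, by linarith⟩
  have a3 : |(10 ^ 4 * (-1 / 2) - (-5000 : ℤ) : ℝ)| ≤ 1 := by norm_num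
  have a4 : |(10 ^ 4 * 1 - (10000 : ℤ) : ℝ)| ≤ 1 := by norm_num
  have a5 : |(10 ^ 4 * 0 - (0 : ℤ) : ℝ)| ≤ 1 := by norm_num
  have key : ∀ (l : Fin 26) (n p q : ℤ),
      vectorTable l = (![⟨10000, 0⟩, ⟨-5000, 8660⟩, ⟨-5000, -8660⟩], ![⟨n, n⟩, ⟨p, q⟩, ⟨q, p⟩]) →
      |10 ^ 4 * k - n| ≤ 1 → |10 ^ 4 * (-k / 2 - k * m) - p| ≤ 1 →
      |10 ^ 4 * (-k / 2 + k * m) - q| ≤ 1 → IsTableClose u v l := by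
    intro l n p q hl g1 g2 g3
    rw [IsTableClose, hl]
    refine IsBlockClose.of_mul_conj h.norm_left σ fun j => ?_
    match j with
    | 0 =>
      rw [e0, f0]
      exact ⟨norm_re_im_sub_div_le (A := ⟨10000, 0⟩) a4 a5,
        norm_re_im_sub_div_le (A := ⟨n, n⟩) g1 g1⟩
    | 1 =>
      rw [e1, f1]
      exact ⟨norm_re_im_sub_div_le (A := ⟨-5000, 8660⟩) a3 a1,
        norm_re_im_sub_div_le (A := ⟨p, q⟩) g2 g3⟩
    | 2 =>
      rw [e2, f2]
      exact ⟨norm_re_im_sub_div_le (A := ⟨-5000, -8660⟩) a3 a2,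
        norm_re_im_sub_div_le (A := ⟨q, p⟩) g3 g2⟩
  rcases bounds_of_sq_eq_two (f := 2 * k) (by linarith) with ⟨k1, k2⟩ | ⟨k1, k2⟩
  · obtain ⟨p1, p2⟩ := (bounds_of_sq_eq_six p6).resolve_right fun hh => by
      linarith [mul_pos (show 0 < k by linarith) (show 0 < m by linarith)]
    refine ⟨24, key 24 7071 (-9659) 2588 rfl ?_ ?_ ?_⟩ <;> push_cast <;>
      refine abs_le.2 ⟨?_, ?_⟩ <;> linarith
  · obtain ⟨p1, p2⟩ := (bounds_of_sq_eq_six p6).resolve_left fun hh => by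
      linarith [mul_neg_of_neg_of_pos (show k < 0 by linarith) (show 0 < m by linarith)]
    refine ⟨25, key 25 (-7071) 9659 (-2588) rfl ?_ ?_ ?_⟩ <;> push_cast <;>
      refine abs_le.2 ⟨?_, ?_⟩ <;> linarith

lemma IsConferenceUnbiased.exists_isTableClose {u v : Fin 3 → ℂ}
    (h : IsConferenceUnbiased u v) : ∃ k, IsTableClose u v k := by
  by_cases hV : ∑ k, u k = 0 ∧ ∑ k, v k = 0
  · exact h.isTableClose_of_sum_eq_zero hV.1 hV.2
  · obtain ⟨d₀, d₁, D, b, s, g, c, x, t, y, hD, hF, hS⟩ := h.exists_isBlochSystem hV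
    obtain ⟨i, σ, hi⟩ := hS.exists_isBlochDecimal hD
    exact ⟨_, hi.isTableClose h.norm_left hF⟩

lemma toComplex_star (z : GaussianInt) :
    GaussianInt.toComplex (star z) = conj (GaussianInt.toComplex z) := by
  rw [GaussianInt.toComplex_star]

lemma norm_add_six_sub_le {c x₁ x₂ x₃ x₄ x₅ x₆ y₁ y₂ y₃ y₄ y₅ y₆ : ℂ} {η : ℝ}
    (h₁ : ‖x₁ - c * y₁‖ ≤ η) (h₂ : ‖x₂ - c * y₂‖ ≤ η) (h₃ : ‖x₃ - c * y₃‖ ≤ η)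
    (h₄ : ‖x₄ - c * y₄‖ ≤ η) (h₅ : ‖x₅ - c * y₅‖ ≤ η) (h₆ : ‖x₆ - c * y₆‖ ≤ η) :
    ‖x₁ + x₂ + (x₃ + x₄) + (x₅ + x₆) - c * (y₁ + y₂ + (y₃ + y₄) + (y₅ + y₆))‖ ≤ 6 * η := by
  have e : x₁ + x₂ + (x₃ + x₄) + (x₅ + x₆) - c * (y₁ + y₂ + (y₃ + y₄) + (y₅ + y₆)) =
      (x₁ - c * y₁) + (x₂ - c * y₂) + ((x₃ - c * y₃) + (x₄ - c * y₄)) +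
        ((x₅ - c * y₅) + (x₆ - c * y₆)) := by ring
  rw [e]
  calc _ ≤ η + η + (η + η) + (η + η) := norm_add_le_of_le (norm_add_le_of_le
        (norm_add_le_of_le h₁ h₂) (norm_add_le_of_le h₃ h₄)) (norm_add_le_of_le h₅ h₆)
    _ = 6 * η := by ring

/-- Two unbiased vectors are not unbiased to each other. -/
lemma IsTableClose.norm_sq_ne_six {u v u' v' : Fin 3 → ℂ} {k l : Fin 26}
    (hu : ∀ j, ‖u j‖ = 1) (hv : ∀ j, ‖v j‖ = 1) (hu' : ∀ j, ‖u' j‖ = 1) (hv' : ∀ j, ‖v' j‖ = 1)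
    (h : IsTableClose u v k) (h' : IsTableClose u' v' l) :
    ‖∑ j, (conj (u j) * u' j + conj (v j) * v' j)‖ ^ 2 ≠ 6 := by
  obtain ⟨σ, μ, hμ, h⟩ := h
  obtain ⟨ρ, ν, hν, h'⟩ := h'
  -- Both vectors are known only up to the order of their blocks; the inner product depends on the
  -- relative permutation `τ`, over all of which the table check runs.
  obtain ⟨τ, hτ⟩ : ∃ τ : Equiv.Perm (Fin 3), τ = σ.trans ρ.symm := ⟨_, rfl⟩
  have h'' : ∀ j, ‖u' (σ j) - ν * (GaussianInt.toComplex ((vectorTable l).1 (τ j)) / 10 ^ 4)‖ ≤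
      25 / 10 ^ 4 ∧
      ‖v' (σ j) - ν * (GaussianInt.toComplex ((vectorTable l).2 (τ j)) / 10 ^ 4)‖ ≤ 25 / 10 ^ 4 := by
    intro j
    have := h' (τ j)
    rw [hτ, Equiv.trans_apply, Equiv.apply_symm_apply] at this
    rw [hτ]
    exact this
  have table := vectorTable_norm τ k l
  rw [← Equiv.sum_comp σ, Fin.sum_univ_three]
  generalize hz : star ((vectorTable k).1 0) * (vectorTable l).1 (τ 0) +
        star ((vectorTable k).2 0) * (vectorTable l).2 (τ 0) +
      (star ((vectorTable k).1 1) * (vectorTable l).1 (τ 1) +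
        star ((vectorTable k).2 1) * (vectorTable l).2 (τ 1)) +
      (star ((vectorTable k).1 2) * (vectorTable l).1 (τ 2) +
        star ((vectorTable k).2 2) * (vectorTable l).2 (τ 2)) = z at table
  have hZ := congrArg GaussianInt.toComplex hz
  simp only [map_add, map_mul, toComplex_star] at hZ
  have a := fun j => norm_inner_sub_le (hu (σ j)) (hu' (σ j)) (h j).1 (h'' j).1
  have b := fun j => norm_inner_sub_le (hv (σ j)) (hv' (σ j)) (h j).2 (h'' j).2
  simp only [map_div₀, map_pow, Complex.conj_ofNat] at a b
  have a0 := a 0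
  have a1 := a 1
  have a2 := a 2
  have b0 := b 0
  have b1 := b 1
  have b2 := b 2
  have hd := norm_add_six_sub_le a0 b0 a1 b1 a2 b2
  generalize conj (u (σ 0)) * u' (σ 0) + conj (v (σ 0)) * v' (σ 0) +
      (conj (u (σ 1)) * u' (σ 1) + conj (v (σ 1)) * v' (σ 1)) +
      (conj (u (σ 2)) * u' (σ 2) + conj (v (σ 2)) * v' (σ 2)) = S at *
  have hc : ‖conj μ * ν‖ = 1 := by rw [norm_mul, Complex.norm_conj, hμ, hν, one_mul]
  -- Six terms, each with error at most `ε (2 + ε)` for `ε = 25 / 10⁴`, about 0.03 in all. The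
  -- denominator is `10⁸` because two table entries are multiplied.
  have hd : ‖S - conj μ * ν * (GaussianInt.toComplex z / 10 ^ 8)‖ ≤ 4 / 100 := by
    refine le_trans (le_of_eq ?_) (hd.trans (by norm_num))
    rw [← hZ]
    congr 2
    ring
  obtain ⟨m, hm⟩ : ∃ m, m = ‖GaussianInt.toComplex z / 10 ^ 8‖ := ⟨_, rfl⟩
  have hm' : ‖conj μ * ν * (GaussianInt.toComplex z / 10 ^ 8)‖ = m := by
    rw [norm_mul, hc, one_mul, hm]
  have hSm := abs_le.1 ((abs_norm_sub_norm_le _ _).trans hd)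
  rw [hm'] at hSm
  have hm2 : m ^ 2 = (Zsqrtd.norm z : ℝ) / 10 ^ 16 := by
    rw [hm, norm_div, norm_pow, Complex.norm_ofNat, div_pow, GaussianInt.intCast_real_norm,
      Complex.sq_norm]
    norm_num
  have hm0 : 0 ≤ m := hm ▸ norm_nonneg _
  intro h6
  have hS0 := norm_nonneg S
  generalize ‖S‖ = r at *
  -- The table gives `m² ≤ 5.6` or `m² ≥ 6.4`, hence `m ≤ 2.37` or `m ≥ 2.52`. An error of 0.04
  -- still keeps the square away from 6, since `2.41² < 6 < 2.48²`.
  rcases table with hn | hn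
  · have hn : (Zsqrtd.norm z : ℝ) ≤ 56 * 10 ^ 15 := by exact_mod_cast hn
    have h1 : m ≤ 237 / 100 := abs_le_of_sq_le_sq' (by linarith) (by norm_num) |>.2
    have h2 : r ≤ 241 / 100 := by linarith [hSm.2]
    nlinarith
  · have hn : (64 * 10 ^ 15 : ℝ) ≤ Zsqrtd.norm z := by exact_mod_cast hn
    have h1 : 252 / 100 ≤ m := by
      by_contra hlt
      nlinarith
    have h2 : 248 / 100 ≤ r := by linarith [hSm.1]
    nlinarith

/-- One vector from each basis already gives the contradiction: both are close to table vectors, and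
no two of these have an inner product of modulus near `√6`. -/
theorem not_hasUnbiasedPair_matM1 : ¬ HasUnbiasedPair matM1 := by
  rintro ⟨A, B, hA, hB, -, -, hAB⟩
  have hA' := (hA 0).isConferenceUnbiased
  have hB' := (hB 0).isConferenceUnbiased
  obtain ⟨k, hk⟩ := hA'.exists_isTableClose
  obtain ⟨l, hl⟩ := hB'.exists_isTableClose
  apply hk.norm_sq_ne_six hA'.norm_left hA'.norm_right hB'.norm_left hB'.norm_right hl
  rw [inner_leftPart_rightPart]
  have : ∑ k, conj (A.col 0 k) * B.col 0 k = (Aᴴ * B) 0 0 := rfl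
  rw [this, hAB, Real.sq_sqrt (by norm_num)]

/-! ### The main theorem -/

theorem mainTheorem1 (ω : ℂ)
    (hω : ω = Complex.exp (2 * Real.pi * Complex.I / 3) ∨
      ω = Complex.exp (4 * Real.pi * Complex.I / 3)) :
    -- both matrices are complex Hadamard matrices, and neither belongs to any CHM trio
    (IsCHM matM1 ∧ ¬ BelongsToCHMTrio matM1) ∧
    (IsCHM (matM2 ω) ∧ ¬ BelongsToCHMTrio (matM2 ω)) ∧
    -- the first one is equivalent to `D_0`
    ComplexEquivalent matM1 matD0 ∧
    -- the second one contains a Hadamard submatrix of order three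
    (∃ r c : Fin 3 → Fin 6, StrictMono r ∧ StrictMono c ∧
      (matM2 ω).submatrix r c = matC3 ω ∧ IsCHM ((matM2 ω).submatrix r c)) ∧
    -- the exclusion holds up to complex equivalence
    (∀ H : Matrix (Fin 6) (Fin 6) ℂ,
      ComplexEquivalent H matM1 ∨ ComplexEquivalent H (matM2 ω) → ¬ BelongsToCHMTrio H) ∧
    -- hence the matrices with more than 22 real entries that are equivalent to one of the two
    -- do not belong to any set of four mutually unbiased bases
    (∀ H : Matrix (Fin 6) (Fin 6) ℂ, IsCHM H → 22 < realEntryCount H →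
      ComplexEquivalent H matM1 ∨ ComplexEquivalent H (matM2 ω) → ¬ BelongsToMUBQuadruple H) := by
  obtain ⟨h1, h⟩ := cube_root_properties hω
  have hall : ∀ H : Matrix (Fin 6) (Fin 6) ℂ,
      ComplexEquivalent H matM1 ∨ ComplexEquivalent H (matM2 ω) → ¬ BelongsToMUBQuadruple H := by
    rintro H (hH | hH) hB
    · exact not_hasUnbiasedPair_matM1 (hH.hasUnbiasedPair hB)
    · exact not_hasUnbiasedPair_matM2 h1 h (hH.hasUnbiasedPair hB)
  have hsub := matM2_submatrix ω
  refine ⟨⟨isCHM_matM1, fun hB => hall _ (Or.inl (.refl _)) hB.belongsToMUBQuadruple⟩,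
    ⟨isCHM_matM2 h1 h, fun hB => hall _ (Or.inr (.refl _)) hB.belongsToMUBQuadruple⟩,
    complexEquivalent_matM1_matD0,
    ⟨![0, 2, 4], ![0, 2, 4], by decide, by decide, hsub, ?_⟩,
    fun H hH hB => hall H hH hB.belongsToMUBQuadruple, fun H _ _ hH => hall H hH⟩
  rw [hsub]
  exact isCHM_matC3 h1 h
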